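/- For $n\ge 1$ consider the closed simple walks of length $2n$ on $\mathbb Z$ starting and ending at $0$, i.e. the sequences $(p_0,\dots,p_{2n})$ of integers with $p_0=p_{2n}=0$ and $|p_i-p_{i-1}|=1$, and let $\Pr_n$ be the uniform probability on this finite set. For such a walk $w$ and $q\in\mathbb Z$ let the multiplicity $mu(q,w)=\delta_{q,p_0}+\delta_{q,p_{2n}}+2\sum_{i=1}^{2n-1}\delta_{q,p_i}$ be the number of steps arriving at $q$ plus the number of steps leaving $q$, and for $k\ge1$ let $N_{2k}(w)=\#\{q\in\mathbb Z : mu(q,w)=2k\}$. Then, as $n\to\infty$, $$\Pr\nolimits_n(N_2=0)=\frac14-\frac1{4n}-\frac1{48n^2}+\frac{13}{144n^3}+\frac{421}{2880n^4}+O\!\left(\frac1{n^5}\right),$$ $$\Pr\nolimits_n(N_2=1)=\frac12-\frac5{24n^2}-\frac{11}{36n^3}-\frac{511}{1440n^4}+O\!\left(\frac1{n^5}\right),$$ $$\Pr\nolimits_n(N_2=2)=\frac14+\frac1{4n}+\frac{11}{48n^2}+\frac{31}{144n^3}+\frac{601}{2880n^4}+O\!\left(\frac1{n^5}\right),$$ and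 for all integers $l>2$ $$\Pr\nolimits_n(N_4=l)=\alpha^l\,(\theta_0+l\,\theta_1)+O\!\left(\frac1n\right),$$ with an implied constant that does not depend on $l$, where $$\alpha=\frac{\pi^2}{24+\pi^2},\qquad \theta_1=\frac{1296}{\pi^8}\left(\frac{\frac{\pi^2}{3}-\zeta(3)}{1+\frac{\pi^2}{24}}\right)^2,$$ $$\theta_0=\frac{216}{\pi^6}\,\frac{\left(\frac{\pi^2}{3}-\zeta(3)\right)^2}{1+\frac{\pi^2}{24}}\left(\frac{4+\frac{\pi^2}{3}}{\frac{\pi^2}{3}-\zeta(3)}-\frac{3+\frac{\pi^2}{24}}{\frac{\pi^2}{6}\left(1+\frac{\pi^2}{24}\right)}-\frac{3}{4\left(1+\frac{\pi^2}{24}\right)}\right).$$ -/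

import Mathlib

open Filter Asymptotics

/-! Simple walks on `ℤ` starting at `0`; a walk of length `m` is its sequence of `m` steps `±1`. -/

namespace SimpleWalk

/-- The `i`-th point of the walk with step sequence `s` started at `0`:
the sum of its first `i` steps. -/
def point {m : ℕ} (s : Fin m → ℤˣ) (i : ℕ) : ℤ :=
  ∑ j ∈ Finset.univ.filter (fun j : Fin m => (j : ℕ) < i), ((s j : ℤˣ) : ℤ)

/-- The multiplicity of the site `q`: the number of steps of the walk that arrive at `q` plus
the number of steps that leave `q`. The initial and the final point count once,
every intermediate point counts twice. -/
def mult {m : ℕ} (q : ℤ) (s : Fin m → ℤˣ) : ℕ :=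
  (if q = point s 0 then 1 else 0) + (if q = point s m then 1 else 0)
    + 2 * ∑ i ∈ Finset.Ioo 0 m, (if q = point s i then 1 else 0)

/-- The `k`-multiple point range `N_{2k}` (for `k ≥ 1`): the number of sites of
multiplicity `2k`. -/
noncomputable def multRange {m : ℕ} (k : ℕ) (s : Fin m → ℤˣ) : ℕ :=
  Set.ncard {q : ℤ | mult q s = 2 * k}

/-- The closed walks of length `2n` starting (and hence ending) at `0`. -/
def closedWalks (n : ℕ) : Finset (Fin (2 * n) → ℤˣ) :=
  Finset.univ.filter fun s => point s (2 * n) = 0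

/-- `Pr_n`: the probability of the event `E` for a uniformly distributed closed simple walk of
length `2n`. -/
noncomputable def prob (n : ℕ) (E : (Fin (2 * n) → ℤˣ) → Prop) [DecidablePred E] : ℝ :=
  (((closedWalks n).filter E).card : ℝ) / ((closedWalks n).card : ℝ)

/-- The real number `ζ(3)`. -/
noncomputable def zeta3 : ℝ := (riemannZeta 3).re

noncomputable def alpha : ℝ := Real.pi ^ 2 / (24 + Real.pi ^ 2)

noncomputable def theta0 : ℝ :=
  216 / Real.pi ^ 6 * ((Real.pi ^ 2 / 3 - zeta3) ^ 2 / (1 + Real.pi ^ 2 / 24)) *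
    ((4 + Real.pi ^ 2 / 3) / (Real.pi ^ 2 / 3 - zeta3)
      - (3 + Real.pi ^ 2 / 24) / (Real.pi ^ 2 / 6 * (1 + Real.pi ^ 2 / 24))
      - 3 / (4 * (1 + Real.pi ^ 2 / 24)))

noncomputable def theta1 : ℝ :=
  1296 / Real.pi ^ 8 * ((Real.pi ^ 2 / 3 - zeta3) / (1 + Real.pi ^ 2 / 24)) ^ 2

end SimpleWalk

namespace SimpleWalk

/-! ### Counting walks with prescribed numbers of crossings -/

/-! A closed walk crosses every edge as often upwards as downwards, and the edges it uses form an
interval. Up to the position of the starting site it is described by a list `L` of positive crossing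
numbers, and a site of multiplicity `2k` is an adjacent pair with sum `k` in the list `0, L, 0`. On
a line the last exit from each site other than the end point must point towards the end point, so
the walks with given crossing numbers are counted by a product of binomial coefficients, one per
site (`card_trails`, the BEST theorem for a path). Summed over the starting site this is `2n` times
a weight `om L` (`headD_mul_sum_card_trails`). A probability is therefore `2n / C(2n, n)` times the
`n`-th coefficient of a generating function.

Multiplicity 2 occurs only at the two extreme sites, when the first or last entry is `1`.
Multiplicity 4 comes from a first or last entry `2` or from adjacent entries `1, 1`. The weight
factors when a list is cut between such ones (`gf_split`), so the number of these pairs contributes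
a geometric series. Everything reduces to the lists that begin with `1` and end with `1`, with `2`,
or arbitrarily. Reading a list entry by entry iterates the Möbius map `y ↦ 1 / (1 - x y)`, which `x
= u / (1 + u)²` makes explicit; the results are Lambert series of `σ₁` and `σ₂` and an elementary
function.

The singularity `x = 1/4` is `w = 1 - 4 x → 0`, that is `u = exp (-t) → 1` with `t = log ((1 + √w) /
(1 - √w))`. The inversion formula of the Eisenstein series `G₂` (`lambertP_exp_neg`) gives the `σ₁`
series up to an exponentially small error: its part odd in `√w` is `-(√w / 4) (2 √w / t)`, where `2
√w / t` is analytic in `w`. This yields the expansions for multiplicity 2 to any order. For `σ₂` a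
lattice sum compared with telescoping sums gives the leading terms, whence `ζ(3)`
(`norm_lambertQ_sub_le`).

A bound `O(|w|^κ)` near the disc becomes a bound `O(4ⁿ n^(-κ-1))` for coefficients
(`norm_coeff_le_of_discNbhd`), with constants independent of the function. Together with `|oneOne /
(1 + oneOne)| ≤ 9/11` near the disc this makes the multiplicity 4 estimate uniform in `l`. -/

lemma point_zero {m : ℕ} (s : Fin m → ℤˣ) : point s 0 = 0 := by
  simp [point]

lemma point_cons_succ {m : ℕ} (ε : ℤˣ) (s : Fin m → ℤˣ) (i : ℕ) :
    point (Fin.cons ε s : Fin (m + 1) → ℤˣ) (i + 1) = (ε : ℤ) + point s i := by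
  simp [point, Finset.sum_filter, Fin.sum_univ_succ]

/-- The number of steps `k → k + 1` of the walk with steps `s` started at `v`. -/
def ups {m : ℕ} (v : ℤ) (s : Fin m → ℤˣ) (k : ℤ) : ℕ :=
  (Finset.univ.filter fun i : Fin m => s i = 1 ∧ v + point s i = k).card

/-- The number of steps `k + 1 → k` of the walk with steps `s` started at `v`. -/
def downs {m : ℕ} (v : ℤ) (s : Fin m → ℤˣ) (k : ℤ) : ℕ :=
  (Finset.univ.filter fun i : Fin m => s i = -1 ∧ v + point s i = k + 1).card

lemma ups_cons {m : ℕ} (v : ℤ) (ε : ℤˣ) (s : Fin m → ℤˣ) (k : ℤ) :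
    ups v (Fin.cons ε s : Fin (m + 1) → ℤˣ) k
      = (if ε = 1 ∧ v = k then 1 else 0) + ups (v + ε) s k := by
  simp only [ups, Finset.card_filter, Fin.sum_univ_succ, Fin.cons_zero, Fin.cons_succ,
    Fin.val_zero, Fin.val_succ, point_cons_succ, point_zero, add_zero, add_assoc]

lemma downs_cons {m : ℕ} (v : ℤ) (ε : ℤˣ) (s : Fin m → ℤˣ) (k : ℤ) :
    downs v (Fin.cons ε s : Fin (m + 1) → ℤˣ) k
      = (if ε = -1 ∧ v = k + 1 then 1 else 0) + downs (v + ε) s k := by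
  simp only [downs, Finset.card_filter, Fin.sum_univ_succ, Fin.cons_zero, Fin.cons_succ,
    Fin.val_zero, Fin.val_succ, point_cons_succ, point_zero, add_zero, add_assoc]

open Classical in
/-- The step sequences of length `m` which, started at `v`, cross every edge upwards and downwards
the prescribed number of times. -/
noncomputable def trails (m : ℕ) (v : ℤ) (u d : ℤ → ℕ) : Finset (Fin m → ℤˣ) :=
  Finset.univ.filter fun s => ∀ k, ups v s k = u k ∧ downs v s k = d k

lemma mem_trails {m : ℕ} {v : ℤ} {u d : ℤ → ℕ} {s : Fin m → ℤˣ} :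
    s ∈ trails m v u d ↔ ∀ k, ups v s k = u k ∧ downs v s k = d k := by
  simp [trails]

lemma cons_one_mem_trails {m : ℕ} {v : ℤ} {u d : ℤ → ℕ} {s : Fin m → ℤˣ} :
    (Fin.cons 1 s : Fin (m + 1) → ℤˣ) ∈ trails (m + 1) v u d ↔
      1 ≤ u v ∧ s ∈ trails m (v + 1) (Function.update u v (u v - 1)) d := by
  have h1 : (1 : ℤˣ) ≠ -1 := by decide
  simp only [mem_trails, ups_cons, downs_cons, true_and, h1, false_and, if_false, zero_add,
    Units.val_one]
  constructor
  · intro h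
    have hv := (h v).1
    simp only [if_true] at hv
    refine ⟨by omega, fun k => ⟨?_, (h k).2⟩⟩
    by_cases hk : k = v
    · subst hk; rw [Function.update_self]; omega
    · rw [Function.update_of_ne hk]
      have := (h k).1
      rw [if_neg (Ne.symm hk)] at this
      omega
  · rintro ⟨h0, h⟩ k
    refine ⟨?_, (h k).2⟩
    have := (h k).1
    by_cases hk : k = v
    · subst hk; rw [Function.update_self] at this; rw [if_pos rfl]; omega
    · rw [Function.update_of_ne hk] at this
      rw [if_neg (Ne.symm hk)]; omega

lemma cons_neg_one_mem_trails {m : ℕ} {v : ℤ} {u d : ℤ → ℕ} {s : Fin m → ℤˣ} :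
    (Fin.cons (-1) s : Fin (m + 1) → ℤˣ) ∈ trails (m + 1) v u d ↔
      1 ≤ d (v - 1) ∧
        s ∈ trails m (v - 1) u (Function.update d (v - 1) (d (v - 1) - 1)) := by
  have h1 : (-1 : ℤˣ) ≠ 1 := by decide
  simp only [mem_trails, ups_cons, downs_cons, true_and, h1, false_and, if_false, zero_add,
    Units.val_one, Units.val_neg]
  constructor
  · intro h
    have hv := (h (v - 1)).2
    simp only [sub_add_cancel, if_true] at hv
    refine ⟨by omega, fun k => ⟨(h k).1, ?_⟩⟩
    by_cases hk : k = v - 1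
    · subst hk; rw [Function.update_self, sub_eq_add_neg]; rw [sub_eq_add_neg] at hv; omega
    · rw [Function.update_of_ne hk]
      have := (h k).2
      rw [if_neg (by omega)] at this
      rw [sub_eq_add_neg]; omega
  · rintro ⟨h0, h⟩ k
    refine ⟨(h k).1, ?_⟩
    have := (h k).2
    by_cases hk : k = v - 1
    · subst hk
      rw [Function.update_self, sub_eq_add_neg] at this
      rw [if_pos (by ring)]
      rw [sub_eq_add_neg] at h0 ⊢
      omega
    · rw [Function.update_of_ne hk, sub_eq_add_neg] at this
      rw [if_neg (by omega)]; omega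

lemma card_trails_succ (m : ℕ) (v : ℤ) (u d : ℤ → ℕ) :
    (trails (m + 1) v u d).card =
      (if 1 ≤ u v then (trails m (v + 1) (Function.update u v (u v - 1)) d).card else 0) +
      (if 1 ≤ d (v - 1) then
        (trails m (v - 1) u (Function.update d (v - 1) (d (v - 1) - 1))).card else 0) := by
  classical
  have key : (trails (m + 1) v u d).card
      = ∑ p : ℤˣ × (Fin m → ℤˣ),
        if (Fin.cons p.1 p.2 : Fin (m + 1) → ℤˣ) ∈ trails (m + 1) v u d then 1 else 0 := by
    refine Eq.trans ?_ (Fintype.sum_equiv (Fin.consEquiv fun _ : Fin (m + 1) => ℤˣ)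
      (fun p => if (Fin.cons p.1 p.2 : Fin (m + 1) → ℤˣ) ∈ trails (m + 1) v u d then 1 else 0)
      (fun s => if s ∈ trails (m + 1) v u d then 1 else 0) (fun p => rfl)).symm
    simp
  rw [key, Fintype.sum_prod_type]
  have hu : (Finset.univ : Finset ℤˣ) = {1, -1} := by decide
  rw [hu, Finset.sum_pair (by decide)]
  simp only [cons_one_mem_trails, cons_neg_one_mem_trails]
  congr 1
  · split_ifs with h <;> simp [h]
  · split_ifs with h <;> simp [h]

/-- The number of orders in which a trail ending at `r` can leave the vertex `i` along `x` upward
and `y` downward edges: the last exit from `i ≠ r` points towards `r`. -/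
def exitOrders (r i : ℤ) (x y : ℕ) : ℕ :=
  if r < i then (x + y - 1).choose x
  else if i < r then (x + y - 1).choose y
  else (x + y).choose x

lemma exitOrders_zero (r i : ℤ) : exitOrders r i 0 0 = 1 := by
  simp [exitOrders]

/-- Pascal's rule, by the direction of the next exit from `i`. The hypotheses keep available the
final exit towards `r`; without it the truncated subtraction in `exitOrders` would spoil the
recursion. -/
lemma exitOrders_step (r i : ℤ) (x y : ℕ) (h1 : r < i → 1 ≤ y) (h2 : i < r → 1 ≤ x)
    (h3 : 1 ≤ x + y) :
    (if 1 ≤ x then exitOrders r i (x - 1) y else 0) +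
      (if 1 ≤ y then exitOrders r i x (y - 1) else 0) = exitOrders r i x y := by
  unfold exitOrders
  rcases lt_trichotomy r i with h | h | h
  · simp only [h, if_true]
    obtain ⟨y, rfl⟩ := Nat.exists_eq_add_of_le' (h1 h)
    rcases x with _ | x
    · simp
    · rcases y with _ | y
      · simp
      · have e1 : x + (y + 1 + 1) - 1 = x + y + 1 := by omega
        have e2 : x + 1 + (y + 1) - 1 = x + y + 1 := by omega
        have e3 : x + 1 + (y + 1 + 1) - 1 = x + y + 1 + 1 := by omega
        simp only [Nat.le_add_left, if_true, Nat.add_sub_cancel, e1, e2, e3]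
        rw [Nat.choose_succ_succ (x + y + 1) x]
  · simp only [h, lt_irrefl, if_false]
    rcases x with _ | x
    · rcases y with _ | y
      · omega
      · simp
    · rcases y with _ | y
      · simp
      · simp only [Nat.le_add_left, if_true, Nat.add_sub_cancel]
        have e1 : x + (y + 1) = x + y + 1 := by omega
        have e2 : x + 1 + y = x + y + 1 := by omega
        have e3 : x + 1 + (y + 1) = x + y + 1 + 1 := by omega
        rw [e1, e2, e3, Nat.choose_succ_succ (x + y + 1) x]
  · simp only [h, not_lt_of_gt h, if_true, if_false]
    obtain ⟨x, rfl⟩ := Nat.exists_eq_add_of_le' (h2 h)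
    rcases y with _ | y
    · simp
    · rcases x with _ | x
      · simp
      · have e1 : x + 1 + 1 + y - 1 = x + y + 1 := by omega
        have e2 : x + 1 + (y + 1) - 1 = x + y + 1 := by omega
        have e3 : x + 1 + 1 + (y + 1) - 1 = x + y + 1 + 1 := by omega
        simp only [Nat.le_add_left, if_true, Nat.add_sub_cancel, e1, e2, e3]
        rw [Nat.choose_succ_succ (x + y + 1) y, add_comm]

/-- Edges not connected to `r` cannot be traversed. At the vertex where they begin there are exits
away from `r` but none towards it, and its factor is `(x - 1).choose x = 0`. -/
lemma prod_exitOrders_eq_zero {r lo hi : ℤ} {e : ℤ → ℕ}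
    (hsupp : ∀ k, e k ≠ 0 → lo ≤ k ∧ k < hi) (h0 : e r = 0) (h1 : e (r - 1) = 0)
    (hne : ∃ k, e k ≠ 0) :
    ∏ i ∈ Finset.Icc lo hi, exitOrders r i (e i) (e (i - 1)) = 0 := by
  by_contra hprod
  rw [Finset.prod_eq_zero_iff] at hprod
  push Not at hprod
  have hup : ∀ n : ℕ, e (r + n) = 0 := by
    intro n
    induction n with
    | zero => simpa using h0
    | succ n ih =>
      by_contra hk
      have := hsupp _ hk
      have hf := hprod (r + (n + 1 : ℕ)) (by rw [Finset.mem_Icc]; omega)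
      have e1 : r + ((n + 1 : ℕ) : ℤ) - 1 = r + n := by push_cast; ring
      rw [e1, ih, exitOrders, if_pos (by push_cast; omega)] at hf
      exact hf (Nat.choose_eq_zero_of_lt (by omega))
  have hdown : ∀ n : ℕ, e (r - 1 - n) = 0 := by
    intro n
    induction n with
    | zero => simpa using h1
    | succ n ih =>
      by_contra hk
      have := hsupp _ hk
      have hf := hprod (r - 1 - n) (by rw [Finset.mem_Icc]; push_cast at this; omega)
      have e1 : r - 1 - ((n + 1 : ℕ) : ℤ) = r - 1 - n - 1 := by push_cast; ring
      rw [e1] at hk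
      rw [ih, exitOrders, if_neg (by omega), if_pos (by omega)] at hf
      exact hf (Nat.choose_eq_zero_of_lt (by omega))
  obtain ⟨k, hk⟩ := hne
  rcases le_or_gt r k with h | h
  · have := hup (k - r).toNat
    rw [show r + ((k - r).toNat : ℤ) = k by omega] at this
    exact hk this
  · have := hdown (r - 1 - k).toNat
    rw [show r - 1 - ((r - 1 - k).toNat : ℤ) = k by omega] at this
    exact hk this

lemma sum_update_sub_one {K : Finset ℤ} {f : ℤ → ℕ} {a : ℤ} (ha : a ∈ K) (hf : 1 ≤ f a) :
    ∑ k ∈ K, Function.update f a (f a - 1) k + 1 = ∑ k ∈ K, f k := by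
  rw [Finset.sum_update_of_mem ha, ← Finset.add_sum_erase _ _ ha, Finset.sdiff_singleton_eq_erase]
  omega

/-- The BEST theorem on a path: a walk from `v` to `r` is the same as an order of the exits at each
vertex, the last exits forming the only spanning tree directed to `r`. The flow condition says that
upward exceed downward crossings by one between `v` and `r` if `v < r`, and conversely if `r < v`.
The induction removes the first step. -/
theorem card_trails (r lo hi : ℤ) (hr : r ∈ Finset.Icc lo hi) (m : ℕ) :
    ∀ (v : ℤ) (u d : ℤ → ℕ), v ∈ Finset.Icc lo hi →
      (∀ k, u k ≠ 0 → lo ≤ k ∧ k < hi) → (∀ k, d k ≠ 0 → lo ≤ k ∧ k < hi) →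
      (∀ k, d k + (if v ≤ k ∧ k < r then 1 else 0) = u k + if r ≤ k ∧ k < v then 1 else 0) →
      ∑ k ∈ Finset.Icc lo hi, (u k + d k) = m →
      (trails m v u d).card = ∏ i ∈ Finset.Icc lo hi, exitOrders r i (u i) (d (i - 1)) := by
  induction m with
  | zero =>
    intro v u d hv hu hd hflow hsum
    rw [Finset.sum_eq_zero_iff] at hsum
    have hu0 : ∀ k, u k = 0 := fun k => by
      by_contra h
      have := hu k h
      have := hsum k (by rw [Finset.mem_Icc]; omega)
      omega
    have hd0 : ∀ k, d k = 0 := fun k => by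
      by_contra h
      have := hd k h
      have := hsum k (by rw [Finset.mem_Icc]; omega)
      omega
    rw [Finset.prod_eq_one (fun i _ => by rw [hu0, hd0, exitOrders_zero])]
    have : trails 0 v u d = Finset.univ := by
      ext s
      simp only [mem_trails, ups, downs, hu0, hd0, Finset.mem_univ, iff_true]
      simp
    rw [this]
    simp
  | succ m ih =>
    intro v u d hv hu hd hflow hsum
    rw [Finset.mem_Icc] at hr
    have hv' := Finset.mem_Icc.1 hv
    rw [card_trails_succ]
    -- If no exit from `v` is left, the flow condition forces `v = r` and `u = d`. The unused edges
    -- are then unreachable and both sides are `0`.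
    by_cases hdeg : u v + d (v - 1) = 0
    · rw [if_neg (by omega), if_neg (by omega)]
      have hvr : v = r := by
        rcases lt_trichotomy v r with h | h | h
        · have := hflow v
          rw [if_pos (by omega), if_neg (by omega)] at this
          omega
        · exact h
        · have := hflow (v - 1)
          rw [if_neg (by omega), if_pos (by omega)] at this
          omega
      subst hvr
      have hdu : d = u := by
        funext k
        have := hflow k
        split_ifs at this <;> omega
      subst hdu
      rw [prod_exitOrders_eq_zero hu (by omega) (by omega)]
      by_contra hne
      push Not at hne
      simp [hne] at hsum
    -- A step out of `v` lowers only `u v` or `d (v - 1)`, and both numbers enter only the factor of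
    -- the vertex `v`.
    · have hsplit : ∀ (u' d' : ℤ → ℕ), (∀ i, i ≠ v → u' i = u i ∧ d' (i - 1) = d (i - 1)) →
          ∏ i ∈ Finset.Icc lo hi, exitOrders r i (u' i) (d' (i - 1))
            = exitOrders r v (u' v) (d' (v - 1)) *
              ∏ i ∈ (Finset.Icc lo hi).erase v, exitOrders r i (u i) (d (i - 1)) := by
        intro u' d' h
        rw [← Finset.mul_prod_erase _ _ hv]
        congr 1
        refine Finset.prod_congr rfl fun i hi => ?_
        rw [(h i (Finset.ne_of_mem_erase hi)).1, (h i (Finset.ne_of_mem_erase hi)).2]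
      have hup : 1 ≤ u v → (trails m (v + 1) (Function.update u v (u v - 1)) d).card
          = exitOrders r v (u v - 1) (d (v - 1)) *
              ∏ i ∈ (Finset.Icc lo hi).erase v, exitOrders r i (u i) (d (i - 1)) := by
        intro h
        have hvhi := hu v (by omega)
        rw [ih (v + 1) _ d (by rw [Finset.mem_Icc]; omega), hsplit, Function.update_self]
        · intro i hi
          exact ⟨Function.update_of_ne hi _ _, rfl⟩
        · intro k hk
          by_cases hkv : k = v
          · subst hkv; exact hvhi
          · rw [Function.update_of_ne hkv] at hk; exact hu k hk
        · exact hd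
        · intro k
          have := hflow k
          by_cases hkv : k = v
          · subst hkv
            rw [Function.update_self]
            split_ifs at this ⊢ <;> omega
          · rw [Function.update_of_ne hkv]
            split_ifs at this ⊢ <;> omega
        · rw [Finset.sum_add_distrib] at hsum ⊢
          have := sum_update_sub_one hv h
          omega
      have hdown : 1 ≤ d (v - 1) →
          (trails m (v - 1) u (Function.update d (v - 1) (d (v - 1) - 1))).card
          = exitOrders r v (u v) (d (v - 1) - 1) *
              ∏ i ∈ (Finset.Icc lo hi).erase v, exitOrders r i (u i) (d (i - 1)) := by
        intro h
        have hvhi := hd (v - 1) (by omega)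
        have hv1 : v - 1 ∈ Finset.Icc lo hi := by rw [Finset.mem_Icc]; omega
        rw [ih (v - 1) u _ hv1, hsplit, Function.update_self]
        · intro i hi
          exact ⟨rfl, Function.update_of_ne (by omega) _ _⟩
        · exact hu
        · intro k hk
          by_cases hkv : k = v - 1
          · subst hkv; exact hvhi
          · rw [Function.update_of_ne hkv] at hk; exact hd k hk
        · intro k
          have := hflow k
          by_cases hkv : k = v - 1
          · subst hkv
            rw [Function.update_self]
            split_ifs at this ⊢ <;> omega
          · rw [Function.update_of_ne hkv]
            split_ifs at this ⊢ <;> omega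
        · rw [Finset.sum_add_distrib] at hsum ⊢
          have := sum_update_sub_one hv1 h
          omega
      rw [hsplit u d fun _ _ => ⟨rfl, rfl⟩, ← exitOrders_step r v (u v) (d (v - 1)), add_mul,
        ite_mul, ite_mul, zero_mul]
      · congr 1
        · split_ifs with h
          · exact hup h
          · rfl
        · split_ifs with h
          · exact hdown h
          · rfl
      · intro h
        have := hflow (v - 1)
        rw [if_neg (by omega), if_pos (by omega)] at this
        omega
      · intro h
        have := hflow v
        rw [if_pos (by omega), if_neg (by omega)] at this
        omega
      · omega

end SimpleWalk

namespace SimpleWalk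

/-! ### Closed walks with a given list of crossing numbers -/

/-- The list `L` seen as a function on the edges of `ℤ`, its first entry sitting at `-j`. -/
def profile (L : List ℕ) (j : ℕ) (k : ℤ) : ℕ :=
  if 0 ≤ k + j then L.getD (k + j).toNat 0 else 0

/-- The number of closed walks with crossing numbers `L` that start and end at the bottom. -/
def rooted : List ℕ → ℕ
  | a :: b :: L => (a + b - 1).choose b * rooted (b :: L)
  | _ => 1

lemma profile_sub (L : List ℕ) (j i : ℕ) : profile L j ((i : ℤ) - j) = L.getD i 0 := by
  simp [profile]

lemma profile_eq_zero {L : List ℕ} {j : ℕ} {k : ℤ} (h : ¬ (-(j : ℤ) ≤ k ∧ k < L.length - j)) :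
    profile L j k = 0 := by
  unfold profile
  split_ifs with h0
  · rw [List.getD_eq_default]
    omega
  · rfl

lemma profile_pos {L : List ℕ} (hL : 0 ∉ L) {j : ℕ} {k : ℤ}
    (h : -(j : ℤ) ≤ k ∧ k < L.length - j) : 0 < profile L j k := by
  unfold profile
  rw [if_pos (by omega)]
  have hlt : (k + j).toNat < L.length := by omega
  rw [List.getD_eq_getElem _ _ hlt, Nat.pos_iff_ne_zero]
  intro h0
  exact hL (h0 ▸ List.getElem_mem hlt)

/-- As the entries are positive, the support of the profile recovers the offset and the length. -/
lemma profile_injective {L L' : List ℕ} {j j' : ℕ} (h0 : L ≠ []) (hL : 0 ∉ L)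
    (hL' : 0 ∉ L') (h : profile L j = profile L' j') : L = L' ∧ j = j' := by
  have hlen : 0 < L.length := List.length_pos_iff.2 h0
  have key : ∀ k : ℤ, (-(j : ℤ) ≤ k ∧ k < L.length - j) ↔
      (-(j' : ℤ) ≤ k ∧ k < L'.length - j') := by
    intro k
    have hk := congrFun h k
    by_cases h1 : (-(j : ℤ) ≤ k ∧ k < L.length - j) <;>
      by_cases h2 : (-(j' : ℤ) ≤ k ∧ k < L'.length - j')
    · simp [h1, h2]
    · rw [profile_eq_zero h2] at hk
      have := profile_pos hL h1
      omega
    · rw [profile_eq_zero h1] at hk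
      have := profile_pos hL' h2
      omega
    · simp [h1, h2]
  have k1 := (key (-j)).1 (by omega)
  have k2 := (key (-j')).2 (by omega)
  have hj : j = j' := by omega
  subst hj
  have k3 := (key (L.length - j - 1)).1 (by omega)
  have k4 := (key (L'.length - j - 1)).2 (by omega)
  refine ⟨List.ext_getElem (by omega) fun i h1 h2 => ?_, rfl⟩
  have := congrFun h ((i : ℤ) - j)
  rw [profile_sub, profile_sub] at this
  rwa [List.getD_eq_getElem _ _ h1, List.getD_eq_getElem _ _ h2] at this

lemma sum_getD (L : List ℕ) : ∑ i ∈ Finset.range L.length, L.getD i 0 = L.sum := by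
  induction L with
  | nil => simp
  | cons a L ih =>
    rw [List.length_cons, Finset.sum_range_succ']
    simp only [List.getD_cons_succ, ih, List.getD_cons_zero, List.sum_cons]
    omega

/-- The shift `i ↦ i - j` of vertex indices. -/
def shiftEmb (j : ℕ) : ℕ ↪ ℤ :=
  ⟨fun i : ℕ => (i : ℤ) - j, fun a b h => by
    have h' : (a : ℤ) - j = (b : ℤ) - j := h
    omega⟩

lemma shiftEmb_apply (j i : ℕ) : shiftEmb j i = (i : ℤ) - j := rfl

/-- Vertices of the profile are indexed by `0, …, L.length`. -/
lemma map_range_eq_Icc (l j : ℕ) :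
    (Finset.range (l + 1)).map (shiftEmb j) = Finset.Icc (-(j : ℤ)) (l - j) := by
  ext k
  simp only [Finset.mem_map, Finset.mem_range, shiftEmb_apply, Finset.mem_Icc]
  constructor
  · rintro ⟨i, hi, rfl⟩; omega
  · intro h; exact ⟨(k + j).toNat, by omega, by omega⟩

lemma sum_profile (L : List ℕ) (j : ℕ) :
    ∑ k ∈ Finset.Icc (-(j : ℤ)) (L.length - j), profile L j k = L.sum := by
  rw [← map_range_eq_Icc, Finset.sum_map]
  simp only [shiftEmb_apply, profile_sub]
  rw [Finset.sum_range_succ, sum_getD]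
  simp

/-- For positive `a` and `b` both sides are `(a + b - 1)! / ((a - 1)! (b - 1)!)`. This symmetry lets
the end point move along the line and the list be reversed. -/
lemma choose_mul_symm (a b : ℕ) :
    (a + b - 1).choose b * b = (a + b - 1).choose a * a := by
  rcases a with _ | a
  · rcases b with _ | b
    · simp
    · simp
  · rcases b with _ | b
    · simp
    · have h1 := Nat.choose_symm_add (a := a) (b := b + 1)
      have e : a + 1 + (b + 1) - 1 = a + (b + 1) := by omega
      rw [e]
      have h2 : (a + (b + 1)).choose (b + 1) * (b + 1)
          = (a + (b + 1)).choose b * (a + (b + 1) - b) := Nat.choose_succ_right_eq _ _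
      have h3 : (a + (b + 1)).choose (a + 1) = (a + (b + 1)).choose b := by
        have := Nat.choose_symm_add (a := a + 1) (b := b)
        rwa [show a + 1 + b = a + (b + 1) by omega] at this
      rw [h2, h3]
      congr 1
      omega

lemma mul_choose_add (a b : ℕ) :
    b * (a + b).choose a = (a + b) * (a + b - 1).choose a := by
  rcases b with _ | b
  · rcases a with _ | a
    · simp
    · simp
  · have := Nat.add_one_mul_choose_eq (a + b) b
    have h3 : (a + b).choose b = (a + b).choose a := (Nat.choose_symm_add).symm
    have h4 : (a + (b + 1)).choose a = (a + b + 1).choose (b + 1) :=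
      Nat.choose_symm_add (a := a) (b := b + 1)
    rw [h4, show a + (b + 1) - 1 = a + b by omega, ← h3, mul_comm]
    exact this.symm

/-- Reverses the last exits at the sites `0, …, j` from upward to downward. By `choose_mul_symm`
each site trades a factor `a (i - 1)` for a factor `a i`, so the product telescopes. -/
lemma mul_prod_exitOrders_lt (a : ℕ → ℕ) (j : ℕ) :
    a 0 * ∏ i ∈ Finset.range (j + 1),
        (a i + (if i = 0 then 0 else a (i - 1)) - 1).choose (if i = 0 then 0 else a (i - 1))
      = a j * ∏ i ∈ Finset.range j, (a (i + 1) + a i - 1).choose (a (i + 1)) := by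
  induction j with
  | zero => simp
  | succ j ih =>
    rw [Finset.prod_range_succ, ← mul_assoc, ih, Finset.prod_range_succ]
    simp only [Nat.add_eq_zero_iff, one_ne_zero, and_false, if_false, Nat.add_sub_cancel]
    have := choose_mul_symm (a (j + 1)) (a j)
    calc _ = ((a (j + 1) + a j - 1).choose (a j) * a j) *
        ∏ i ∈ Finset.range j, (a (i + 1) + a i - 1).choose (a (i + 1)) := by ring
      _ = _ := by rw [this]; ring

/-- Rotating a closed walk: the number of walks rooted at a site is proportional to the number of
exits from that site, which is `a 0` at the bottom. -/
lemma mul_prod_exitOrders (a : ℕ → ℕ) (j l : ℕ) (hjl : j ≤ l) :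
    a 0 * ∏ i ∈ Finset.range (l + 1),
        exitOrders 0 ((i : ℤ) - j) (a i) (if i = 0 then 0 else a (i - 1))
      = (a j + (if j = 0 then 0 else a (j - 1)))
          * ∏ i ∈ Finset.range l, (a (i + 1) + a i - 1).choose (a (i + 1)) := by
  induction l, hjl using Nat.le_induction with
  | base =>
    rw [Finset.prod_range_succ]
    have h1 : ∏ i ∈ Finset.range j,
        exitOrders 0 ((i : ℤ) - j) (a i) (if i = 0 then 0 else a (i - 1))
        = ∏ i ∈ Finset.range j,
        (a i + (if i = 0 then 0 else a (i - 1)) - 1).choose (if i = 0 then 0 else a (i - 1)) := by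
      refine Finset.prod_congr rfl fun i hi => ?_
      rw [Finset.mem_range] at hi
      rw [exitOrders, if_neg (by omega), if_pos (by omega)]
    rw [h1, sub_self]
    rcases j with _ | j
    · simp [exitOrders]
    · rw [← mul_assoc, mul_prod_exitOrders_lt, Finset.prod_range_succ]
      simp only [exitOrders, lt_irrefl, Nat.add_eq_zero_iff, one_ne_zero, and_false, if_false,
        Nat.add_sub_cancel]
      have := mul_choose_add (a (j + 1)) (a j)
      calc _ = (a j * (a (j + 1) + a j).choose (a (j + 1))) *
        ∏ i ∈ Finset.range j, (a (i + 1) + a i - 1).choose (a (i + 1)) := by ring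
        _ = _ := by rw [this]; ring
  | succ l hl ih =>
    rw [Finset.prod_range_succ, ← mul_assoc, ih, Finset.prod_range_succ, mul_assoc]
    congr 2
    rw [exitOrders, if_pos (by push_cast; omega)]
    simp

lemma prod_choose_getD (L : List ℕ) :
    ∏ i ∈ Finset.range L.length, (L.getD (i + 1) 0 + L.getD i 0 - 1).choose (L.getD (i + 1) 0)
      = rooted L := by
  induction L with
  | nil => simp [rooted]
  | cons a L ih =>
    cases L with
    | nil => simp [rooted]
    | cons b L =>
      rw [List.length_cons, Finset.prod_range_succ', rooted, ← ih]
      simp only [List.getD_cons_succ, List.getD_cons_zero]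
      rw [mul_comm, add_comm b a]

/-- By `mul_prod_exitOrders` the starting sites contribute in proportion to their numbers of exits.
These numbers add up to `2 * L.sum`, as every edge has two ends. -/
theorem headD_mul_sum_card_trails (L : List ℕ) :
    L.headD 0 * ∑ j ∈ Finset.range (L.length + 1),
      (trails (2 * L.sum) 0 (profile L j) (profile L j)).card = 2 * L.sum * rooted L := by
  have hcard : ∀ j ∈ Finset.range (L.length + 1),
      L.headD 0 * (trails (2 * L.sum) 0 (profile L j) (profile L j)).card
        = (L.getD j 0 + (if j = 0 then 0 else L.getD (j - 1) 0)) * rooted L := by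
    intro j hj
    rw [Finset.mem_range] at hj
    have hsupp : ∀ k, profile L j k ≠ 0 → -(j : ℤ) ≤ k ∧ k < L.length - j := by
      intro k hk
      by_contra h
      exact hk (profile_eq_zero h)
    have h0 : (0 : ℤ) ∈ Finset.Icc (-(j : ℤ)) (L.length - j) := by
      rw [Finset.mem_Icc]; omega
    rw [card_trails 0 (-(j : ℤ)) (L.length - j) h0 _ 0 _ _ h0 hsupp hsupp (fun k => rfl)
      (by rw [Finset.sum_add_distrib, sum_profile]; ring), ← map_range_eq_Icc, Finset.prod_map]
    simp only [shiftEmb_apply, profile_sub]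
    rw [← prod_choose_getD, ← mul_prod_exitOrders (fun i => L.getD i 0) j L.length (by omega)]
    congr 1
    · cases L <;> simp
    · refine Finset.prod_congr rfl fun i hi => ?_
      congr 1
      rcases i with _ | i
      · rw [if_pos rfl]
        exact profile_eq_zero (by push_cast; omega)
      · rw [if_neg (by omega), Nat.add_sub_cancel, ← profile_sub L j i]
        congr 1
        push_cast; ring
  rw [Finset.mul_sum, Finset.sum_congr rfl hcard, ← Finset.sum_mul, Finset.sum_add_distrib]
  congr 1
  rw [Finset.sum_range_succ, sum_getD, Finset.sum_range_succ', List.getD_eq_default _ _ le_rfl]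
  simp only [Nat.add_eq_zero_iff, one_ne_zero, and_false, if_false, Nat.add_sub_cancel, if_true,
    sum_getD]
  ring

/-! ### The profile of a closed walk -/

lemma units_int_cases (ε : ℤˣ) : ε = 1 ∨ ε = -1 := Int.units_eq_one_or ε

/-- Conservation of flow across the edge `k`. -/
lemma ups_add_eq {m : ℕ} : ∀ (v : ℤ) (s : Fin m → ℤˣ) (k : ℤ),
    ups v s k + (if k < v then 1 else 0) = downs v s k + if k < v + point s m then 1 else 0 := by
  induction m with
  | zero => intro v s k; simp [ups, downs, point]
  | succ m ih =>
    intro v s k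
    rw [← Fin.cons_self_tail s]
    generalize s 0 = ε
    generalize Fin.tail s = t
    have h1 : (1 : ℤˣ) ≠ -1 := by decide
    have := ih (v + ε) t k
    rw [ups_cons, downs_cons, point_cons_succ, ← add_assoc]
    rcases units_int_cases ε with rfl | rfl
    · simp only [true_and, h1, false_and, if_false, Units.val_one] at this ⊢
      split_ifs at this ⊢ <;> omega
    · simp only [true_and, h1.symm, false_and, if_false, Units.val_one, Units.val_neg] at this ⊢
      split_ifs at this ⊢ <;> omega

/-- A walk starting at or below `k` must climb the edge `k` before it can climb a higher one, so the
edges in use have no gaps. -/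
lemma ups_eq_zero_of_le {m : ℕ} : ∀ (v : ℤ) (s : Fin m → ℤˣ) (k : ℤ), v ≤ k → ups v s k = 0 →
    ∀ k', k ≤ k' → ups v s k' = 0 := by
  induction m with
  | zero => intro v s k _ _ k' _; simp [ups]
  | succ m ih =>
    intro v s k hv h k' hk'
    rw [← Fin.cons_self_tail s] at h ⊢
    generalize s 0 = ε at *
    generalize Fin.tail s = t at *
    rw [ups_cons] at h ⊢
    have h2 : ¬ (ε = 1 ∧ v = k) := by
      intro hh; rw [if_pos hh] at h; omega
    have h3 : v + ε ≤ k := by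
      rcases units_int_cases ε with rfl | rfl
      · simp only [true_and, Units.val_one] at h2 ⊢; omega
      · simp only [Units.val_one, Units.val_neg]; omega
    rw [ih _ t k h3 (by omega) k' hk', if_neg]
    rintro ⟨h4, h5⟩
    exact h2 ⟨h4, by omega⟩

lemma downs_eq_zero_of_le {m : ℕ} : ∀ (v : ℤ) (s : Fin m → ℤˣ) (k : ℤ), k + 1 ≤ v →
    downs v s k = 0 → ∀ k', k' ≤ k → downs v s k' = 0 := by
  induction m with
  | zero => intro v s k _ _ k' _; simp [downs]
  | succ m ih =>
    intro v s k hv h k' hk'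
    rw [← Fin.cons_self_tail s] at h ⊢
    generalize s 0 = ε at *
    generalize Fin.tail s = t at *
    rw [downs_cons] at h ⊢
    have h2 : ¬ (ε = -1 ∧ v = k + 1) := by
      intro hh; rw [if_pos hh] at h; omega
    have h3 : k + 1 ≤ v + ε := by
      rcases units_int_cases ε with rfl | rfl
      · simp only [Units.val_one]; omega
      · simp only [true_and, Units.val_one, Units.val_neg] at h2 ⊢; omega
    rw [ih _ t k h3 (by omega) k' hk', if_neg]
    rintro ⟨h4, h5⟩
    exact h2 ⟨h4, by omega⟩

lemma sum_ups_add_downs {m : ℕ} (K : Finset ℤ) : ∀ (v : ℤ) (s : Fin m → ℤˣ),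
    Finset.Icc (v - m) (v + m) ⊆ K → ∑ k ∈ K, (ups v s k + downs v s k) = m := by
  induction m with
  | zero => intro v s _; simp [ups, downs]
  | succ m ih =>
    intro v s hK
    rw [← Fin.cons_self_tail s]
    generalize s 0 = ε
    generalize Fin.tail s = t
    have h1 : (1 : ℤˣ) ≠ -1 := by decide
    have hsub : Finset.Icc (v + ε - m) (v + ε + m) ⊆ K := by
      refine subset_trans (fun k hk => ?_) hK
      rw [Finset.mem_Icc] at hk ⊢
      push_cast
      rcases units_int_cases ε with rfl | rfl
      · rw [Units.val_one] at hk; omega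
      · rw [Units.val_neg, Units.val_one] at hk; omega
    have := ih (v + ε) t hsub
    simp only [ups_cons, downs_cons]
    rw [Finset.sum_congr rfl (g := fun k => ((if ε = 1 ∧ v = k then 1 else 0) +
      (if ε = -1 ∧ v = k + 1 then 1 else 0)) + (ups (v + ε) t k + downs (v + ε) t k))
      (fun k _ => by ring), Finset.sum_add_distrib, this, Finset.sum_add_distrib]
    have hv : v ∈ K := hK (by rw [Finset.mem_Icc]; omega)
    have hv1 : v - 1 ∈ K := hK (by rw [Finset.mem_Icc]; push_cast; omega)
    rcases units_int_cases ε with rfl | rfl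
    · simp [h1, hv, add_comm]
    · have : ∀ k : ℤ, (v = k + 1) = (v - 1 = k) := fun k => by
        rw [eq_iff_iff]; omega
      simp [h1.symm, this, hv1, add_comm]

lemma eq_of_mem_trails_profile {m : ℕ} {L : List ℕ} {j : ℕ} {s : Fin m → ℤˣ} (hj : j ≤ L.length)
    (hs : s ∈ trails m 0 (profile L j) (profile L j)) : m = 2 * L.sum := by
  rw [mem_trails] at hs
  set K : Finset ℤ := Finset.Icc (-(j : ℤ) - m) (L.length - j + m)
  have h := sum_ups_add_downs K 0 s (by
    intro k hk
    rw [Finset.mem_Icc] at hk ⊢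
    omega)
  rw [← h, ← sum_profile L j, Finset.sum_congr rfl (g := fun k => 2 * profile L j k)
    (fun k _ => by rw [(hs k).1, (hs k).2]; ring), ← Finset.mul_sum]
  congr 1
  symm
  refine Finset.sum_subset (fun k hk => ?_) fun k _ hk => ?_
  · rw [Finset.mem_Icc] at hk ⊢; omega
  · rw [Finset.mem_Icc] at hk
    exact profile_eq_zero (by omega)

lemma point_eq_zero_of_mem_trails {m : ℕ} {e : ℤ → ℕ} {s : Fin m → ℤˣ}
    (hs : s ∈ trails m 0 e e) : point s m = 0 := by
  rw [mem_trails] at hs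
  have h1 := ups_add_eq 0 s 0
  have h2 := ups_add_eq 0 s (point s m)
  have h3 := ups_add_eq 0 s (-1)
  rw [(hs _).1, (hs _).2, zero_add] at h1 h2 h3
  split_ifs at h1 h2 h3 <;> omega

lemma exists_profile {m : ℕ} (hm : 0 < m) {s : Fin m → ℤˣ} (hs : point s m = 0) :
    ∃ (L : List ℕ) (j : ℕ), L ≠ [] ∧ 0 ∉ L ∧ j ≤ L.length ∧
      s ∈ trails m 0 (profile L j) (profile L j) := by
  classical
  obtain ⟨e, he⟩ : ∃ e : ℤ → ℕ, ∀ k, ups 0 s k = e k := ⟨_, fun _ => rfl⟩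
  have hd : ∀ k, downs 0 s k = e k := by
    intro k
    have := ups_add_eq 0 s k
    rw [hs, add_zero, he] at this
    omega
  have hfar : ∀ k, k ∉ Finset.Icc (-(m : ℤ)) m → e k = 0 := by
    intro k hk
    have h1 := sum_ups_add_downs (Finset.Icc (-(m : ℤ)) m) 0 s (by simp)
    have h2 := sum_ups_add_downs (insert k (Finset.Icc (-(m : ℤ)) m)) 0 s
      (by rw [zero_sub, zero_add]; exact Finset.subset_insert _ _)
    rw [Finset.sum_insert hk, he] at h2
    omega
  -- The edges in use are those strictly between the first unused edge `b` above the start and the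
  -- first unused edge `-1 - a` below it.
  have hb : ∃ b : ℕ, e b = 0 := ⟨m + 1, hfar _ (by rw [Finset.mem_Icc]; push_cast; omega)⟩
  have ha : ∃ a : ℕ, e (-1 - a) = 0 := ⟨m, hfar _ (by rw [Finset.mem_Icc]; omega)⟩
  obtain ⟨b, hb0, hbmin⟩ : ∃ b : ℕ, e b = 0 ∧ ∀ i < b, e i ≠ 0 :=
    ⟨Nat.find hb, Nat.find_spec hb, fun i hi => Nat.find_min hb hi⟩
  obtain ⟨a, ha0, hamin⟩ : ∃ a : ℕ, e (-1 - a) = 0 ∧ ∀ i < a, e (-1 - i) ≠ 0 :=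
    ⟨Nat.find ha, Nat.find_spec ha, fun i hi => Nat.find_min ha hi⟩
  have hup : ∀ k : ℤ, (b : ℤ) ≤ k → e k = 0 := fun k hk =>
    (he k).symm.trans (ups_eq_zero_of_le 0 s b (by omega) ((he _).trans hb0) k hk)
  have hdown : ∀ k : ℤ, k ≤ -1 - a → e k = 0 := fun k hk => by
    rw [← hd]
    exact downs_eq_zero_of_le 0 s (-1 - a) (by omega) (by rw [hd]; exact ha0) k hk
  have hpos : ∀ k : ℤ, -(a : ℤ) ≤ k → k < b → e k ≠ 0 := by
    intro k h1 h2
    rcases le_or_gt 0 k with h | h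
    · have := hbmin k.toNat (by omega)
      rwa [Int.toNat_of_nonneg h] at this
    · have := hamin (-1 - k).toNat (by omega)
      rwa [show (-1 : ℤ) - ((-1 - k).toNat : ℤ) = k by omega] at this
  set L : List ℕ := (List.range (a + b)).map fun i : ℕ => e ((i : ℤ) - a)
  have hlen : L.length = a + b := by simp [L]
  have hprof : profile L a = e := by
    funext k
    by_cases h : -(a : ℤ) ≤ k ∧ k < L.length - a
    · rw [profile, if_pos (by omega), List.getD_eq_getElem _ _ (by omega)]
      simp only [L, List.getElem_map, List.getElem_range]
      congr 1
      omega
    · rw [profile_eq_zero h]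
      rcases not_and_or.1 h with h | h
      · exact (hdown k (by omega)).symm
      · exact (hup k (by omega)).symm
  have htr : s ∈ trails m 0 (profile L a) (profile L a) := by
    rw [mem_trails, hprof]
    exact fun k => ⟨he k, hd k⟩
  refine ⟨L, a, ?_, ?_, by omega, htr⟩
  · intro hL
    have := eq_of_mem_trails_profile (by omega) htr
    rw [hL] at this
    simp at this
    omega
  · intro h0
    simp only [L, List.mem_map, List.mem_range] at h0
    obtain ⟨i, hi, h0⟩ := h0
    exact hpos _ (by omega) (by omega) h0

/-! ### Multiplicities -/

/-- A closed walk arrives at `q` as often as it leaves `q`, and it leaves `e q` times upwards and `e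
(q - 1)` times downwards. The half weights of the coinciding initial and final points combine to one
visit. -/
lemma mult_eq {m : ℕ} (hm : 0 < m) {e : ℤ → ℕ} {s : Fin m → ℤˣ} (hs : s ∈ trails m 0 e e)
    (q : ℤ) : mult q s = 2 * (e (q - 1) + e q) := by
  have hp := point_eq_zero_of_mem_trails hs
  rw [mem_trails] at hs
  have h1 : e (q - 1) + e q = ∑ i ∈ Finset.range m, if q = point s i then 1 else 0 := by
    rw [← (hs q).1, ← (hs (q - 1)).2, ups, downs, Finset.card_filter, Finset.card_filter,
      ← Finset.sum_add_distrib, Finset.sum_range]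
    refine Finset.sum_congr rfl fun i _ => ?_
    have h1 : (1 : ℤˣ) ≠ -1 := by decide
    rcases units_int_cases (s i) with h | h
    · simp [h, eq_comm, h1]
    · simp [h, eq_comm, h1]
  have h2 : Finset.range m = insert 0 (Finset.Ioo 0 m) := by
    ext i
    simp only [Finset.mem_range, Finset.mem_insert, Finset.mem_Ioo]
    omega
  rw [h1, h2, Finset.sum_insert (by simp), mult, hp, point_zero]
  ring

/-- The number of adjacent pairs with sum `k`, the list being continued by `0`. -/
def pairCount (k : ℕ) : List ℕ → ℕ
  | a :: b :: L => (if a + b = k then 1 else 0) + pairCount k (b :: L)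
  | [a] => if a = k then 1 else 0
  | [] => 0

lemma pairCount_cons (k c : ℕ) (L : List ℕ) :
    pairCount k (c :: L) = ∑ i ∈ Finset.range (L.length + 1),
      if (c :: L).getD i 0 + L.getD i 0 = k then 1 else 0 := by
  induction L generalizing c with
  | nil => rw [List.length_nil, Finset.sum_range_one]; simp [pairCount]
  | cons a L ih =>
    rw [pairCount, ih, List.length_cons, Finset.sum_range_succ' _ (L.length + 1), add_comm]
    simp only [List.getD_cons_succ, List.getD_cons_zero]

/-- The leading `0` supplies the pair at the lowest site, and `pairCount` itself supplies the final
`0` at the highest one. Unvisited sites have multiplicity `0`, which `0 < k` excludes. -/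
theorem multRange_eq {m : ℕ} (hm : 0 < m) {L : List ℕ} {j : ℕ} {s : Fin m → ℤˣ}
    (hs : s ∈ trails m 0 (profile L j) (profile L j)) {k : ℕ} (hk : 0 < k) :
    multRange k s = pairCount k (0 :: L) := by
  have h1 : {q : ℤ | mult q s = 2 * k} = ↑(((Finset.range (L.length + 1)).filter
      fun i => (0 :: L).getD i 0 + L.getD i 0 = k).map
      (shiftEmb j)) := by
    ext q
    rw [Set.mem_ofPred_eq, mult_eq hm hs]
    simp only [Finset.coe_map, shiftEmb_apply, Finset.coe_filter, Finset.mem_range,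
      Set.mem_image, Set.mem_ofPred_eq]
    have hval : ∀ i : ℕ, profile L j ((i : ℤ) - j - 1) + profile L j ((i : ℤ) - j)
        = (0 :: L).getD i 0 + L.getD i 0 := by
      intro i
      rw [profile_sub]
      congr 1
      rcases i with _ | i
      · exact profile_eq_zero (by push_cast; omega)
      · rw [List.getD_cons_succ, ← profile_sub L j i]
        congr 1
        push_cast; ring
    constructor
    · intro hq
      have hq' : -(j : ℤ) ≤ q ∧ q ≤ L.length - j := by
        by_contra hcon
        rw [profile_eq_zero (by omega), profile_eq_zero (by omega)] at hq
        omega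
      refine ⟨(q + j).toNat, ⟨by omega, ?_⟩, by omega⟩
      rw [← hval, show (((q + j).toNat : ℕ) : ℤ) - j = q by omega]
      omega
    · rintro ⟨i, ⟨_, hi⟩, rfl⟩
      rw [hval, hi]
  rw [multRange, h1, Set.ncard_coe_finset, Finset.card_map, Finset.card_filter, pairCount_cons]

end SimpleWalk

namespace SimpleWalk

open scoped ENNReal

/-! ### Generating functions of crossing lists -/

/-- The weight of a list of crossing numbers: the number of closed walks of this shape is
`2 * L.sum` times it. -/
noncomputable def om (L : List ℕ) : ℝ≥0∞ := (rooted L : ℝ≥0∞) / (L.headD 0 : ℕ)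

/-- The lists of crossing numbers: nonempty lists of positive integers. -/
def Valid (L : List ℕ) : Prop := L ≠ [] ∧ 0 ∉ L

lemma Valid.headD_ne_zero {L : List ℕ} (h : Valid L) : L.headD 0 ≠ 0 := by
  obtain ⟨h1, h2⟩ := h
  cases L with
  | nil => exact absurd rfl h1
  | cons a L => intro h; apply h2; simp at h; simp [h]

open Classical in
/-- The total weight of the lists with sum `n` in the class `P`. -/
noncomputable def coef (P : List ℕ → Prop) (n : ℕ) : ℝ≥0∞ :=
  ∑' L, if Valid L ∧ P L ∧ L.sum = n then om L else 0

open Classical in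
/-- The generating function of the lists in the class `P`. -/
noncomputable def gf (P : List ℕ → Prop) (x : ℝ≥0∞) : ℝ≥0∞ :=
  ∑' L, if Valid L ∧ P L then om L * x ^ L.sum else 0

lemma tsum_coef_mul_pow (P : List ℕ → Prop) (x : ℝ≥0∞) :
    ∑' n, coef P n * x ^ n = gf P x := by
  classical
  simp only [coef, gf, ← ENNReal.tsum_mul_right]
  rw [ENNReal.tsum_comm]
  refine tsum_congr fun L => ?_
  rw [tsum_eq_single L.sum]
  · simp [ite_mul, zero_mul]
  · intro n hn
    rw [if_neg (by tauto), zero_mul]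

lemma sum_card_trails_eq_om {L : List ℕ} (hL : Valid L) {n : ℕ} (hn : L.sum = n) :
    ((∑ j ∈ Finset.range (L.length + 1),
      (trails (2 * n) 0 (profile L j) (profile L j)).card : ℕ) : ℝ≥0∞) = 2 * n * om L := by
  have h := congrArg (Nat.cast (R := ℝ≥0∞)) (headD_mul_sum_card_trails L)
  rw [hn] at h
  have h0 : ((L.headD 0 : ℕ) : ℝ≥0∞) ≠ 0 := by exact_mod_cast hL.headD_ne_zero
  rw [om, ← mul_div_assoc, ENNReal.eq_div_iff h0 (ENNReal.natCast_ne_top _)]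
  exact_mod_cast h

-- Every closed walk has exactly one pair `(L, j)`, so the indicator of `Q` is a double sum with at
-- most one nonzero term. Exchanging summations leaves, for each `L`, the count of
-- `sum_card_trails_eq_om`.
open Classical in
theorem card_filter_closedWalks {n : ℕ} (hn : 0 < n) (Q : (Fin (2 * n) → ℤˣ) → Prop)
    [DecidablePred Q] (P : List ℕ → Prop)
    (hQ : ∀ L j s, Valid L → s ∈ trails (2 * n) 0 (profile L j) (profile L j) → (Q s ↔ P L)) :
    (((closedWalks n).filter Q).card : ℝ≥0∞) = 2 * n * coef P n := by
  have h1 : ∀ s ∈ closedWalks n, (if Q s then (1 : ℝ≥0∞) else 0) =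
      ∑' L : List ℕ, ∑' j : ℕ, if Valid L ∧ P L ∧ j ≤ L.length ∧
        s ∈ trails (2 * n) 0 (profile L j) (profile L j) then 1 else 0 := by
    intro s hs
    rw [closedWalks, Finset.mem_filter] at hs
    obtain ⟨L, j, h0, hL, hj, htr⟩ := exists_profile (by omega) hs.2
    have huniq : ∀ L' j', 0 ∉ L' → s ∈ trails (2 * n) 0 (profile L' j') (profile L' j') →
        L = L' ∧ j = j' := by
      intro L' j' hL' h'
      refine profile_injective h0 hL hL' ?_
      rw [mem_trails] at htr h'
      funext k
      rw [← (htr k).1, ← (h' k).1]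
    rw [tsum_eq_single L, tsum_eq_single j]
    · have hV : Valid L := ⟨h0, hL⟩
      simp only [hV, hj, htr, hQ L j s hV htr, true_and, and_true]
    · intro j' hj'
      rw [if_neg]
      rintro ⟨hV, -, -, h⟩
      exact hj' (huniq L j' hL h).2.symm
    · intro L' hL'
      rw [ENNReal.tsum_eq_zero]
      intro j'
      rw [if_neg]
      rintro ⟨hV, -, -, h⟩
      exact hL' (huniq L' j' hV.2 h).1.symm
  have h2 : (((closedWalks n).filter Q).card : ℝ≥0∞)
      = ∑ s ∈ closedWalks n, if Q s then 1 else 0 := by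
    rw [Finset.card_filter]; push_cast; rfl
  rw [h2, Finset.sum_congr rfl h1, ← Summable.tsum_finsetSum (fun _ _ => ENNReal.summable), coef,
    ← ENNReal.tsum_mul_left]
  refine tsum_congr fun L => ?_
  rw [← Summable.tsum_finsetSum (fun _ _ => ENNReal.summable)]
  by_cases hL : Valid L ∧ P L ∧ L.sum = n
  · rw [if_pos hL, ← sum_card_trails_eq_om hL.1 hL.2.2, tsum_eq_sum (s := Finset.range (L.length + 1))]
    · push_cast
      refine Finset.sum_congr rfl fun j hj => ?_
      rw [Finset.mem_range] at hj
      have hj' : j ≤ L.length := by omega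
      simp only [hL.1, hL.2.1, hj', true_and]
      rw [← Nat.cast_one (R := ℝ≥0∞), ← Nat.cast_zero (R := ℝ≥0∞)]
      simp only [← Nat.cast_ite, ← Nat.cast_sum]
      refine congrArg (Nat.cast (R := ℝ≥0∞)) ?_
      rw [Finset.sum_boole, Nat.cast_id]
      refine congrArg _ ?_
      ext s
      simp only [Finset.mem_filter]
      refine ⟨fun h => h.2, fun h => ⟨?_, h⟩⟩
      rw [closedWalks, Finset.mem_filter]
      exact ⟨Finset.mem_univ _, point_eq_zero_of_mem_trails h⟩
    · intro j hj
      rw [Finset.mem_range] at hj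
      refine Finset.sum_eq_zero fun s _ => ?_
      rw [if_neg]
      rintro ⟨-, -, h, -⟩
      omega
  · rw [if_neg hL, mul_zero, ENNReal.tsum_eq_zero]
    intro j
    refine Finset.sum_eq_zero fun s _ => ?_
    rw [if_neg]
    rintro ⟨hV, hP, hj, h⟩
    have := eq_of_mem_trails_profile hj h
    exact hL ⟨hV, hP, by omega⟩

lemma coef_mono {P Q : List ℕ → Prop} (h : ∀ L, P L → Q L) (n : ℕ) : coef P n ≤ coef Q n := by
  classical
  refine ENNReal.tsum_le_tsum fun L => ?_
  split_ifs with h1 h2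
  · exact le_rfl
  · exact absurd ⟨h1.1, h _ h1.2.1, h1.2.2⟩ h2
  · exact zero_le
  · exact le_rfl

lemma coef_zero (P : List ℕ → Prop) : coef P 0 = 0 := by
  classical
  rw [coef, ENNReal.tsum_eq_zero]
  intro L
  rw [if_neg]
  rintro ⟨hV, -, h⟩
  rw [List.sum_eq_zero_iff] at h
  obtain ⟨h1, h2⟩ := hV
  cases L with
  | nil => exact h1 rfl
  | cons a L => apply h2; rw [← h a (by simp)]; simp

lemma gf_congr {P Q : List ℕ → Prop} (h : ∀ L, Valid L → (P L ↔ Q L)) (x : ℝ≥0∞) :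
    gf P x = gf Q x := by
  classical
  refine tsum_congr fun L => ?_
  by_cases hV : Valid L
  · simp [hV, h L hV]
  · simp [hV]

lemma gf_add {P Q R : List ℕ → Prop} (h : ∀ L, Valid L → (P L ↔ (Q L ∨ R L)))
    (hd : ∀ L, Valid L → ¬ (Q L ∧ R L)) (x : ℝ≥0∞) : gf P x = gf Q x + gf R x := by
  classical
  rw [gf, gf, gf, ← ENNReal.tsum_add]
  refine tsum_congr fun L => ?_
  by_cases hV : Valid L
  · have := h L hV
    have := hd L hV
    by_cases hQ : Q L <;> by_cases hR : R L <;> simp_all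
  · simp [hV]

/-! ### Reversal -/

lemma rooted_append_two (L : List ℕ) (a b : ℕ) :
    rooted (L ++ [a, b]) = rooted (L ++ [a]) * (a + b - 1).choose b := by
  induction L with
  | nil => simp [rooted]
  | cons c L ih =>
    cases L with
    | nil => simp [rooted]
    | cons d L =>
      simp only [List.cons_append, rooted] at ih ⊢
      rw [ih, mul_assoc]

/-- Reflection symmetry of the walks, obtained by applying `choose_mul_symm` along the list. It
makes the weight `om` invariant under reversal. -/
lemma headD_mul_rooted_reverse (L : List ℕ) :
    L.headD 0 * rooted L.reverse = L.getLastD 0 * rooted L := by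
  induction L with
  | nil => simp
  | cons a L ih =>
    cases L with
    | nil => simp
    | cons b L =>
      have h1 : (a :: b :: L).reverse = L.reverse ++ [b, a] := by simp
      have h2 : (b :: L).reverse = L.reverse ++ [b] := by simp
      rw [h2] at ih
      rw [h1, rooted_append_two, rooted]
      have h3 : (a :: b :: L).getLastD 0 = (b :: L).getLastD 0 := by simp
      have h4 := choose_mul_symm b a
      rw [h3]
      simp only [List.headD_cons] at ih ⊢
      calc a * (rooted (L.reverse ++ [b]) * (b + a - 1).choose a)
          = ((b + a - 1).choose a * a) * rooted (L.reverse ++ [b]) := by ring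
        _ = (b + a - 1).choose b * (b * rooted (L.reverse ++ [b])) := by rw [h4]; ring
        _ = _ := by rw [ih, add_comm b a]; ring

lemma Valid.reverse {L : List ℕ} (h : Valid L) : Valid L.reverse :=
  ⟨by simpa using h.1, by simpa using h.2⟩

lemma valid_reverse_iff {L : List ℕ} : Valid L.reverse ↔ Valid L :=
  ⟨fun h => by simpa using h.reverse, Valid.reverse⟩

lemma headD_reverse (L : List ℕ) : L.reverse.headD 0 = L.getLastD 0 := by
  rw [List.headD_eq_head?_getD, List.head?_reverse, List.getLastD_eq_getLast?]

lemma getLastD_reverse (L : List ℕ) : L.reverse.getLastD 0 = L.headD 0 := by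
  rw [← headD_reverse, List.reverse_reverse]

lemma om_reverse {L : List ℕ} (hL : Valid L) : om L.reverse = om L := by
  have h1 : ((L.headD 0 : ℕ) : ℝ≥0∞) ≠ 0 := by exact_mod_cast hL.headD_ne_zero
  have h2 : ((L.getLastD 0 : ℕ) : ℝ≥0∞) ≠ 0 := by
    rw [← headD_reverse]; exact_mod_cast hL.reverse.headD_ne_zero
  have h := congrArg (Nat.cast (R := ℝ≥0∞)) (headD_mul_rooted_reverse L)
  push_cast at h
  rw [om, om, headD_reverse, ENNReal.eq_div_iff h1 (ENNReal.natCast_ne_top _), ← mul_div_assoc, h,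
    mul_comm, mul_div_assoc, mul_comm, ENNReal.div_self h2 (ENNReal.natCast_ne_top _), one_mul]

lemma gf_reverse (P : List ℕ → Prop) (x : ℝ≥0∞) : gf (fun L => P L.reverse) x = gf P x := by
  classical
  rw [gf, gf, ← Equiv.tsum_eq (Function.Involutive.toPerm _ (List.reverse_involutive (α := ℕ)))]
  refine tsum_congr fun L => ?_
  simp only [Function.Involutive.coe_toPerm, List.reverse_reverse]
  rw [valid_reverse_iff]
  by_cases hV : Valid L
  · rw [om_reverse hV, List.sum_reverse]
  · simp [hV]

/-! ### Splitting at adjacent ones -/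

/-- The number of adjacent pairs `1, 1`. -/
def count11 : List ℕ → ℕ
  | a :: b :: L => (if a = 1 ∧ b = 1 then 1 else 0) + count11 (b :: L)
  | _ => 0

lemma count11_append {L₁ L₂ : List ℕ} (h1 : L₁.getLastD 0 = 1) (h2 : L₂.headD 0 = 1) :
    count11 (L₁ ++ L₂) = count11 L₁ + count11 L₂ + 1 := by
  induction L₁ with
  | nil => simp at h1
  | cons a L ih =>
    cases L with
    | nil =>
      cases L₂ with
      | nil => simp at h2
      | cons b L₂ =>
        simp at h1 h2
        simp [count11, h1, h2, add_comm]
    | cons b L =>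
      have := ih (by simpa using h1)
      simp only [List.cons_append, count11] at this ⊢
      omega

lemma count11_append_two (L : List ℕ) (a b : ℕ) :
    count11 (L ++ [a, b]) = count11 (L ++ [a]) + if a = 1 ∧ b = 1 then 1 else 0 := by
  induction L with
  | nil => simp [count11]
  | cons c L ih =>
    cases L with
    | nil => simp [count11]
    | cons d L =>
      simp only [List.cons_append, count11] at ih ⊢
      rw [ih, add_assoc]

lemma count11_reverse (L : List ℕ) : count11 L.reverse = count11 L := by
  induction L with
  | nil => simp
  | cons a L ih =>
    cases L with
    | nil => simp
    | cons b L =>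
      have h1 : (a :: b :: L).reverse = L.reverse ++ [b, a] := by simp
      have h2 : (b :: L).reverse = L.reverse ++ [b] := by simp
      rw [h2] at ih
      rw [h1, count11_append_two, ih, count11, add_comm]
      simp only [and_comm]

/-- The binomial coefficient at the junction is `(1 + 1 - 1).choose 1 = 1`. -/
lemma rooted_append {L₁ L₂ : List ℕ} (h1 : L₁.getLastD 0 = 1) (h2 : L₂.headD 0 = 1) :
    rooted (L₁ ++ L₂) = rooted L₁ * rooted L₂ := by
  induction L₁ with
  | nil => simp at h1
  | cons a L ih =>
    cases L with
    | nil =>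
      cases L₂ with
      | nil => simp at h2
      | cons b L₂ =>
        simp at h1 h2
        simp [rooted, h1, h2]
    | cons b L =>
      have := ih (by simpa using h1)
      simp only [List.cons_append, rooted] at this ⊢
      rw [this, mul_assoc]

lemma exists_split {L : List ℕ} (h : 0 < count11 L) : ∃ L₁ L₂, L = L₁ ++ L₂ ∧
    L₁.getLastD 0 = 1 ∧ L₂.headD 0 = 1 ∧ count11 L₁ = 0 := by
  induction L with
  | nil => simp [count11] at h
  | cons a L ih =>
    cases L with
    | nil => simp [count11] at h
    | cons b L =>
      by_cases hab : a = 1 ∧ b = 1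
      · exact ⟨[a], b :: L, by simp, by simp [hab.1], by simp [hab.2], by simp [count11]⟩
      · rw [count11, if_neg hab, zero_add] at h
        obtain ⟨L₁, L₂, h1, h2, h3, h4⟩ := ih h
        cases L₁ with
        | nil => simp at h2
        | cons c L₁ =>
          simp only [List.cons_append, List.cons.injEq] at h1
          refine ⟨a :: c :: L₁, L₂, by simp [h1], by simpa using h2, h3, ?_⟩
          rw [count11, if_neg (by rwa [← h1.1]), h4]

lemma split_unique_aux {L₁ A L₂ : List ℕ} (h1 : L₁.getLastD 0 = 1)
    (h2 : (A ++ L₂).headD 0 = 1) (h : count11 (L₁ ++ A) = 0) : A = [] := by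
  cases A with
  | nil => rfl
  | cons a A =>
    rw [count11_append h1 (by simpa using h2)] at h
    omega

lemma split_unique {L₁ L₂ M₁ M₂ : List ℕ} (h : L₁ ++ L₂ = M₁ ++ M₂)
    (h1 : L₁.getLastD 0 = 1) (h2 : L₂.headD 0 = 1) (h3 : count11 L₁ = 0)
    (k1 : M₁.getLastD 0 = 1) (k2 : M₂.headD 0 = 1) (k3 : count11 M₁ = 0) :
    L₁ = M₁ ∧ L₂ = M₂ := by
  rcases List.append_eq_append_iff.1 h with ⟨A, rfl, rfl⟩ | ⟨A, rfl, rfl⟩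
  · have := split_unique_aux h1 h2 k3
    subst this; simp
  · have := split_unique_aux k1 k2 h3
    subst this; simp

/-- The lists with prescribed head, last entry and number of adjacent ones. -/
def cls (H E R : ℕ → Prop) (L : List ℕ) : Prop :=
  H (L.headD 0) ∧ E (L.getLastD 0) ∧ R (count11 L)

lemma headD_append {L₁ L₂ : List ℕ} (h : L₁ ≠ []) : (L₁ ++ L₂).headD 0 = L₁.headD 0 := by
  cases L₁ with
  | nil => exact absurd rfl h
  | cons a L => simp

lemma getLastD_append {L₁ L₂ : List ℕ} (h : L₂ ≠ []) :
    (L₁ ++ L₂).getLastD 0 = L₂.getLastD 0 := by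
  rw [← headD_reverse, ← headD_reverse, List.reverse_append, headD_append (by simpa using h)]

/-- Cut at the first adjacent pair `1, 1`: the left part then has no such pair, and the right part
has one fewer than the whole. Weights multiply because the right part begins with `1`, so dividing
by its head in `om` changes nothing. -/
theorem gf_split (H E R : ℕ → Prop) (x : ℝ≥0∞) :
    gf (cls H E fun k => 0 < k ∧ R (k - 1)) x
      = gf (cls H (· = 1) (· = 0)) x * gf (cls (· = 1) E R) x := by
  classical
  rw [gf, gf, gf, ← ENNReal.tsum_mul_right]
  simp only [← ENNReal.tsum_mul_left]
  rw [← ENNReal.tsum_prod (f := fun L₁ L₂ =>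
    (if Valid L₁ ∧ cls H (· = 1) (· = 0) L₁ then om L₁ * x ^ L₁.sum else 0) *
      if Valid L₂ ∧ cls (· = 1) E R L₂ then om L₂ * x ^ L₂.sum else 0)]
  have key : ∀ p : List ℕ × List ℕ, (Valid p.1 ∧ cls H (· = 1) (· = 0) p.1) →
      (Valid p.2 ∧ cls (· = 1) E R p.2) → (Valid (p.1 ++ p.2) ∧
        cls H E (fun k => 0 < k ∧ R (k - 1)) (p.1 ++ p.2)) := by
    rintro ⟨L₁, L₂⟩ ⟨hV1, hH, h1, h0⟩ ⟨hV2, h2, hE, hR⟩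
    refine ⟨⟨by simp [hV1.1], by simp [hV1.2, hV2.2]⟩, ?_, ?_, ?_⟩
    · rwa [headD_append hV1.1]
    · rwa [getLastD_append hV2.1]
    · rw [count11_append h1 h2, h0]
      simpa using hR
  refine tsum_eq_tsum_of_ne_zero_bij (fun p => p.1.1 ++ p.1.2) ?_ ?_ ?_
  · rintro ⟨⟨L₁, L₂⟩, hp⟩ ⟨⟨M₁, M₂⟩, hq⟩ h
    simp only [Function.mem_support, ne_eq, mul_eq_zero, not_or, ite_eq_right_iff,
      not_forall] at hp hq h
    obtain ⟨⟨hL1, -⟩, hL2, -⟩ := hp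
    obtain ⟨⟨hM1, -⟩, hM2, -⟩ := hq
    obtain ⟨rfl, rfl⟩ := split_unique h hL1.2.2.1 hL2.2.1 hL1.2.2.2 hM1.2.2.1 hM2.2.1 hM1.2.2.2
    rfl
  · intro L hL
    simp only [Function.mem_support, ne_eq, ite_eq_right_iff, not_forall] at hL
    obtain ⟨⟨hV, hH, hE, hpos, hR⟩, hne⟩ := hL
    obtain ⟨L₁, L₂, rfl, h1, h2, h0⟩ := exists_split hpos
    have hn1 : L₁ ≠ [] := by rintro rfl; simp at h1
    have hn2 : L₂ ≠ [] := by rintro rfl; simp at h2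
    have hz : 0 ∉ L₁ ∧ 0 ∉ L₂ := by simpa using hV.2
    rw [headD_append hn1] at hH
    rw [getLastD_append hn2] at hE
    rw [count11_append h1 h2, h0] at hR
    have c1 : Valid L₁ ∧ cls H (· = 1) (· = 0) L₁ := ⟨⟨hn1, hz.1⟩, hH, h1, h0⟩
    have c2 : Valid L₂ ∧ cls (· = 1) E R L₂ := ⟨⟨hn2, hz.2⟩, h2, hE, by simpa using hR⟩
    refine ⟨⟨(L₁, L₂), ?_⟩, rfl⟩
    simp only [Function.mem_support]
    rw [if_pos c1, if_pos c2]
    rw [om, rooted_append h1 h2, headD_append hn1, List.sum_append, pow_add] at hne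
    rw [om, om, h2]
    intro h
    apply hne
    rw [Nat.cast_one, div_one] at h
    rw [← h]
    push_cast
    simp only [div_eq_mul_inv]
    ring
  · rintro ⟨⟨L₁, L₂⟩, hp⟩
    simp only [Function.mem_support, ne_eq, mul_eq_zero, not_or, ite_eq_right_iff,
      not_forall] at hp
    obtain ⟨⟨c1, -⟩, c2, -⟩ := hp
    have c := key (L₁, L₂) c1 c2
    simp only at c ⊢
    rw [if_pos c, if_pos c1, if_pos c2]
    rw [om, rooted_append c1.2.2.1 c2.2.1, headD_append c1.1.1, List.sum_append, pow_add, om, om,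
      c2.2.1]
    push_cast
    simp only [div_eq_mul_inv, inv_one]
    ring

end SimpleWalk

namespace SimpleWalk

open scoped ENNReal

/-! ### Relations between the generating functions -/

lemma gf_cls_symm (H E R : ℕ → Prop) (x : ℝ≥0∞) : gf (cls H E R) x = gf (cls E H R) x := by
  rw [← gf_reverse]
  refine gf_congr (fun L _ => ?_) x
  rw [cls, cls, headD_reverse, getLastD_reverse, count11_reverse]
  tauto

/-- For `H` and `E` both `(· = 1)` this reads `A = A₀ + A₀ A`, so the series `A₀` of lists without
adjacent ones is `A / (1 + A)`. -/
lemma gf_cls_true (H E : ℕ → Prop) (x : ℝ≥0∞) :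
    gf (cls H E fun _ => True) x = gf (cls H E (· = 0)) x +
      gf (cls H (· = 1) (· = 0)) x * gf (cls (· = 1) E fun _ => True) x := by
  rw [← gf_split]
  refine gf_add (fun L _ => ?_) (fun L _ => ?_) x
  · simp only [cls]
    have := Nat.eq_zero_or_pos (count11 L)
    tauto
  · simp only [cls]
    rintro ⟨h1, h2⟩
    omega

lemma gf_cls_succ (H E : ℕ → Prop) (j : ℕ) (x : ℝ≥0∞) :
    gf (cls H E (· = j + 1)) x =
      gf (cls H (· = 1) (· = 0)) x * gf (cls (· = 1) E (· = j)) x := by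
  rw [← gf_split]
  refine gf_congr (fun L _ => ?_) x
  simp only [cls]
  have : count11 L = j + 1 ↔ 0 < count11 L ∧ count11 L - 1 = j := by omega
  tauto

lemma gf_cls_count (H E : ℕ → Prop) (j : ℕ) (x : ℝ≥0∞) :
    gf (cls H E (· = j + 1)) x = gf (cls H (· = 1) (· = 0)) x *
      gf (cls (· = 1) (· = 1) (· = 0)) x ^ j * gf (cls E (· = 1) (· = 0)) x := by
  induction j generalizing H with
  | zero => rw [gf_cls_succ, gf_cls_symm (· = 1) E, pow_zero, mul_one]
  | succ j ih => rw [gf_cls_succ, ih]; ring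

/-- Two positive integers with sum `2` are `1, 1`; otherwise a `2` is paired with one of the zeros
at the ends. -/
lemma pairCount_two {L : List ℕ} (hL : Valid L) :
    pairCount 2 (0 :: L) = (if L.headD 0 = 2 then 1 else 0) + (if L.getLastD 0 = 2 then 1 else 0)
      + count11 L := by
  have key : ∀ L : List ℕ, Valid L →
      pairCount 2 L = (if L.getLastD 0 = 2 then 1 else 0) + count11 L := by
    intro L
    induction L with
    | nil => intro h; exact absurd rfl h.1
    | cons a L ih =>
      intro hV
      cases L with
      | nil => simp [pairCount, count11]
      | cons b L =>
        have h0 := hV.2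
        simp only [List.mem_cons, not_or] at h0
        have := ih ⟨by simp, by simp only [List.mem_cons, not_or]; exact h0.2⟩
        have hab : a + b = 2 ↔ a = 1 ∧ b = 1 := by omega
        rw [pairCount, count11, this]
        simp only [hab, List.getLastD_cons]
        ring
  cases L with
  | nil => exact absurd rfl hL.1
  | cons a L =>
    rw [pairCount, key _ hL, zero_add, List.headD_cons, add_assoc]

lemma pairCount_one {L : List ℕ} (hL : Valid L) :
    pairCount 1 (0 :: L)
      = (if L.headD 0 = 1 then 1 else 0) + (if L.getLastD 0 = 1 then 1 else 0) := by
  have key : ∀ L : List ℕ, Valid L → pairCount 1 L = if L.getLastD 0 = 1 then 1 else 0 := by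
    intro L
    induction L with
    | nil => intro h; exact absurd rfl h.1
    | cons a L ih =>
      intro hV
      cases L with
      | nil => simp [pairCount]
      | cons b L =>
        have h0 := hV.2
        simp only [List.mem_cons, not_or] at h0
        have := ih ⟨by simp, by simp only [List.mem_cons, not_or]; exact h0.2⟩
        rw [pairCount, this, if_neg (by omega)]
        simp only [List.getLastD_cons, zero_add]
  cases L with
  | nil => exact absurd rfl hL.1
  | cons a L =>
    rw [pairCount, key _ hL, zero_add, List.headD_cons]

/-- At most two of the pairs lie at the ends, so a total of `k + 3` leaves at least one adjacent
pair `1, 1`. In all four cases, according to which ends equal `2`, the formula `gf_cls_count` thus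
applies. This is why `l > 2` is assumed. -/
theorem gf_pairCount_two (k : ℕ) (x : ℝ≥0∞) :
    gf (fun L => pairCount 2 (0 :: L) = k + 3) x = gf (cls (· = 1) (· = 1) (· = 0)) x ^ k *
      (gf (cls (· ≠ 2) (· = 1) (· = 0)) x * gf (cls (· = 1) (· = 1) (· = 0)) x +
        gf (cls (· = 2) (· = 1) (· = 0)) x) ^ 2 := by
  have h1 : gf (fun L => pairCount 2 (0 :: L) = k + 3) x =
      (gf (cls (· ≠ 2) (· ≠ 2) (· = k + 2 + 1)) x + gf (cls (· ≠ 2) (· = 2) (· = k + 1 + 1)) x) +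
      (gf (cls (· = 2) (· ≠ 2) (· = k + 1 + 1)) x + gf (cls (· = 2) (· = 2) (· = k + 1)) x) := by
    rw [← gf_add (P := fun L => pairCount 2 (0 :: L) = k + 3 ∧ L.headD 0 ≠ 2),
      ← gf_add (P := fun L => pairCount 2 (0 :: L) = k + 3 ∧ L.headD 0 = 2)]
    · refine gf_add (fun L _ => ?_) (fun L _ => ?_) x <;> tauto
    · intro L hL
      rw [pairCount_two hL]
      simp only [cls]
      split_ifs <;> omega
    · intro L _
      simp only [cls]
      tauto
    · intro L hL
      rw [pairCount_two hL]
      simp only [cls]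
      split_ifs <;> omega
    · intro L _
      simp only [cls]
      tauto
  rw [h1, gf_cls_count, gf_cls_count, gf_cls_count, gf_cls_count]
  ring

/-! ### Summation over lists of given length -/

lemma tsum_list_eq (F : List ℕ → ℝ≥0∞) :
    ∑' L, F L = F [] + ∑' a, ∑' L, F (a :: L) := by
  classical
  rw [ENNReal.tsum_eq_add_tsum_ite [], ← ENNReal.tsum_prod (f := fun a L => F (a :: L))]
  congr 1
  have hinj : Function.Injective fun p : ℕ × List ℕ => p.1 :: p.2 := by
    rintro ⟨a, L⟩ ⟨b, M⟩ h
    simpa using h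
  rw [← hinj.tsum_eq]
  · refine tsum_congr fun p => ?_
    rw [if_neg (by simp)]
  · intro L hL
    cases L with
    | nil => simp at hL
    | cons a L => exact ⟨(a, L), rfl⟩

open Classical in
/-- The total weight of the lists of length `m` that can follow the entry `j + 1` so that the last
entry satisfies `E`. -/
noncomputable def lengthGF (E : ℕ → Prop) (x : ℝ≥0∞) : ℕ → ℕ → ℝ≥0∞
  | 0, j => if E (j + 1) then 1 else 0
  | m + 1, j => ∑' k, ((j + k + 1).choose (k + 1) : ℝ≥0∞) * x ^ (k + 1) * lengthGF E x m k

open Classical in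
lemma tsum_length_eq (E : ℕ → Prop) (x : ℝ≥0∞) (m j : ℕ) :
    ∑' L : List ℕ, (if L.length = m ∧ 0 ∉ L ∧ E (((j + 1) :: L).getLastD 0)
      then (rooted ((j + 1) :: L) : ℝ≥0∞) * x ^ L.sum else 0) = lengthGF E x m j := by
  induction m generalizing j with
  | zero =>
    rw [tsum_eq_single []]
    · simp [lengthGF, rooted]
    · intro L hL
      rw [if_neg]
      rintro ⟨h, -⟩
      exact hL (List.length_eq_zero_iff.1 h)
  | succ m ih =>
    rw [tsum_list_eq, if_neg (by simp), zero_add, tsum_eq_zero_add' ENNReal.summable]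
    have h0 : ∑' L : List ℕ, (if (0 :: L).length = m + 1 ∧ 0 ∉ 0 :: L ∧
        E (((j + 1) :: 0 :: L).getLastD 0)
        then (rooted ((j + 1) :: 0 :: L) : ℝ≥0∞) * x ^ (0 :: L).sum else 0) = 0 := by
      rw [ENNReal.tsum_eq_zero]
      intro L
      rw [if_neg (by simp)]
    rw [h0, zero_add, lengthGF]
    refine tsum_congr fun k => ?_
    rw [← ih, ← ENNReal.tsum_mul_left]
    refine tsum_congr fun L => ?_
    simp only [List.length_cons, Nat.add_right_cancel_iff, List.mem_cons, not_or,
      List.getLastD_cons, rooted, List.sum_cons, mul_ite, mul_zero]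
    have : j + 1 + (k + 1) - 1 = j + k + 1 := by omega
    rw [this]
    have h1 : ¬ (0 = k + 1) := by omega
    simp only [h1, not_false_eq_true, true_and]
    split_ifs
    · push_cast; rw [pow_add]; ring
    · rfl

theorem gf_head_one (E : ℕ → Prop) (x : ℝ≥0∞) :
    gf (cls (· = 1) E fun _ => True) x = x * ∑' m, lengthGF E x m 0 := by
  classical
  simp only [← tsum_length_eq]
  rw [ENNReal.tsum_comm, gf, tsum_list_eq, if_neg (by simp [Valid]), zero_add,
    tsum_eq_single 1, ← ENNReal.tsum_mul_left]
  · refine tsum_congr fun L => ?_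
    rw [tsum_eq_single L.length]
    · simp only [Valid, cls, List.headD_cons, zero_add, true_and, and_true, om, Nat.cast_one,
        div_one, List.sum_cons, mul_ite, mul_zero, List.mem_cons, not_or]
      simp only [ne_eq, reduceCtorEq, not_false_eq_true, zero_ne_one, true_and]
      split_ifs
      · rw [pow_add]; ring
      · rfl
    · intro m hm
      rw [if_neg]
      rintro ⟨h, -⟩
      exact hm h.symm
  · intro a ha
    rw [ENNReal.tsum_eq_zero]
    intro L
    rw [if_neg]
    rintro ⟨-, h, -⟩
    exact ha (by simpa using h)

/-! ### Closed forms -/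

lemma tsum_ofReal_eq {f : ℕ → ℝ} {r : ℝ} (hf : ∀ n, 0 ≤ f n) (h : HasSum f r) :
    ∑' n, ENNReal.ofReal (f n) = ENNReal.ofReal r := by
  rw [← ENNReal.ofReal_tsum_of_nonneg hf h.summable, h.tsum_eq]

/-- `x = u / (1 + u)²`. -/
noncomputable def xOf (u : ℝ) : ℝ := u / (1 + u) ^ 2

/-- The `m`-th iterate of `y ↦ 1 / (1 - x y)` with `x = xOf u` has the expansion `qSeq u m + pSeq u
m * y + rSeq u m * y² + …` at `y = 0`. Here `y` marks the entry at depth `m` of a list. -/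
noncomputable def qSeq (u : ℝ) (m : ℕ) : ℝ := (1 + u) * (1 - u ^ m) / (1 - u ^ (m + 1))

noncomputable def pSeq (u : ℝ) (m : ℕ) : ℝ := (1 - u) ^ 2 * u ^ m / (1 - u ^ (m + 1)) ^ 2

noncomputable def rSeq (u : ℝ) (m : ℕ) : ℝ :=
  (1 - u) ^ 2 * u ^ (m + 1) * (1 - u ^ m) / ((1 + u) * (1 - u ^ (m + 1)) ^ 3)

lemma xOf_pos {u : ℝ} (h0 : 0 < u) : 0 < xOf u := by unfold xOf; positivity

section ClosedForms

variable {u : ℝ} (h0 : 0 < u) (h1 : u < 1)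

include h0 h1

lemma one_sub_pow_pos (m : ℕ) : 0 < 1 - u ^ (m + 1) :=
  sub_pos.2 (pow_lt_one₀ h0.le h1 (by omega))

lemma qSeq_nonneg (m : ℕ) : 0 ≤ qSeq u m :=
  div_nonneg (mul_nonneg (by linarith) (sub_nonneg.2 (pow_le_one₀ h0.le h1.le)))
    (one_sub_pow_pos h0 h1 m).le

/-- One step of the iteration, at `y = 0`; `pSeq_succ` and `rSeq_succ` are its first and second
order parts. -/
lemma one_sub_xOf_mul_qSeq (m : ℕ) : 1 - xOf u * qSeq u m = 1 / qSeq u (m + 1) := by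
  have := (one_sub_pow_pos h0 h1 m).ne'
  have := (one_sub_pow_pos h0 h1 (m + 1)).ne'
  have : (1 + u) ≠ 0 := by linarith
  rw [xOf, qSeq, qSeq]
  field_simp
  ring

lemma qSeq_succ_pos (m : ℕ) : 0 < qSeq u (m + 1) :=
  div_pos (mul_pos (by linarith) (one_sub_pow_pos h0 h1 m)) (one_sub_pow_pos h0 h1 (m + 1))

lemma pSeq_nonneg (m : ℕ) : 0 ≤ pSeq u m := by
  unfold pSeq; positivity

lemma rSeq_nonneg (m : ℕ) : 0 ≤ rSeq u m := by
  have := (one_sub_pow_pos h0 h1 m).le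
  have h2 : 0 ≤ 1 - u ^ m := sub_nonneg.2 (pow_le_one₀ h0.le h1.le)
  unfold rSeq; positivity

lemma pSeq_succ (m : ℕ) : pSeq u (m + 1) = xOf u * pSeq u m * qSeq u (m + 1) ^ 2 := by
  have := (one_sub_pow_pos h0 h1 m).ne'
  have := (one_sub_pow_pos h0 h1 (m + 1)).ne'
  have : (1 + u) ≠ 0 := by linarith
  rw [xOf, qSeq, pSeq, pSeq]
  field_simp
  ring

lemma rSeq_succ (m : ℕ) : rSeq u (m + 1) = xOf u * rSeq u m * qSeq u (m + 1) ^ 2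
    + xOf u ^ 2 * pSeq u m ^ 2 * qSeq u (m + 1) ^ 3 := by
  have := (one_sub_pow_pos h0 h1 m).ne'
  have := (one_sub_pow_pos h0 h1 (m + 1)).ne'
  have : (1 + u) ≠ 0 := by linarith
  rw [xOf, qSeq, pSeq, rSeq, rSeq]
  field_simp
  ring

lemma norm_xOf_mul_qSeq_lt (m : ℕ) : ‖xOf u * qSeq u m‖ < 1 := by
  have h2 := one_sub_xOf_mul_qSeq h0 h1 m
  have h3 : 0 < 1 / qSeq u (m + 1) := one_div_pos.2 (qSeq_succ_pos h0 h1 m)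
  have h4 : 0 ≤ xOf u * qSeq u m := mul_nonneg (xOf_pos h0).le (qSeq_nonneg h0 h1 m)
  rw [Real.norm_of_nonneg h4]
  linarith

lemma hasSum_choose_qSeq (j m : ℕ) :
    HasSum (fun k => ((k + j).choose j : ℝ) * (xOf u * qSeq u m) ^ k)
      (qSeq u (m + 1) ^ (j + 1)) := by
  have h := hasSum_choose_mul_geometric_of_norm_lt_one j (norm_xOf_mul_qSeq_lt h0 h1 m)
  rw [one_sub_xOf_mul_qSeq h0 h1 m] at h
  simpa using h

/-- The coefficient of `y` in `(q + p y + r y² + …) ^ (j + 1)`: summing over the next entry with the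
negative binomial series `∑ C(j + b, b) (x Y)ᵇ = (1 - x Y) ^ (-(j + 1))` performs one iteration. -/
lemma lengthGF_eq_one (m j : ℕ) :
    lengthGF (· = 1) (ENNReal.ofReal (xOf u)) (m + 1) j
      = ENNReal.ofReal ((j + 1) * pSeq u (m + 1) * qSeq u (m + 1) ^ j) := by
  have hx := (xOf_pos h0).le
  induction m generalizing j with
  | zero =>
    rw [lengthGF, tsum_eq_single 0]
    · have e1 : pSeq u (0 + 1) = xOf u := by
        have : (1 - u) ≠ 0 := by linarith
        have : (1 + u) ≠ 0 := by linarith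
        have h2 : 1 - u ^ 2 = (1 - u) * (1 + u) := by ring
        rw [pSeq, xOf, zero_add, h2]
        field_simp
      have e2 : qSeq u (0 + 1) = 1 := by
        have : (1 - u) ≠ 0 := by linarith
        have : (1 + u) ≠ 0 := by linarith
        have h2 : 1 - u ^ 2 = (1 - u) * (1 + u) := by ring
        rw [qSeq, zero_add, h2]
        field_simp
      rw [e1, e2]
      simp only [lengthGF, add_zero, zero_add, Nat.choose_one_right, pow_one, if_true, mul_one,
        one_pow]
      rw [ENNReal.ofReal_mul (by positivity), ← Nat.cast_add_one, ENNReal.ofReal_natCast]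
    · intro k hk
      simp [lengthGF, hk]
  | succ m ih =>
    rw [lengthGF]
    simp only [ih]
    have hp := pSeq_nonneg h0 h1 (m + 1)
    have hq := qSeq_nonneg h0 h1 (m + 1)
    rw [tsum_congr (g := fun k => ENNReal.ofReal ((j + 1) * (xOf u * pSeq u (m + 1)) *
      (((k + (j + 1)).choose (j + 1) : ℝ) * (xOf u * qSeq u (m + 1)) ^ k))), tsum_ofReal_eq]
    · intro k; positivity
    · have := (hasSum_choose_qSeq h0 h1 (j + 1) (m + 1)).mul_left
        ((j + 1) * (xOf u * pSeq u (m + 1)))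
      convert! this using 1
      rw [pSeq_succ h0 h1 (m + 1)]
      ring
    · intro k
      rw [← ENNReal.ofReal_natCast, ← ENNReal.ofReal_pow hx, ← ENNReal.ofReal_mul (by positivity),
        ← ENNReal.ofReal_mul (by positivity)]
      congr 1
      have hc : ((j + k + 1).choose (k + 1) : ℝ) * (k + 1)
          = (j + 1) * ((k + (j + 1)).choose (j + 1)) := by
        have := Nat.choose_succ_right_eq (j + k + 1) k
        rw [show j + k + 1 - k = j + 1 by omega] at this
        have h2 : (k + (j + 1)).choose (j + 1) = (j + k + 1).choose k := by
          rw [← Nat.choose_symm_add, show k + (j + 1) = j + k + 1 by omega]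
        rw [h2]
        exact_mod_cast this.trans (mul_comm _ _)
      calc _ = (((j + k + 1).choose (k + 1) : ℝ) * (k + 1)) *
          (xOf u ^ (k + 1) * pSeq u (m + 1) * qSeq u (m + 1) ^ k) := by ring
        _ = _ := by rw [hc, mul_pow]; ring

/-- The coefficient of `y²` in the same power: the square comes either from one factor, through `r`,
or from two factors, through `p` twice. -/
lemma lengthGF_eq_two (m j : ℕ) :
    lengthGF (· = 2) (ENNReal.ofReal (xOf u)) (m + 1) j
      = ENNReal.ofReal ((j + 1) * rSeq u (m + 1) * qSeq u (m + 1) ^ j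
        + (j + 1).choose 2 * pSeq u (m + 1) ^ 2 * qSeq u (m + 1) ^ (j - 1)) := by
  have hx := (xOf_pos h0).le
  induction m generalizing j with
  | zero =>
    rw [lengthGF, tsum_eq_single 1]
    · have e0 : (1 - u) ≠ 0 := by linarith
      have e0' : (1 + u) ≠ 0 := by linarith
      have h2 : 1 - u ^ 2 = (1 - u) * (1 + u) := by ring
      have e1 : pSeq u (0 + 1) = xOf u := by
        rw [pSeq, xOf, zero_add, h2]
        field_simp
      have e2 : qSeq u (0 + 1) = 1 := by
        rw [qSeq, zero_add, h2]
        field_simp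
      have e3 : rSeq u (0 + 1) = xOf u ^ 2 := by
        rw [rSeq, xOf, zero_add, h2]
        field_simp
      rw [e1, e2, e3]
      simp only [lengthGF, if_true, mul_one, one_pow]
      rw [← ENNReal.ofReal_natCast, ← ENNReal.ofReal_pow hx, ← ENNReal.ofReal_mul (by positivity)]
      congr 1
      have : (j + 1 + 1).choose 2 = (j + 1) + (j + 1).choose 2 := by
        rw [Nat.choose_succ_succ' (j + 1) 1, Nat.choose_one_right]
      rw [show (1 : ℕ) + 1 = 2 from rfl, this]
      push_cast
      ring
    · intro k hk
      have : ¬ (k + 1 = 2) := by omega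
      simp [lengthGF, hk]
  | succ m ih =>
    rw [lengthGF]
    simp only [ih]
    have hp := pSeq_nonneg h0 h1 (m + 1)
    have hq := qSeq_nonneg h0 h1 (m + 1)
    have hr := rSeq_nonneg h0 h1 (m + 1)
    rw [tsum_congr (g := fun k => ENNReal.ofReal (((j + k + 1).choose (k + 1) : ℝ) *
      xOf u ^ (k + 1) * ((k + 1) * rSeq u (m + 1) * qSeq u (m + 1) ^ k
        + (k + 1).choose 2 * pSeq u (m + 1) ^ 2 * qSeq u (m + 1) ^ (k - 1)))), tsum_ofReal_eq]
    · intro k; positivity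
    · have s1 : HasSum (fun k => ((j + k + 1).choose (k + 1) : ℝ) *
          xOf u ^ (k + 1) * ((k + 1) * rSeq u (m + 1) * qSeq u (m + 1) ^ k))
          ((j + 1) * (xOf u * rSeq u (m + 1)) * qSeq u (m + 1 + 1) ^ (j + 1 + 1)) := by
        convert! (hasSum_choose_qSeq h0 h1 (j + 1) (m + 1)).mul_left
          ((j + 1) * (xOf u * rSeq u (m + 1))) using 2 with k
        have hc : ((j + k + 1).choose (k + 1) : ℝ) * (k + 1)
            = (j + 1) * ((k + (j + 1)).choose (j + 1)) := by
          have := Nat.choose_succ_right_eq (j + k + 1) k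
          rw [show j + k + 1 - k = j + 1 by omega] at this
          have h2 : (k + (j + 1)).choose (j + 1) = (j + k + 1).choose k := by
            rw [← Nat.choose_symm_add, show k + (j + 1) = j + k + 1 by omega]
          rw [h2]
          exact_mod_cast this.trans (mul_comm _ _)
        calc _ = (((j + k + 1).choose (k + 1) : ℝ) * (k + 1)) *
            (xOf u ^ (k + 1) * rSeq u (m + 1) * qSeq u (m + 1) ^ k) := by ring
          _ = _ := by rw [hc, mul_pow]; ring
      have s2 : HasSum (fun k => ((j + k + 1).choose (k + 1) : ℝ) *
          xOf u ^ (k + 1) * ((k + 1).choose 2 * pSeq u (m + 1) ^ 2 * qSeq u (m + 1) ^ (k - 1)))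
          ((j + 2).choose 2 * (xOf u ^ 2 * pSeq u (m + 1) ^ 2) *
            qSeq u (m + 1 + 1) ^ (j + 2 + 1)) := by
        rw [← hasSum_nat_add_iff' 1, Finset.range_one, Finset.sum_singleton, zero_add,
          Nat.choose_eq_zero_of_lt one_lt_two, Nat.cast_zero, zero_mul, zero_mul, mul_zero,
          sub_zero]
        convert! (hasSum_choose_qSeq h0 h1 (j + 2) (m + 1)).mul_left
          ((j + 2).choose 2 * (xOf u ^ 2 * pSeq u (m + 1) ^ 2)) using 2 with k
        have hc : ((j + (k + 1) + 1).choose (k + 1 + 1) : ℝ) * (k + 1 + 1).choose 2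
            = (j + 2).choose 2 * ((k + (j + 2)).choose (j + 2)) := by
          have := Nat.choose_mul (n := j + k + 2) (k := k + 2) (s := 2) (by omega)
          have h3 := Nat.choose_mul (n := j + k + 2) (k := j + 2) (s := 2) (by omega)
          rw [show j + k + 2 - 2 = j + k by omega, show k + 2 - 2 = k by omega] at this
          rw [show j + k + 2 - 2 = j + k by omega, show j + 2 - 2 = j by omega] at h3
          rw [show j + (k + 1) + 1 = j + k + 2 by omega, show k + 1 + 1 = k + 2 by omega,
            show k + (j + 2) = j + k + 2 by omega]
          have h4 : (j + k).choose k = (j + k).choose j := (Nat.choose_symm_add).symm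
          rw [mul_comm ((j + 2).choose 2 : ℝ)]
          rw [h4, ← h3] at this
          exact_mod_cast this
        rw [Nat.add_sub_cancel]
        calc _ = (((j + (k + 1) + 1).choose (k + 1 + 1) : ℝ) * (k + 1 + 1).choose 2) *
            (xOf u ^ (k + 1 + 1) * pSeq u (m + 1) ^ 2 * qSeq u (m + 1) ^ k) := by ring
          _ = _ := by rw [hc, mul_pow]; ring
      convert! s1.add s2 using 1
      · funext k; ring
      · rw [rSeq_succ h0 h1 (m + 1), pSeq_succ h0 h1 (m + 1)]
        have : (j + 2).choose 2 = (j + 1) + (j + 1).choose 2 := by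
          rw [Nat.choose_succ_succ' (j + 1) 1, Nat.choose_one_right]
        rw [this]
        push_cast
        rcases j with _ | j
        · simp
        · rw [Nat.add_sub_cancel]; ring
    · intro k
      rw [← ENNReal.ofReal_natCast, ← ENNReal.ofReal_pow hx, ← ENNReal.ofReal_mul (by positivity),
        ← ENNReal.ofReal_mul (by positivity)]

/-- Allowing all lengths up to `m` adds the value `0` for the next entry, meaning that the list
stops. This completes the negative binomial series, whose value is a power of a convergent. -/
lemma sum_lengthGF_true (m j : ℕ) :
    ∑ i ∈ Finset.range (m + 1), lengthGF (fun _ => True) (ENNReal.ofReal (xOf u)) i j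
      = ENNReal.ofReal (qSeq u (m + 1) ^ (j + 1)) := by
  have hx := (xOf_pos h0).le
  induction m generalizing j with
  | zero =>
    have e2 : qSeq u (0 + 1) = 1 := by
      have e0 : (1 - u) ≠ 0 := by linarith
      have e0' : (1 + u) ≠ 0 := by linarith
      have h2 : 1 - u ^ 2 = (1 - u) * (1 + u) := by ring
      rw [qSeq, zero_add, h2]
      field_simp
    simp [lengthGF, e2]
  | succ m ih =>
    rw [Finset.sum_range_succ']
    simp only [lengthGF]
    rw [← Summable.tsum_finsetSum (fun _ _ => ENNReal.summable)]
    simp only [← Finset.mul_sum, ih, if_true]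
    have hq := qSeq_nonneg h0 h1 (m + 1)
    have h := hasSum_choose_qSeq h0 h1 j (m + 1)
    rw [← tsum_ofReal_eq (fun k => by positivity) h, add_comm]
    refine Eq.trans ?_ (tsum_eq_zero_add' ENNReal.summable).symm
    congr 1
    · simp
    · refine tsum_congr fun k => ?_
      rw [← ENNReal.ofReal_natCast, ← ENNReal.ofReal_pow hx, ← ENNReal.ofReal_mul (by positivity),
        ← ENNReal.ofReal_mul (by positivity)]
      congr 1
      have h2 : (j + k + 1).choose (k + 1) = (k + 1 + j).choose j := by
        rw [show k + 1 + j = j + (k + 1) by omega, Nat.choose_symm_add, add_assoc]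
      rw [h2, mul_pow]
      ring

theorem gf_one_one : gf (cls (· = 1) (· = 1) fun _ => True) (ENNReal.ofReal (xOf u)) =
    ∑' m : ℕ, ENNReal.ofReal
      (((1 - u) / (1 + u)) ^ 2 * (u ^ (m + 1) / (1 - u ^ (m + 1)) ^ 2)) := by
  rw [gf_head_one, ← ENNReal.tsum_mul_left]
  refine tsum_congr fun m => ?_
  have hm := (one_sub_pow_pos h0 h1 m).ne'
  have e0' : (1 + u) ≠ 0 := by linarith
  rcases m with _ | m
  · have e0 : (1 - u) ≠ 0 := by linarith
    simp only [lengthGF, zero_add, if_true, mul_one, pow_one]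
    congr 1
    rw [xOf]
    field_simp
  · rw [lengthGF_eq_one h0 h1, ← ENNReal.ofReal_mul (xOf_pos h0).le]
    congr 1
    rw [pSeq, xOf]
    push_cast
    field_simp
    ring

theorem gf_one_two : gf (cls (· = 1) (· = 2) fun _ => True) (ENNReal.ofReal (xOf u)) =
    ∑' m : ℕ, ENNReal.ofReal (((1 - u) / (1 + u)) ^ 2 / (1 + u) *
      (u ^ (m + 1) * (u - u ^ (m + 1)) / (1 - u ^ (m + 1)) ^ 3)) := by
  rw [gf_head_one, ← ENNReal.tsum_mul_left]
  refine tsum_congr fun m => ?_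
  have hm := (one_sub_pow_pos h0 h1 m).ne'
  have e0' : (1 + u) ≠ 0 := by linarith
  rcases m with _ | m
  · simp [lengthGF]
  · rw [lengthGF_eq_two h0 h1, ← ENNReal.ofReal_mul (xOf_pos h0).le]
    congr 1
    rw [rSeq, xOf]
    simp
    field_simp
    ring

/-- The convergents `qSeq u m` tend to the fixed point `1 + u` of `y ↦ 1 / (1 - x y)`. -/
theorem gf_one_any : gf (cls (· = 1) (fun _ => True) fun _ => True) (ENNReal.ofReal (xOf u)) =
    ENNReal.ofReal (u / (1 + u)) := by
  rw [gf_head_one]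
  have h2 : Tendsto (fun m => ∑ i ∈ Finset.range (m + 1),
      lengthGF (fun _ => True) (ENNReal.ofReal (xOf u)) i 0) atTop
      (nhds (∑' m, lengthGF (fun _ => True) (ENNReal.ofReal (xOf u)) m 0)) :=
    (tendsto_add_atTop_iff_nat 1).2 ENNReal.summable.hasSum.tendsto_sum_nat
  have h3 : Tendsto (fun m => ∑ i ∈ Finset.range (m + 1),
      lengthGF (fun _ => True) (ENNReal.ofReal (xOf u)) i 0) atTop
      (nhds (ENNReal.ofReal (1 + u))) := by
    simp only [sum_lengthGF_true h0 h1, zero_add, pow_one]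
    refine (ENNReal.continuous_ofReal.tendsto _).comp ?_
    have hp := (tendsto_pow_atTop_nhds_zero_of_lt_one h0.le h1)
    have hp1 := (tendsto_add_atTop_iff_nat 1).2 hp
    have hp2 := (tendsto_add_atTop_iff_nat 2).2 hp
    have := ((tendsto_const_nhds (x := (1 : ℝ))).sub hp1).const_mul (1 + u)
    have := this.div ((tendsto_const_nhds (x := (1 : ℝ))).sub hp2) (by norm_num)
    simpa [qSeq] using! this
  rw [tendsto_nhds_unique h2 h3, ← ENNReal.ofReal_mul (xOf_pos h0).le]
  congr 1
  have e0' : (1 + u) ≠ 0 := by linarith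
  rw [xOf]
  field_simp

end ClosedForms

end SimpleWalk

namespace SimpleWalk

/-! ### From the size of a function near its singularity to the size of its coefficients -/

/-- A neighbourhood of the disc `‖w - 1‖ < 1` that approaches `0` in a sector. -/
def discNbhd (δ : ℝ) : Set ℂ := {w | ∃ w₀ : ℂ, ‖w₀ - 1‖ < 1 ∧ ‖w - w₀‖ < δ * ‖w₀‖}

lemma ne_zero_of_norm_sub_one_lt {w : ℂ} (h : ‖w - 1‖ < 1) : w ≠ 0 := by
  rintro rfl; simp at h

lemma iteratedDeriv_of_hasSum {f : ℂ → ℂ} {a : ℕ → ℂ} {r : ℝ} (hr : 0 < r)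
    (h : ∀ z : ℂ, ‖z‖ < r → HasSum (fun n => a n * z ^ n) (f z)) (n : ℕ) :
    iteratedDeriv n f 0 = n.factorial * a n := by
  have hp : HasFPowerSeriesAt f (FormalMultilinearSeries.ofScalars ℂ a) 0 := by
    rw [hasFPowerSeriesAt_iff]
    filter_upwards [Metric.ball_mem_nhds (0 : ℂ) hr] with z hz
    rw [zero_add]
    simpa [FormalMultilinearSeries.coeff_ofScalars, mul_comm] using h z (by simpa using hz)
  obtain ⟨R, hR⟩ := hp
  have := hR.factorial_smul 1 n
  rw [iteratedDeriv_eq_iteratedFDeriv, ← this]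
  simp [FormalMultilinearSeries.ofScalars]

lemma norm_iteratedDeriv_zero_le {h : ℂ → ℂ} {r : ℝ} (hr : 0 < r)
    (hd : DifferentiableOn ℂ h (Metric.closedBall 0 r)) (n : ℕ) :
    ‖iteratedDeriv n h 0‖ ≤ n.factorial *
      (((2 * Real.pi)⁻¹ * ∫ θ : ℝ in 0..2 * Real.pi, ‖h (circleMap 0 r θ)‖) * r⁻¹ ^ n) := by
  lift r to NNReal using hr.le
  have h1 : HasFPowerSeriesOnBall h (cauchyPowerSeries h 0 r) 0 r :=
    DifferentiableOn.hasFPowerSeriesOnBall hd hr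
  have h2 := h1.factorial_smul 1 n
  rw [iteratedDeriv_eq_iteratedFDeriv, ← h2, nsmul_eq_mul, norm_mul]
  have h3 := norm_cauchyPowerSeries_le h 0 r n
  rw [abs_of_pos hr] at h3
  have h4 := (cauchyPowerSeries h 0 r n).le_opNorm (fun _ => 1)
  simp only [norm_one, Finset.prod_const_one, mul_one] at h4
  simp only [Complex.norm_natCast]
  gcongr
  exact h4.trans h3

/-- The Poisson kernel: `(1 - r²) / |1 - ζ|²` is the real part of `(1 + ζ) / (1 - ζ)`, whose mean
over the circle is its value `1` at the centre. -/
lemma integral_inv_norm_sq {r : ℝ} (h0 : 0 < r) (h1 : r < 1) :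
    (2 * Real.pi)⁻¹ * ∫ θ : ℝ in 0..2 * Real.pi, (‖1 - circleMap 0 r θ‖ ^ 2)⁻¹
      = (1 - r ^ 2)⁻¹ := by
  set G : ℂ → ℂ := fun ζ => (1 + ζ) / (1 - ζ)
  have hne : ∀ ζ ∈ Metric.closedBall (0 : ℂ) r, 1 - ζ ≠ 0 := by
    intro ζ hζ h
    have : ‖ζ‖ ≤ r := by simpa using hζ
    have h2 : ζ = 1 := by linear_combination -h
    rw [h2, norm_one] at this
    linarith
  have hG : DifferentiableOn ℂ G (Metric.closedBall 0 r) := by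
    intro ζ hζ
    exact ((differentiableAt_const _).add differentiableAt_id).div
      ((differentiableAt_const _).sub differentiableAt_id) (hne ζ hζ) |>.differentiableWithinAt
  have hcl : DiffContOnCl ℂ G (Metric.ball 0 |r|) := by
    rw [abs_of_pos h0]
    exact (hG.mono Metric.closure_ball_subset_closedBall).diffContOnCl
  have hmean := hcl.circleAverage
  rw [Real.circleAverage_def] at hmean
  have hG0 : G 0 = 1 := by simp [G]
  rw [hG0] at hmean
  have hcont : Continuous fun θ : ℝ => G (circleMap 0 r θ) := by
    rw [← continuousOn_univ]
    refine hG.continuousOn.comp (continuous_circleMap 0 r).continuousOn fun θ _ => ?_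
    exact circleMap_mem_closedBall 0 h0.le θ
  have hre := congrArg Complex.re hmean
  have hint : IntervalIntegrable (fun θ : ℝ => G (circleMap 0 r θ)) MeasureTheory.volume 0
    (2 * Real.pi) := hcont.intervalIntegrable _ _
  rw [Complex.smul_re, ← Complex.reCLM_apply,
    ← ContinuousLinearMap.intervalIntegral_comp_comm _ hint, smul_eq_mul, Complex.one_re] at hre
  have hpt : ∀ θ : ℝ, (‖1 - circleMap 0 r θ‖ ^ 2)⁻¹
      = (1 - r ^ 2)⁻¹ * Complex.reCLM (G (circleMap 0 r θ)) := by
    intro θ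
    set ζ := circleMap 0 r θ
    have hζ : ‖ζ‖ = r := by simp [ζ, abs_of_pos h0]
    have hn : Complex.normSq ζ = r ^ 2 := by rw [Complex.normSq_eq_norm_sq, hζ]
    have hpos : 0 < Complex.normSq (1 - ζ) := by
      rw [Complex.normSq_pos]
      exact hne ζ (by simp [hζ])
    have hr2 : 1 - r ^ 2 ≠ 0 := by nlinarith
    rw [Complex.reCLM_apply, Complex.div_re, ← Complex.normSq_eq_norm_sq]
    rw [Complex.normSq_apply] at hn
    simp only [Complex.add_re, Complex.sub_re, Complex.one_re, Complex.add_im, Complex.sub_im,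
      Complex.one_im]
    field_simp
    nlinarith
  simp only [hpt, intervalIntegral.integral_const_mul]
  rw [mul_left_comm, hre, mul_one]

lemma one_sub_mem_discNbhd {δ : ℝ} {ζ ξ : ℂ} (hζ : ‖ζ‖ < 1) (h : ‖ξ - ζ‖ < δ * ‖1 - ζ‖) :
    1 - ξ ∈ discNbhd δ := by
  refine ⟨1 - ζ, by simpa using hζ, ?_⟩
  rwa [show (1 - ξ) - (1 - ζ) = ζ - ξ by ring, norm_sub_rev]

/-- Cauchy's estimate on a circle around `ζ` of radius proportional to its distance from the
singularity `1`: each derivative costs one power of that distance. -/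
lemma norm_iteratedDeriv_le_of_discNbhd {δ κ : ℝ} (hδ : 0 < δ) (hκ : 0 ≤ κ) (m : ℕ) {F : ℂ → ℂ}
    {C : ℝ} (hF : DifferentiableOn ℂ F (discNbhd δ))
    (hb : ∀ w ∈ discNbhd δ, ‖F w‖ ≤ C * ‖w‖ ^ κ) {ζ : ℂ} (hζ : ‖ζ‖ < 1) :
    ‖iteratedDeriv m (fun ξ => F (1 - ξ)) ζ‖ ≤
      m.factorial * (C * (1 + δ) ^ κ / (δ / 2) ^ m) * (‖1 - ζ‖ ^ κ / ‖1 - ζ‖ ^ m) := by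
  have hpos : 0 < ‖1 - ζ‖ := by
    rw [norm_pos_iff]; exact ne_zero_of_norm_sub_one_lt (by simpa using hζ)
  have hsub : ∀ ξ ∈ Metric.closedBall ζ (δ / 2 * ‖1 - ζ‖), 1 - ξ ∈ discNbhd δ := by
    intro ξ hξ
    refine one_sub_mem_discNbhd hζ ?_
    rw [Metric.mem_closedBall, dist_eq_norm] at hξ
    nlinarith [mul_pos hδ hpos]
  have hopen : IsOpen (discNbhd δ) := by
    have : discNbhd δ = ⋃ w₀ ∈ Metric.ball (1 : ℂ) 1, Metric.ball w₀ (δ * ‖w₀‖) := by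
      ext w; simp [discNbhd, dist_eq_norm]
    rw [this]
    exact isOpen_biUnion fun _ _ => Metric.isOpen_ball
  have hd : DifferentiableOn ℂ (fun ξ => F (1 - ξ))
      (Metric.closedBall ζ (δ / 2 * ‖1 - ζ‖)) := by
    intro ξ hξ
    have h1 := (hF (1 - ξ) (hsub ξ hξ)).differentiableAt (hopen.mem_nhds (hsub ξ hξ))
    exact (h1.comp ξ ((differentiableAt_const _).sub differentiableAt_id)).differentiableWithinAt
  have hC : 0 ≤ C := by
    have := (norm_nonneg _).trans (hb (1 - ζ) (hsub ζ (by simp; positivity)))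
    have h2 : 0 < ‖1 - ζ‖ ^ κ := Real.rpow_pos_of_pos hpos _
    nlinarith
  have := Complex.norm_iteratedDeriv_le_of_forall_mem_sphere_norm_le m
    (R := δ / 2 * ‖1 - ζ‖) (C := C * ((1 + δ) * ‖1 - ζ‖) ^ κ) (by positivity)
    (hd.mono Metric.closure_ball_subset_closedBall).diffContOnCl (fun ξ hξ => by
      refine (hb _ (hsub ξ (Metric.sphere_subset_closedBall hξ))).trans ?_
      gcongr
      rw [mem_sphere_iff_norm] at hξ
      calc ‖1 - ξ‖ = ‖(1 - ζ) - (ξ - ζ)‖ := by congr 1; ring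
        _ ≤ ‖1 - ζ‖ + ‖ξ - ζ‖ := norm_sub_le _ _
        _ ≤ _ := by rw [hξ]; nlinarith [mul_pos hδ hpos])
  refine this.trans (le_of_eq ?_)
  rw [Real.mul_rpow (by positivity) hpos.le, mul_pow]
  field_simp

/-- Differentiate until the bound is singular enough, then apply Cauchy's formula on a circle at
distance `1 / (n + 1)` from the unit circle, in the variable `4 z`. `K` and `N` depend only on `δ`
and `κ`; the uniformity in `l` of the final estimate rests on this. -/
theorem norm_coeff_le_of_discNbhd {δ κ : ℝ} (hδ : 0 < δ) (hκ : 0 ≤ κ) :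
    ∃ K : ℝ, ∃ N : ℕ, ∀ (F : ℂ → ℂ) (C : ℝ) (g : ℕ → ℂ), DifferentiableOn ℂ F (discNbhd δ) →
      (∀ w ∈ discNbhd δ, ‖F w‖ ≤ C * ‖w‖ ^ κ) →
      (∀ z : ℂ, ‖z‖ < 1 / 4 → HasSum (fun n => g n * z ^ n) (F (1 - 4 * z))) →
      ∀ n, N ≤ n → ‖g n‖ ≤ K * C * 4 ^ n * (n : ℝ) ^ (-κ - 1) := by
  -- With `m` derivatives the bound is `|1 - ζ| ^ (κ - m)`. For `m ≥ κ + 2` a factor `|1 - ζ| ^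
  -- (-2)` can be kept for the Poisson integral, and the rest is estimated by `|1 - ζ| ≥ 1 / (n +
  -- 1)`.
  obtain ⟨m, hm⟩ : ∃ m : ℕ, κ + 2 ≤ m := exists_nat_ge _
  have hm1 : 1 ≤ m := by
    by_contra h
    have : m = 0 := by omega
    rw [this] at hm; norm_num at hm; linarith
  set B : ℝ := m.factorial * ((1 + δ) ^ κ / (δ / 2) ^ m) with hB
  refine ⟨B * Real.exp 1 * 2 ^ (m : ℝ) * 2 ^ ((m : ℝ) - κ - 1), 2 * m, ?_⟩
  intro F C g hF hb hg n hn
  set f : ℂ → ℂ := fun ξ => F (1 - ξ) with hf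
  have hpos : ∀ ζ : ℂ, ‖ζ‖ < 1 → 0 < ‖1 - ζ‖ := fun ζ hζ => by
    rw [norm_pos_iff]; exact ne_zero_of_norm_sub_one_lt (by simpa using hζ)
  have hmem : ∀ ζ : ℂ, ‖ζ‖ < 1 → 1 - ζ ∈ discNbhd δ := fun ζ hζ =>
    one_sub_mem_discNbhd hζ (by simpa using mul_pos hδ (hpos ζ hζ))
  have hC : 0 ≤ C := by
    have := (norm_nonneg _).trans (hb (1 - 0) (hmem 0 (by simp)))
    simpa using this
  have hBC : 0 ≤ B := by positivity
  have hopen : IsOpen (discNbhd δ) := by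
    have : discNbhd δ = ⋃ w₀ ∈ Metric.ball (1 : ℂ) 1, Metric.ball w₀ (δ * ‖w₀‖) := by
      ext w; simp [discNbhd, dist_eq_norm]
    rw [this]
    exact isOpen_biUnion fun _ _ => Metric.isOpen_ball
  have hfd : DifferentiableOn ℂ f (Metric.ball 0 1) := by
    intro ξ hξ
    have hξ' : ‖ξ‖ < 1 := by simpa using hξ
    have h1 := (hF (1 - ξ) (hmem ξ hξ')).differentiableAt (hopen.mem_nhds (hmem ξ hξ'))
    exact (h1.comp ξ ((differentiableAt_const _).sub differentiableAt_id)).differentiableWithinAt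
  set h : ℂ → ℂ := iteratedDeriv m f with hh
  have hhd : DifferentiableOn ℂ h (Metric.ball 0 1) := by
    have : ∀ k : ℕ, DifferentiableOn ℂ (iteratedDeriv k f) (Metric.ball 0 1) := by
      intro k
      induction k with
      | zero => simpa using hfd
      | succ k ih => rw [iteratedDeriv_succ]; exact ih.deriv Metric.isOpen_ball
    exact this m
  have hn1 : (1 : ℝ) ≤ n := by exact_mod_cast (by omega : 1 ≤ n)
  set r : ℝ := 1 - 1 / (n + 1) with hr
  have hr1 : r = n / (n + 1) := by rw [hr]; field_simp; ring
  have hr0 : 0 < r := by rw [hr1]; positivity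
  have hrlt : r < 1 := by
    have : (0 : ℝ) < 1 / (n + 1) := by positivity
    linarith
  obtain ⟨j, hj⟩ : ∃ j, n = j + m := ⟨n - m, by omega⟩
  have hcomp : iteratedDeriv j h 0 = iteratedDeriv n f 0 := by
    rw [hh, hj, iteratedDeriv_eq_iterate, iteratedDeriv_eq_iterate, iteratedDeriv_eq_iterate,
      Function.iterate_add_apply]
  have hcoef : iteratedDeriv n f 0 = n.factorial * (g n / 4 ^ n) := by
    refine iteratedDeriv_of_hasSum (a := fun n => g n / 4 ^ n) one_pos (fun z hz => ?_) n
    have := hg (z / 4) (by rw [norm_div]; simp; linarith)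
    rw [hf]
    convert this using 2 with k
    · rw [div_pow]; ring
    · ring
  have hptw : ∀ θ : ℝ, ‖h (circleMap 0 r θ)‖ ≤
      B * C * ((n : ℝ) + 1) ^ ((m : ℝ) - κ - 2) * (‖1 - circleMap 0 r θ‖ ^ 2)⁻¹ := by
    intro θ
    set ζ := circleMap 0 r θ
    have hζ : ‖ζ‖ = r := by simp [ζ, abs_of_pos hr0]
    have hζ1 : ‖ζ‖ < 1 := by rw [hζ]; exact hrlt
    have hp := hpos ζ hζ1
    refine (norm_iteratedDeriv_le_of_discNbhd hδ hκ m hF hb hζ1).trans ?_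
    have h1 : m.factorial * (C * (1 + δ) ^ κ / (δ / 2) ^ m) = B * C := by rw [hB]; ring
    rw [h1, mul_assoc (B * C)]
    refine mul_le_mul_of_nonneg_left ?_ (by positivity)
    have hlow : 1 / ((n : ℝ) + 1) ≤ ‖1 - ζ‖ := by
      have := norm_sub_norm_le (1 : ℂ) ζ
      rw [norm_one, hζ] at this
      rw [hr] at this; linarith
    have h2 : ‖1 - ζ‖ ^ κ / ‖1 - ζ‖ ^ m
        = (‖1 - ζ‖⁻¹) ^ ((m : ℝ) - κ - 2) * (‖1 - ζ‖ ^ 2)⁻¹ := by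
      rw [Real.inv_rpow hp.le, ← Real.rpow_neg hp.le, ← Real.rpow_natCast, ← Real.rpow_natCast,
        ← Real.rpow_neg hp.le, ← Real.rpow_sub hp, ← Real.rpow_add hp]
      congr 1
      push_cast
      ring
    rw [h2]
    refine mul_le_mul_of_nonneg_right ?_ (by positivity)
    refine Real.rpow_le_rpow (by positivity) ?_ (by linarith)
    rw [inv_le_comm₀ hp (by positivity)]
    simpa using hlow
  have hballs : Metric.closedBall (0 : ℂ) r ⊆ Metric.ball 0 1 := Metric.closedBall_subset_ball hrlt
  have hcm : Continuous fun θ : ℝ => circleMap 0 r θ := continuous_circleMap 0 r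
  have hint1 : Continuous fun θ : ℝ => ‖h (circleMap 0 r θ)‖ := by
    refine Continuous.norm ?_
    rw [← continuousOn_univ]
    exact hhd.continuousOn.comp hcm.continuousOn fun θ _ =>
      hballs (circleMap_mem_closedBall 0 hr0.le θ)
  have hint2 : Continuous fun θ : ℝ => (‖1 - circleMap 0 r θ‖ ^ 2)⁻¹ := by
    refine Continuous.inv₀ (by fun_prop) fun θ => ?_
    have : ‖circleMap 0 r θ‖ < 1 := by simpa [abs_of_pos hr0] using hrlt
    exact (pow_pos (hpos _ this) 2).ne'
  have hI : (2 * Real.pi)⁻¹ * ∫ θ : ℝ in 0..2 * Real.pi, ‖h (circleMap 0 r θ)‖ ≤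
      B * C * ((n : ℝ) + 1) ^ ((m : ℝ) - κ - 2) * ((n : ℝ) + 1) := by
    have h1 : ∫ θ : ℝ in 0..2 * Real.pi, ‖h (circleMap 0 r θ)‖ ≤
        ∫ θ : ℝ in 0..2 * Real.pi,
          B * C * ((n : ℝ) + 1) ^ ((m : ℝ) - κ - 2) * (‖1 - circleMap 0 r θ‖ ^ 2)⁻¹ :=
      intervalIntegral.integral_mono_on (by positivity) (hint1.intervalIntegrable _ _)
        ((hint2.const_mul _).intervalIntegrable _ _) fun θ _ => hptw θ
    rw [intervalIntegral.integral_const_mul] at h1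
    have h2 := integral_inv_norm_sq hr0 hrlt
    have h3 : (1 - r ^ 2)⁻¹ ≤ (n : ℝ) + 1 := by
      rw [inv_le_comm₀ (by nlinarith) (by positivity)]
      have : ((n : ℝ) + 1)⁻¹ = 1 - r := by rw [hr]; ring
      rw [this]; nlinarith
    calc _ ≤ (2 * Real.pi)⁻¹ * (B * C * ((n : ℝ) + 1) ^ ((m : ℝ) - κ - 2) *
          ∫ θ : ℝ in 0..2 * Real.pi, (‖1 - circleMap 0 r θ‖ ^ 2)⁻¹) := by gcongr
      _ = B * C * ((n : ℝ) + 1) ^ ((m : ℝ) - κ - 2) * (1 - r ^ 2)⁻¹ := by rw [← h2]; ring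
      _ ≤ _ := by gcongr
  have hmain := norm_iteratedDeriv_zero_le hr0 (hhd.mono hballs) j
  rw [hcomp, hcoef, norm_mul, norm_div, norm_pow, Complex.norm_natCast,
    Complex.norm_ofNat] at hmain
  have hrj : r⁻¹ ^ j ≤ Real.exp 1 := by
    have h1 : r⁻¹ = 1 + 1 / (n : ℝ) := by rw [hr1]; field_simp
    have h2 : (1 : ℝ) ≤ r⁻¹ := by rw [h1]; have : (0 : ℝ) ≤ 1 / n := by positivity
                                  linarith
    calc r⁻¹ ^ j ≤ r⁻¹ ^ n := pow_le_pow_right₀ h2 (by omega)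
      _ ≤ (Real.exp (1 / n)) ^ n := by
        gcongr
        rw [h1, add_comm]; exact Real.add_one_le_exp _
      _ = Real.exp 1 := by
        rw [← Real.exp_nat_mul]; congr 1; field_simp
  -- Undoing the `m` derivatives divides by `n! / (n - m)!`, which is at least `(n / 2) ^ m` because
  -- `n ≥ 2 m`.
  have hfact : ((j.factorial : ℝ)) * ((n : ℝ) / 2) ^ m ≤ n.factorial := by
    have h1 : j.factorial * (j + 1) ^ m ≤ n.factorial := by
      rw [hj]; exact Nat.factorial_mul_pow_le_factorial
    have h2 : ((n : ℝ) / 2) ≤ j + 1 := by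
      have : n ≤ 2 * (j + 1) := by omega
      have : (n : ℝ) ≤ 2 * (j + 1) := by exact_mod_cast this
      linarith
    calc ((j.factorial : ℝ)) * ((n : ℝ) / 2) ^ m ≤ j.factorial * ((j : ℝ) + 1) ^ m := by gcongr
      _ ≤ _ := by exact_mod_cast h1
  have hjpos : (0 : ℝ) < j.factorial := by exact_mod_cast j.factorial_pos
  have hX : (n.factorial : ℝ) * (‖g n‖ / 4 ^ n) ≤ j.factorial *
      (B * C * ((n : ℝ) + 1) ^ ((m : ℝ) - κ - 2) * ((n : ℝ) + 1) * Real.exp 1) := by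
    refine hmain.trans ?_
    gcongr
  have hY : ((n : ℝ) / 2) ^ m * (‖g n‖ / 4 ^ n) ≤
      B * C * ((n : ℝ) + 1) ^ ((m : ℝ) - κ - 2) * ((n : ℝ) + 1) * Real.exp 1 := by
    refine le_of_mul_le_mul_left ?_ hjpos
    refine le_trans ?_ hX
    rw [← mul_assoc]
    gcongr
  have hn0 : (0 : ℝ) < n := by linarith
  have hZ : ((n : ℝ) + 1) ^ ((m : ℝ) - κ - 2) * ((n : ℝ) + 1)
      ≤ 2 ^ ((m : ℝ) - κ - 1) * (n : ℝ) ^ ((m : ℝ) - κ - 1) := by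
    have : ((n : ℝ) + 1) ^ ((m : ℝ) - κ - 2) * ((n : ℝ) + 1)
        = ((n : ℝ) + 1) ^ ((m : ℝ) - κ - 1) := by
      rw [← Real.rpow_add_one (by positivity)]; congr 1; ring
    rw [this, ← Real.mul_rpow (by norm_num) hn0.le]
    exact Real.rpow_le_rpow (by positivity) (by linarith) (by linarith)
  have hW : (n : ℝ) ^ ((m : ℝ) - κ - 1) = (n : ℝ) ^ m * (n : ℝ) ^ (-κ - 1) := by
    rw [← Real.rpow_natCast, ← Real.rpow_add hn0]; congr 1; ring
  have h4 : (0 : ℝ) < 4 ^ n := by positivity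
  have hnm : (0 : ℝ) < (n : ℝ) ^ m := by positivity
  rw [div_pow, div_mul_div_comm, div_le_iff₀ (by positivity)] at hY
  rw [Real.rpow_natCast]
  refine le_of_mul_le_mul_left (hY.trans ?_) hnm
  calc B * C * ((n : ℝ) + 1) ^ ((m : ℝ) - κ - 2) * ((n : ℝ) + 1) * Real.exp 1 * (2 ^ m * 4 ^ n)
      = B * C * Real.exp 1 * (2 ^ m * 4 ^ n) *
        (((n : ℝ) + 1) ^ ((m : ℝ) - κ - 2) * ((n : ℝ) + 1)) := by ring
    _ ≤ B * C * Real.exp 1 * (2 ^ m * 4 ^ n) *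
        (2 ^ ((m : ℝ) - κ - 1) * (n : ℝ) ^ ((m : ℝ) - κ - 1)) := by gcongr
    _ = _ := by rw [hW]; ring

end SimpleWalk

namespace SimpleWalk

/-! ### Two Lambert series -/

/-- `∑ σ₁(k) uᵏ` as a Lambert series. -/
noncomputable def lambertP (u : ℂ) : ℂ := ∑' m : ℕ, u ^ (m + 1) / (1 - u ^ (m + 1)) ^ 2

/-- `∑ σ₂(k) uᵏ` as a Lambert series. -/
noncomputable def lambertQ (u : ℂ) : ℂ :=
  ∑' m : ℕ, u ^ (m + 1) * (1 + u ^ (m + 1)) / (1 - u ^ (m + 1)) ^ 3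

lemma one_sub_le_norm_one_sub_pow {u : ℂ} {r : ℝ} (hu : ‖u‖ ≤ r) (hr : r < 1) (m : ℕ) :
    1 - r ≤ ‖1 - u ^ (m + 1)‖ := by
  have h1 : ‖u ^ (m + 1)‖ ≤ ‖u‖ := by
    rw [norm_pow]
    exact pow_le_of_le_one (norm_nonneg _) (by linarith) (by omega)
  have := norm_sub_norm_le (1 : ℂ) (u ^ (m + 1))
  rw [norm_one] at this
  linarith

lemma norm_lambertP_term_le {u : ℂ} {r : ℝ} (hu : ‖u‖ ≤ r) (hr : r < 1) (m : ℕ) :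
    ‖u ^ (m + 1) / (1 - u ^ (m + 1)) ^ 2‖ ≤ ‖u‖ ^ (m + 1) / (1 - r) ^ 2 := by
  have h := one_sub_le_norm_one_sub_pow hu hr m
  have : 0 < 1 - r := by linarith
  rw [norm_div, norm_pow, norm_pow]
  gcongr

lemma norm_lambertQ_term_le {u : ℂ} {r : ℝ} (hu : ‖u‖ ≤ r) (hr : r < 1) (m : ℕ) :
    ‖u ^ (m + 1) * (1 + u ^ (m + 1)) / (1 - u ^ (m + 1)) ^ 3‖
      ≤ ‖u‖ ^ (m + 1) * 2 / (1 - r) ^ 3 := by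
  have h := one_sub_le_norm_one_sub_pow hu hr m
  have : 0 < 1 - r := by linarith
  have h2 : ‖1 + u ^ (m + 1)‖ ≤ 2 := by
    refine (norm_add_le _ _).trans ?_
    rw [norm_one, norm_pow]
    have : ‖u‖ ^ (m + 1) ≤ 1 := pow_le_one₀ (norm_nonneg _) (by linarith)
    linarith
  rw [norm_div, norm_mul, norm_pow, norm_pow]
  gcongr

lemma summable_pow_succ {r : ℝ} (h0 : 0 ≤ r) (h1 : r < 1) :
    Summable fun m : ℕ => r ^ (m + 1) :=
  (summable_nat_add_iff 1).2 (summable_geometric_of_lt_one h0 h1)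

lemma summable_lambertP {u : ℂ} (hu : ‖u‖ < 1) :
    Summable fun m : ℕ => u ^ (m + 1) / (1 - u ^ (m + 1)) ^ 2 :=
  Summable.of_norm_bounded ((summable_pow_succ (norm_nonneg u) hu).div_const _)
    fun m => norm_lambertP_term_le le_rfl hu m

lemma summable_lambertQ {u : ℂ} (hu : ‖u‖ < 1) :
    Summable fun m : ℕ => u ^ (m + 1) * (1 + u ^ (m + 1)) / (1 - u ^ (m + 1)) ^ 3 :=
  Summable.of_norm_bounded (((summable_pow_succ (norm_nonneg u) hu).mul_right 2).div_const _)
    fun m => norm_lambertQ_term_le le_rfl hu m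

lemma one_sub_pow_ne_zero {u : ℂ} (hu : ‖u‖ < 1) (m : ℕ) : 1 - u ^ (m + 1) ≠ 0 := by
  have := one_sub_le_norm_one_sub_pow le_rfl hu m
  rw [← norm_pos_iff]
  linarith

lemma differentiableAt_lambertP {u : ℂ} (hu : ‖u‖ < 1) : DifferentiableAt ℂ lambertP u := by
  obtain ⟨r, hr0, hr1⟩ := exists_between hu
  have hr : 0 ≤ r := (norm_nonneg u).trans hr0.le
  have hd : DifferentiableOn ℂ lambertP (Metric.ball 0 r) := by
    refine Complex.differentiableOn_tsum_of_summable_norm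
      ((summable_pow_succ hr hr1).div_const ((1 - r) ^ 2)) (fun m => ?_) Metric.isOpen_ball
      fun m w hw => ?_
    · intro w hw
      have hw' : ‖w‖ < 1 := by have : ‖w‖ < r := by simpa using hw
                               linarith
      have := one_sub_pow_ne_zero hw' m
      exact (DifferentiableAt.fun_div (𝕜 := ℂ) (c := fun w : ℂ => w ^ (m + 1))
        (d := fun w : ℂ => (1 - w ^ (m + 1)) ^ 2) (by fun_prop) (by fun_prop)
        (pow_ne_zero 2 this)).differentiableWithinAt
    · have hw' : ‖w‖ < r := by simpa using hw
      refine (norm_lambertP_term_le hw'.le hr1 m).trans ?_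
      have : 0 < 1 - r := by linarith
      gcongr
  exact hd.differentiableAt (Metric.isOpen_ball.mem_nhds (by simpa using hr0))

lemma differentiableAt_lambertQ {u : ℂ} (hu : ‖u‖ < 1) : DifferentiableAt ℂ lambertQ u := by
  obtain ⟨r, hr0, hr1⟩ := exists_between hu
  have hr : 0 ≤ r := (norm_nonneg u).trans hr0.le
  have hd : DifferentiableOn ℂ lambertQ (Metric.ball 0 r) := by
    refine Complex.differentiableOn_tsum_of_summable_norm
      (((summable_pow_succ hr hr1).mul_right 2).div_const ((1 - r) ^ 3)) (fun m => ?_)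
      Metric.isOpen_ball fun m w hw => ?_
    · intro w hw
      have hw' : ‖w‖ < 1 := by have : ‖w‖ < r := by simpa using hw
                               linarith
      have := one_sub_pow_ne_zero hw' m
      exact (DifferentiableAt.fun_div (𝕜 := ℂ) (c := fun w : ℂ => w ^ (m + 1) * (1 + w ^ (m + 1)))
        (d := fun w : ℂ => (1 - w ^ (m + 1)) ^ 3) (by fun_prop) (by fun_prop)
        (pow_ne_zero 3 this)).differentiableWithinAt
    · have hw' : ‖w‖ < r := by simpa using hw
      refine (norm_lambertQ_term_le hw'.le hr1 m).trans ?_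
      have : 0 < 1 - r := by linarith
      gcongr
  exact hd.differentiableAt (Metric.isOpen_ball.mem_nhds (by simpa using hr0))

lemma norm_lambertP_le {u : ℂ} (hu : ‖u‖ ≤ 1 / 2) : ‖lambertP u‖ ≤ 8 * ‖u‖ := by
  have h1 : ‖u‖ < 1 := by linarith
  have hs := (summable_pow_succ (norm_nonneg u) h1).div_const ((1 - 1 / 2 : ℝ) ^ 2)
  have h2 : ∑' m : ℕ, ‖u‖ ^ (m + 1) / (1 - 1 / 2 : ℝ) ^ 2 = ‖u‖ * (1 - ‖u‖)⁻¹ * 4 := by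
    rw [tsum_div_const]
    simp only [pow_succ']
    rw [tsum_mul_left, tsum_geometric_of_lt_one (norm_nonneg u) h1]
    norm_num
    ring
  refine (tsum_of_norm_bounded hs.hasSum
    fun m => norm_lambertP_term_le hu (by norm_num) m).trans ?_
  rw [h2]
  have h3 : (1 - ‖u‖)⁻¹ ≤ 2 := by
    rw [inv_le_comm₀ (by linarith) (by norm_num)]; linarith
  nlinarith [norm_nonneg u]

lemma lambertP_eq_tsum_sigma {u : ℂ} (hu : ‖u‖ < 1) :
    lambertP u = ∑' n : ℕ+, (ArithmeticFunction.sigma 1 n : ℂ) * u ^ (n : ℕ) := by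
  rw [← tsum_prod_pow_eq_tsum_sigma 1 hu,
    tsum_pnat_eq_tsum_succ (f := fun d => ∑' c : ℕ+, (c : ℂ) ^ 1 * u ^ (d * c : ℕ)), lambertP]
  refine tsum_congr fun m => ?_
  have h1 : ‖u ^ (m + 1)‖ < 1 := by
    rw [norm_pow]; exact pow_lt_one₀ (norm_nonneg _) hu (by omega)
  rw [← tsum_coe_mul_geometric_of_norm_lt_one h1,
    ← tsum_zero_pnat_eq_tsum_nat (f := fun n : ℕ => (n : ℂ) * (u ^ (m + 1)) ^ n)]
  · simp [pow_mul]
  · exact (hasSum_coe_mul_geometric_of_norm_lt_one h1).summable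

/-- The inversion formula of the first Lambert series. -/
theorem lambertP_exp_neg {t : ℂ} (ht : 0 < t.re) :
    lambertP (Complex.exp (-t)) = 1 / 24 + Real.pi ^ 2 / (6 * t ^ 2) - 1 / (2 * t)
      - 4 * Real.pi ^ 2 / t ^ 2 * lambertP (Complex.exp (-(4 * Real.pi ^ 2 / t))) := by
  have ht0 : t ≠ 0 := by rintro rfl; simp at ht
  have hpi : (Real.pi : ℂ) ≠ 0 := by exact_mod_cast Real.pi_ne_zero
  have hI := Complex.I_ne_zero
  -- With `z = i t / (2 π)` the nome is `exp (-t)`, and `S` replaces `t` by `4 π² / t`. The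
  -- quasimodular term of `G₂` produces `-1 / (2 t)`.
  set z : UpperHalfPlane := ⟨Complex.I * t / (2 * Real.pi), by
    have : Complex.I * t / (2 * Real.pi) = ((1 / (2 * Real.pi) : ℝ) : ℂ) * (Complex.I * t) := by
      push_cast; field_simp
    rw [this, Complex.im_ofReal_mul]
    simp only [Complex.mul_im, Complex.I_re, Complex.I_im, zero_mul, one_mul, zero_add]
    positivity⟩ with hz
  have hzc : (z : ℂ) = Complex.I * t / (2 * Real.pi) := rfl
  have hq : Complex.exp (2 * Real.pi * Complex.I * z) = Complex.exp (-t) := by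
    congr 1
    rw [hzc]
    field_simp
    rw [Complex.I_sq]
  have hSz : ((ModularGroup.S • z : UpperHalfPlane) : ℂ) = (-(z : ℂ))⁻¹ := by
    rw [UpperHalfPlane.modular_S_smul]
  have hqS : Complex.exp (2 * Real.pi * Complex.I * (ModularGroup.S • z : UpperHalfPlane))
      = Complex.exp (-(4 * Real.pi ^ 2 / t)) := by
    congr 1
    rw [hSz, hzc]
    field_simp
    norm_num
  have hn1 : ‖Complex.exp (-t)‖ < 1 := by
    rw [Complex.norm_exp]; simpa using ht
  have hn2 : ‖Complex.exp (-(4 * Real.pi ^ 2 / t))‖ < 1 := by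
    rw [← hqS]; exact UpperHalfPlane.norm_exp_two_pi_I_lt_one _
  have h := EisensteinSeries.G2_S_transform z
  rw [EisensteinSeries.G2_eq_tsum_cexp, EisensteinSeries.G2_eq_tsum_cexp, hq, hqS,
    ← lambertP_eq_tsum_sigma hn1, ← lambertP_eq_tsum_sigma hn2, riemannZeta_two, hzc] at h
  field_simp at h
  rw [Complex.I_sq] at h
  field_simp
  linear_combination (6 : ℂ) * h

lemma exp_neg_mul_pow_le (N : ℕ) {x : ℝ} (hx : 0 < x) :
    Real.exp (-x) ≤ N.factorial / x ^ N := by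
  rw [Real.exp_neg, inv_le_comm₀ (Real.exp_pos x) (by positivity), inv_div]
  exact Real.pow_div_factorial_le_exp x hx.le N

/-- In the sector `Re (4 π² / t) ≥ π² / |t|`, so the transformed Lambert series is exponentially
small and beats every power of `t`. -/
lemma norm_lambertP_sub_le (N : ℕ) : ∃ C : ℝ, ∀ t : ℂ, t ≠ 0 → ‖t‖ ≤ 1 → ‖t‖ / 4 ≤ t.re →
    ‖lambertP (Complex.exp (-t)) - (1 / 24 + Real.pi ^ 2 / (6 * t ^ 2) - 1 / (2 * t))‖
      ≤ C * ‖t‖ ^ N := by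
  refine ⟨4 * Real.pi ^ 2 * (8 * ((N + 2).factorial / Real.pi ^ (2 * (N + 2)))), ?_⟩
  intro t ht0 ht1 hsec
  have hpos : 0 < ‖t‖ := norm_pos_iff.2 ht0
  have hre : 0 < t.re := by linarith
  have hE : ‖Complex.exp (-(4 * Real.pi ^ 2 / t))‖ ≤ Real.exp (-(Real.pi ^ 2 / ‖t‖)) := by
    rw [Complex.norm_exp, Real.exp_le_exp, Complex.neg_re, neg_le_neg_iff]
    have h1 : (4 * (Real.pi : ℂ) ^ 2 / t).re = 4 * Real.pi ^ 2 * (t.re / ‖t‖ ^ 2) := by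
      have : (4 * (Real.pi : ℂ) ^ 2 / t) = ((4 * Real.pi ^ 2 : ℝ) : ℂ) * t⁻¹ := by
        push_cast; rw [div_eq_mul_inv]
      rw [this, Complex.re_ofReal_mul, Complex.inv_re, Complex.normSq_eq_norm_sq]
    rw [h1, div_le_iff₀ hpos]
    have h2 : 4 * Real.pi ^ 2 * (t.re / ‖t‖ ^ 2) * ‖t‖ = Real.pi ^ 2 * (4 * t.re / ‖t‖) := by
      field_simp
    rw [h2]
    have h3 : 1 ≤ 4 * t.re / ‖t‖ := by rw [le_div_iff₀ hpos]; linarith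
    nlinarith [Real.pi_pos]
  have hE2 := hE.trans (exp_neg_mul_pow_le (N + 2) (by positivity))
  have hhalf : ‖Complex.exp (-(4 * Real.pi ^ 2 / t))‖ ≤ 1 / 2 := by
    refine (hE.trans (exp_neg_mul_pow_le 1 (by positivity))).trans ?_
    have : (2 : ℝ) ≤ Real.pi ^ 2 := by nlinarith [Real.pi_gt_three]
    rw [pow_one, Nat.factorial_one, Nat.cast_one, one_div_div, div_le_div_iff₀ (by positivity)
      (by norm_num)]
    linarith
  rw [lambertP_exp_neg hre, sub_sub_cancel_left, norm_neg, norm_mul, norm_div, norm_mul, norm_pow,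
    norm_pow, Complex.norm_real, Real.norm_of_nonneg Real.pi_pos.le, Complex.norm_ofNat]
  calc 4 * Real.pi ^ 2 / ‖t‖ ^ 2 * ‖lambertP (Complex.exp (-(4 * Real.pi ^ 2 / t)))‖
      ≤ 4 * Real.pi ^ 2 / ‖t‖ ^ 2 * (8 * ((N + 2).factorial / (Real.pi ^ 2 / ‖t‖) ^ (N + 2))) := by
        gcongr
        refine (norm_lambertP_le hhalf).trans ?_
        gcongr
    _ = _ := by
        rw [div_pow, ← pow_mul, pow_add ‖t‖ N 2]
        field_simp

end SimpleWalk

namespace SimpleWalk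

/-! ### The second Lambert series near `u = 1` -/

lemma hasSum_sq_mul_geometric {y : ℂ} (hy : ‖y‖ < 1) :
    HasSum (fun n : ℕ => (n : ℂ) ^ 2 * y ^ n) (y * (1 + y) / (1 - y) ^ 3) := by
  have h0 := hasSum_choose_mul_geometric_of_norm_lt_one 0 hy
  have h1 := hasSum_choose_mul_geometric_of_norm_lt_one 1 hy
  have h2 := hasSum_choose_mul_geometric_of_norm_lt_one 2 hy
  have hne : 1 - y ≠ 0 := by simpa using one_sub_pow_ne_zero hy 0
  convert! ((h2.mul_left 2).sub (h1.mul_left 3)).add h0 using 1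
  · funext n
    have e2 : ((n + 2).choose 2 : ℂ) = (n + 2) * (n + 1) / 2 := by
      rw [Nat.cast_choose_two]; push_cast; ring
    rw [e2, Nat.choose_one_right, Nat.choose_zero_right]
    push_cast
    ring
  · field_simp
    ring

/-- Lipschitz's formula in weight `3`: the left side is `∑ n² exp (-n x)`. -/
lemma latticeSum_eq {x : ℂ} (hx : 0 < x.re) :
    Complex.exp (-x) * (1 + Complex.exp (-x)) / (1 - Complex.exp (-x)) ^ 3
      = ∑' n : ℤ, 2 / (x - 2 * Real.pi * Complex.I * n) ^ 3 := by
  have hpi : (Real.pi : ℂ) ≠ 0 := by exact_mod_cast Real.pi_ne_zero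
  have hI := Complex.I_ne_zero
  have hn1 : ‖Complex.exp (-x)‖ < 1 := by
    rw [Complex.norm_exp]; simpa using hx
  set z : UpperHalfPlane := ⟨Complex.I * x / (2 * Real.pi), by
    have : Complex.I * x / (2 * Real.pi) = ((1 / (2 * Real.pi) : ℝ) : ℂ) * (Complex.I * x) := by
      push_cast; field_simp
    rw [this, Complex.im_ofReal_mul]
    simp only [Complex.mul_im, Complex.I_re, Complex.I_im, zero_mul, one_mul, zero_add]
    positivity⟩ with hz
  have hzc : (z : ℂ) = Complex.I * x / (2 * Real.pi) := rfl
  have hq : Complex.exp (2 * Real.pi * Complex.I * z) = Complex.exp (-x) := by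
    congr 1
    rw [hzc]
    field_simp
    rw [Complex.I_sq, neg_one_mul]
  have h := EisensteinSeries.qExpansion_identity (k := 2) (by norm_num) z
  rw [hq, (hasSum_sq_mul_geometric hn1).tsum_eq] at h
  have h2 : ∀ n : ℤ, 2 / (x - 2 * Real.pi * Complex.I * n) ^ 3
      = 2 * (Complex.I / (2 * Real.pi)) ^ 3 * (1 / ((z : ℂ) + n) ^ 3) := by
    intro n
    have h3 : (z : ℂ) + n = Complex.I / (2 * Real.pi) * (x - 2 * Real.pi * Complex.I * n) := by
      rw [hzc]
      field_simp
      linear_combination (2 * Real.pi * n : ℂ) * Complex.I_sq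
    have h4 : Complex.I / (2 * Real.pi) ≠ 0 := div_ne_zero hI (by simp [hpi])
    rw [h3, mul_pow, one_div, mul_inv, div_eq_mul_inv, mul_assoc 2 ((Complex.I / (2 * Real.pi)) ^ 3),
      mul_inv_cancel_left₀ (pow_ne_zero 3 h4)]
  rw [tsum_congr h2, tsum_mul_left, h, Nat.factorial_two]
  have h6 : Complex.I ^ 6 = -1 := by
    rw [show 6 = 2 * 3 by norm_num, pow_mul, Complex.I_sq]; norm_num
  have h7 : 2 * (Complex.I / (2 * Real.pi)) ^ 3
      * ((-2 * Real.pi * Complex.I) ^ (2 + 1) / ((2 : ℕ) : ℂ)) = 1 := by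
    push_cast
    field_simp
    linear_combination (-1 : ℂ) * h6
  rw [← mul_assoc, h7, one_mul]

/-- There is no cancellation in the sector. If `|b| ≤ 2 m |t|`, the real part alone is at least `m
|t| / 4 ≥ (m |t| + |b|) / 12`; otherwise the reverse triangle inequality suffices. -/
lemma norm_add_I_mul_ge {t : ℂ} (hsec : ‖t‖ / 4 ≤ t.re) (m : ℕ) (b : ℝ) :
    (m * ‖t‖ + |b|) / 12 ≤ ‖(m : ℂ) * t + Complex.I * b‖ := by
  have hn : ‖(m : ℂ) * t‖ = m * ‖t‖ := by rw [norm_mul, Complex.norm_natCast]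
  have hb : ‖Complex.I * (b : ℂ)‖ = |b| := by simp
  have h1 := norm_sub_norm_le (Complex.I * (b : ℂ)) (-((m : ℂ) * t))
  rw [norm_neg, hn, hb, sub_neg_eq_add, add_comm (Complex.I * (b : ℂ))] at h1
  have h2 : m * (‖t‖ / 4) ≤ ‖(m : ℂ) * t + Complex.I * b‖ := by
    refine le_trans ?_ (Complex.re_le_norm _)
    have : ((m : ℂ) * t + Complex.I * b).re = m * t.re := by simp
    rw [this]
    gcongr
  have h3 : (0 : ℝ) ≤ m * ‖t‖ := by positivity
  rcases le_total (2 * (m * ‖t‖)) |b| with h | h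
  · linarith
  · linarith

/-- A Riemann sum for the integral of `2 / x³` along the ray from `i b`, whose value is `1 / (i b)²
= -1 / b²`. It is compared term by term with the telescoping differences of `1 / x²`. -/
lemma telescoping_bound {t : ℂ} (hsec : ‖t‖ / 4 ≤ t.re) (ht : t ≠ 0) {b : ℝ}
    (hb : b ≠ 0)
    (hs : Summable fun m : ℕ => 2 / (((m + 1 : ℕ) : ℂ) * t + Complex.I * b) ^ 3) :
    ‖t * ∑' m : ℕ, 2 / (((m + 1 : ℕ) : ℂ) * t + Complex.I * b) ^ 3 + 1 / (b : ℂ) ^ 2‖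
      ≤ 3 * 12 ^ 5 * ‖t‖ / |b| ^ 3 := by
  have hT : 0 < ‖t‖ := norm_pos_iff.2 ht
  have hB : 0 < |b| := abs_pos.2 hb
  set x : ℕ → ℂ := fun m => (m : ℂ) * t + Complex.I * b with hx
  set a : ℕ → ℝ := fun m => m * ‖t‖ + |b| with ha
  have hapos : ∀ m, 0 < a m := fun m => by simp only [ha]; positivity
  have hxlow : ∀ m, a m / 12 ≤ ‖x m‖ := fun m => norm_add_I_mul_ge hsec m b
  have hxpos : ∀ m, 0 < ‖x m‖ := fun m => lt_of_lt_of_le (by have := hapos m; positivity) (hxlow m)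
  have hx0 : ∀ m, x m ≠ 0 := fun m => norm_pos_iff.1 (hxpos m)
  have hxup : ∀ m, ‖x m‖ ≤ a m := fun m => by
    refine (norm_add_le _ _).trans ?_
    simp [ha]
  have hstep : ∀ m, x (m + 1) = x m + t := fun m => by simp only [hx]; push_cast; ring
  have hastep : ∀ m, a (m + 1) = a m + ‖t‖ := fun m => by simp only [ha]; push_cast; ring
  have haB : ∀ m, |b| ≤ a m := fun m => by
    have : (0 : ℝ) ≤ m * ‖t‖ := by positivity
    simp only [ha]; linarith
  set d : ℕ → ℂ := fun m => t * (2 / x (m + 1) ^ 3) - (1 / x m ^ 2 - 1 / x (m + 1) ^ 2) with hd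
  -- The numerator of `d m` gives the factor `3`, and the five factors in its denominator give `12 ^
  -- 5`. The majorant telescopes as well.
  have hdb : ∀ m, ‖d m‖ ≤ 3 * 12 ^ 5 * ‖t‖ / |b| ^ 2 * (1 / a m - 1 / a (m + 1)) := by
    intro m
    have e1 : d m = -(t ^ 2 * (x (m + 1) + 2 * x m) / (x (m + 1) ^ 3 * x m ^ 2)) := by
      have h1 := hx0 m
      have h2 := hx0 (m + 1)
      have h3 : t = x (m + 1) - x m := by rw [hstep]; ring
      simp only [hd]
      rw [h3]
      field_simp
      ring
    have hnum : ‖x (m + 1) + 2 * x m‖ ≤ 3 * a (m + 1) := by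
      refine (norm_add_le _ _).trans ?_
      rw [norm_mul, Complex.norm_ofNat]
      have := hxup m
      have := hxup (m + 1)
      have := hastep m
      linarith
    rw [e1, norm_neg, norm_div, norm_mul, norm_mul, norm_pow, norm_pow, norm_pow]
    have p0 := hapos m
    have p1 := hapos (m + 1)
    calc ‖t‖ ^ 2 * ‖x (m + 1) + 2 * x m‖ / (‖x (m + 1)‖ ^ 3 * ‖x m‖ ^ 2)
        ≤ ‖t‖ ^ 2 * (3 * a (m + 1)) / ((a (m + 1) / 12) ^ 3 * (a m / 12) ^ 2) := by
          have := hxlow m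
          have := hxlow (m + 1)
          gcongr
      _ = 3 * 12 ^ 5 * ‖t‖ ^ 2 / (a (m + 1) * a m) * (1 / (a (m + 1) * a m)) := by
          field_simp
      _ ≤ 3 * 12 ^ 5 * ‖t‖ ^ 2 / (|b| * |b|) * (1 / (a (m + 1) * a m)) := by
          have := haB m
          have := haB (m + 1)
          gcongr
      _ = 3 * 12 ^ 5 * ‖t‖ / |b| ^ 2 * (‖t‖ / (a (m + 1) * a m)) := by
          field_simp
      _ = _ := by
          congr 1
          rw [div_sub_div _ _ p0.ne' p1.ne', hastep]
          congr 1
          · ring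
          · ring
  have hpart : ∀ N, ∑ m ∈ Finset.range N,
      3 * 12 ^ 5 * ‖t‖ / |b| ^ 2 * (1 / a m - 1 / a (m + 1)) ≤ 3 * 12 ^ 5 * ‖t‖ / |b| ^ 3 := by
    intro N
    rw [← Finset.mul_sum, Finset.sum_range_sub' (fun m => 1 / a m)]
    have h0 : a 0 = |b| := by simp [ha]
    rw [h0]
    have := hapos N
    calc 3 * 12 ^ 5 * ‖t‖ / |b| ^ 2 * (1 / |b| - 1 / a N)
        ≤ 3 * 12 ^ 5 * ‖t‖ / |b| ^ 2 * (1 / |b|) := by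
          gcongr
          have : 0 ≤ 1 / a N := by positivity
          linarith
      _ = _ := by field_simp
  have hnn : ∀ m, 0 ≤ 3 * 12 ^ 5 * ‖t‖ / |b| ^ 2 * (1 / a m - 1 / a (m + 1)) :=
    fun m => (norm_nonneg _).trans (hdb m)
  have hsum := summable_of_sum_range_le hnn hpart
  have hdsum : Summable d := Summable.of_norm_bounded hsum hdb
  have hdle : ‖∑' m, d m‖ ≤ 3 * 12 ^ 5 * ‖t‖ / |b| ^ 3 :=
    (tsum_of_norm_bounded hsum.hasSum hdb).trans (hsum.tsum_le_of_sum_range_le hpart)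
  have hs' : Summable fun m => t * (2 / x (m + 1) ^ 3) := hs.mul_left t
  have hv : Summable fun m => 1 / x m ^ 2 - 1 / x (m + 1) ^ 2 := by
    have := hs'.sub hdsum
    refine this.congr fun m => ?_
    simp only [hd]; ring
  have hv0 : Tendsto (fun N => 1 / x N ^ 2) atTop (nhds 0) := by
    have hinv : Tendsto (fun N => (x N)⁻¹) atTop (nhds 0) := by
      rw [tendsto_zero_iff_norm_tendsto_zero]
      simp only [norm_inv]
      refine Tendsto.inv_tendsto_atTop ?_
      refine tendsto_atTop_mono hxlow ?_
      refine Tendsto.atTop_div_const (by norm_num) ?_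
      exact tendsto_atTop_add_const_right _ _
        (tendsto_natCast_atTop_atTop.atTop_mul_const hT)
    have := hinv.pow 2
    simpa [inv_pow] using this
  have hvsum : ∑' m, (1 / x m ^ 2 - 1 / x (m + 1) ^ 2) = -(1 / (b : ℂ) ^ 2) := by
    refine tendsto_nhds_unique hv.hasSum.tendsto_sum_nat ?_
    have h1 : ∀ N, ∑ m ∈ Finset.range N, (1 / x m ^ 2 - 1 / x (m + 1) ^ 2)
        = 1 / x 0 ^ 2 - 1 / x N ^ 2 := fun N => Finset.sum_range_sub' (fun m => 1 / x m ^ 2) N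
    simp only [h1]
    have h2 : 1 / x 0 ^ 2 = -(1 / (b : ℂ) ^ 2) := by
      simp only [hx, Nat.cast_zero, zero_mul, zero_add, mul_pow, Complex.I_sq]
      rw [neg_one_mul, div_neg]
    rw [h2]
    have := hv0.const_sub (-(1 / (b : ℂ) ^ 2))
    rwa [sub_zero] at this
  have hfin : t * ∑' m : ℕ, 2 / (((m + 1 : ℕ) : ℂ) * t + Complex.I * b) ^ 3 + 1 / (b : ℂ) ^ 2
      = ∑' m, d m := by
    rw [← tsum_mul_left]
    simp only [hd]
    rw [hs'.tsum_sub hv, hvsum, sub_neg_eq_add]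
  rw [hfin]
  exact hdle

lemma summable_lattice {t : ℂ} (ht : 0 < t.re) :
    Summable fun p : ℕ × ℤ =>
      2 / (((p.1 + 1 : ℕ) : ℂ) * t - 2 * Real.pi * Complex.I * p.2) ^ 3 := by
  have hpi : (Real.pi : ℂ) ≠ 0 := by exact_mod_cast Real.pi_ne_zero
  have hI := Complex.I_ne_zero
  set z : UpperHalfPlane := ⟨Complex.I * t / (2 * Real.pi), by
    have : Complex.I * t / (2 * Real.pi) = ((1 / (2 * Real.pi) : ℝ) : ℂ) * (Complex.I * t) := by
      push_cast; field_simp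
    rw [this, Complex.im_ofReal_mul]
    simp only [Complex.mul_im, Complex.I_re, Complex.I_im, zero_mul, one_mul, zero_add]
    positivity⟩ with hz
  have hzc : (z : ℂ) = Complex.I * t / (2 * Real.pi) := rfl
  have h := (EisensteinSeries.summable_norm_eisSummand (k := 3) (by norm_num) z).of_norm
  have hinj : Function.Injective fun p : ℕ × ℤ => (![((p.1 + 1 : ℕ) : ℤ), p.2] : Fin 2 → ℤ) := by
    rintro ⟨a, b⟩ ⟨c, d⟩ h
    have h0 := congrFun h 0
    have h1 := congrFun h 1
    simp at h0 h1
    simp [h0, h1]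
  have h2 := (h.comp_injective hinj).mul_left (2 * (Complex.I / (2 * Real.pi)) ^ 3)
  refine h2.congr ?_
  rintro ⟨m, n⟩
  have h3 : (((m + 1 : ℕ) : ℤ) : ℂ) * z + n
      = Complex.I / (2 * Real.pi) * (((m + 1 : ℕ) : ℂ) * t - 2 * Real.pi * Complex.I * n) := by
    rw [hzc]
    push_cast
    field_simp
    linear_combination (2 * Real.pi * n : ℂ) * Complex.I_sq
  simp only [Function.comp_apply, EisensteinSeries.eisSummand, Matrix.cons_val_zero,
    Matrix.cons_val_one, h3]
  rw [zpow_neg, mul_zpow, mul_inv, div_eq_mul_inv, mul_assoc]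
  congr 1
  rw [← zpow_natCast, ← zpow_natCast]
  rw [show ((3 : ℕ) : ℤ) = 3 from rfl, mul_inv_cancel_left₀]
  exact zpow_ne_zero _ (div_ne_zero hI (by simp [hpi]))

lemma hasSum_one_div_int_sq : HasSum (fun n : ℤ => 1 / (n : ℝ) ^ 2) (Real.pi ^ 2 / 3) := by
  have h1 : HasSum (fun n : ℕ => 1 / (((n : ℤ) : ℝ)) ^ 2) (Real.pi ^ 2 / 6) := by
    simpa using hasSum_zeta_two
  have h2 : HasSum (fun n : ℕ => 1 / (((-(n : ℤ) : ℤ) : ℝ)) ^ 2) (Real.pi ^ 2 / 6) := by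
    simpa using hasSum_zeta_two
  have := HasSum.of_nat_of_neg (f := fun n : ℤ => 1 / (n : ℝ) ^ 2) h1 h2
  have e : Real.pi ^ 2 / 6 + Real.pi ^ 2 / 6 - 1 / ((0 : ℤ) : ℝ) ^ 2 = Real.pi ^ 2 / 3 := by
    rw [Int.cast_zero]; ring
  rwa [e] at this

lemma tsum_one_div_cube : ∑' m : ℕ, 1 / ((m + 1 : ℕ) : ℂ) ^ 3 = (zeta3 : ℂ) := by
  have h : riemannZeta 3 = ∑' n : ℕ, 1 / (n : ℂ) ^ 3 :=
    zeta_nat_eq_tsum_of_gt_one (k := 3) (by norm_num)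
  have hs : Summable fun n : ℕ => 1 / (n : ℝ) ^ 3 :=
    Real.summable_one_div_nat_pow.2 (by norm_num)
  have hcast : (fun n : ℕ => 1 / (n : ℂ) ^ 3) = fun n : ℕ => (((1 / (n : ℝ) ^ 3 : ℝ)) : ℂ) := by
    funext n; push_cast; rfl
  have h2 : (zeta3 : ℂ) = ∑' n : ℕ, 1 / (n : ℂ) ^ 3 := by
    rw [zeta3, h, hcast, ← Complex.ofReal_tsum, Complex.ofReal_re]
  have hsc : Summable fun n : ℕ => 1 / (n : ℂ) ^ 3 := by
    rw [hcast]; exact Complex.ofRealCLM.summable hs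
  rw [h2, hsc.tsum_eq_zero_add]
  simp

/-- The order of summation is exchanged so that each column, with `n` fixed, can be estimated by
`telescoping_bound`; the double series converges absolutely in weight `3`. -/
lemma lambertQ_exp_neg {t : ℂ} (ht : 0 < t.re) :
    lambertQ (Complex.exp (-t)) = ∑' n : ℤ, ∑' m : ℕ,
      2 / (((m + 1 : ℕ) : ℂ) * t - 2 * Real.pi * Complex.I * n) ^ 3 := by
  have h := summable_lattice ht
  have h2 := Summable.tsum_comm (f := fun (m : ℕ) (n : ℤ) =>
    2 / (((m + 1 : ℕ) : ℂ) * t - 2 * Real.pi * Complex.I * n) ^ 3) h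
  rw [h2, lambertQ]
  refine tsum_congr fun m => ?_
  rw [← latticeSum_eq (x := ((m + 1 : ℕ) : ℂ) * t), ← Complex.exp_nat_mul, mul_neg]
  have : (((m + 1 : ℕ) : ℂ) * t).re = (m + 1 : ℕ) * t.re := by simp
  rw [this]
  positivity

/-- The terms of the expansion of the second Lambert series. -/
noncomputable def lambertQTerm (t : ℂ) (n : ℤ) : ℂ :=
  (if n = 0 then 2 * (zeta3 : ℂ) / t ^ 2 else 0) - 1 / (4 * Real.pi ^ 2) * (1 / (n : ℂ) ^ 2)

/-- The column `n = 0` gives `ζ(3)`. The other columns give `-∑ 1 / (4 π² n²) = -1/12`, with `1 / 0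
= 0` removing the term at `n = 0`. -/
lemma hasSum_lambertQTerm (t : ℂ) :
    HasSum (lambertQTerm t) (2 * (zeta3 : ℂ) / t ^ 2 - 1 / 12) := by
  have hpi : (Real.pi : ℂ) ≠ 0 := by exact_mod_cast Real.pi_ne_zero
  have h1 : HasSum (fun n : ℤ => if n = 0 then 2 * (zeta3 : ℂ) / t ^ 2 else 0)
      (2 * (zeta3 : ℂ) / t ^ 2) := hasSum_ite_eq (0 : ℤ) _
  have h2 : HasSum (fun n : ℤ => 1 / (n : ℂ) ^ 2) ((Real.pi : ℂ) ^ 2 / 3) := by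
    have := Complex.hasSum_ofReal.2 hasSum_one_div_int_sq
    push_cast at this
    exact this
  have h3 := h1.sub (h2.mul_left (1 / (4 * (Real.pi : ℂ) ^ 2)))
  have e : 1 / (4 * (Real.pi : ℂ) ^ 2) * ((Real.pi : ℂ) ^ 2 / 3) = 1 / 12 := by
    field_simp
    norm_num
  rw [e] at h3
  exact h3

lemma norm_lattice_column_le {t : ℂ} (ht : t ≠ 0) (hsec : ‖t‖ / 4 ≤ t.re) (n : ℤ) :
    ‖t * ∑' m : ℕ, 2 / (((m + 1 : ℕ) : ℂ) * t - 2 * Real.pi * Complex.I * n) ^ 3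
      - lambertQTerm t n‖
      ≤ 3 * 12 ^ 5 / (2 * Real.pi) ^ 3 * ‖t‖ * (1 / |(n : ℝ)| ^ 3) := by
  have hT : 0 < ‖t‖ := norm_pos_iff.2 ht
  have hre : 0 < t.re := by linarith
  have hpi : (Real.pi : ℂ) ≠ 0 := by exact_mod_cast Real.pi_ne_zero
  by_cases hn : n = 0
  · subst hn
    have : ∀ m : ℕ, 2 / (((m + 1 : ℕ) : ℂ) * t - 2 * Real.pi * Complex.I * (0 : ℤ)) ^ 3
        = 2 / t ^ 3 * (1 / ((m + 1 : ℕ) : ℂ) ^ 3) := by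
      intro m
      rw [Int.cast_zero, mul_zero, sub_zero, mul_pow]
      have : ((m + 1 : ℕ) : ℂ) ≠ 0 := by exact_mod_cast Nat.succ_ne_zero m
      field_simp
    rw [tsum_congr this, tsum_mul_left, tsum_one_div_cube]
    have e : t * (2 / t ^ 3 * (zeta3 : ℂ)) = 2 * zeta3 / t ^ 2 := by field_simp
    rw [e]
    simp [lambertQTerm]
  · have hn' : (n : ℝ) ≠ 0 := by exact_mod_cast hn
    have hnc : (n : ℂ) ≠ 0 := by exact_mod_cast hn
    have hbne : -(2 * Real.pi * n) ≠ 0 := by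
      have := Real.pi_ne_zero
      simp [hn', this]
    have e : ∀ m : ℕ, 2 / (((m + 1 : ℕ) : ℂ) * t - 2 * Real.pi * Complex.I * n) ^ 3
        = 2 / (((m + 1 : ℕ) : ℂ) * t + Complex.I * ((-(2 * Real.pi * n) : ℝ) : ℂ)) ^ 3 := by
      intro m; push_cast; congr 2; ring
    have hs : Summable fun m : ℕ =>
        2 / (((m + 1 : ℕ) : ℂ) * t - 2 * Real.pi * Complex.I * n) ^ 3 :=
      (summable_lattice hre).prod_symm.prod_factor n
    have := telescoping_bound hsec ht hbne (hs.congr e)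
    have habs : |(-(2 * Real.pi * n))| = 2 * Real.pi * |(n : ℝ)| := by
      rw [abs_neg, abs_mul, abs_of_pos (by positivity)]
    rw [habs] at this
    rw [tsum_congr e]
    have e2 : lambertQTerm t n = -(1 / ((-(2 * Real.pi * n) : ℝ) : ℂ) ^ 2) := by
      rw [lambertQTerm, if_neg hn]
      push_cast
      field_simp
      norm_num
    rw [e2, sub_neg_eq_add]
    refine this.trans (le_of_eq ?_)
    have : |(n : ℝ)| ≠ 0 := abs_ne_zero.2 hn'
    field_simp

/-- The expansion of the second Lambert series at `u = 1`. -/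
theorem norm_lambertQ_sub_le : ∃ C : ℝ, ∀ t : ℂ, t ≠ 0 → ‖t‖ / 4 ≤ t.re →
    ‖t * lambertQ (Complex.exp (-t)) - (2 * zeta3 / t ^ 2 - 1 / 12)‖ ≤ C * ‖t‖ := by
  have hs3 : Summable fun n : ℤ => 1 / |(n : ℝ)| ^ 3 := by
    have := (Real.summable_one_div_int_pow (p := 3)).2 (by norm_num)
    have := this.norm
    refine this.congr fun n => ?_
    simp
  refine ⟨3 * 12 ^ 5 / (2 * Real.pi) ^ 3 * ∑' n : ℤ, 1 / |(n : ℝ)| ^ 3, ?_⟩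
  intro t ht hsec
  have hT : 0 < ‖t‖ := norm_pos_iff.2 ht
  have hre : 0 < t.re := by linarith
  have hsumn : Summable fun n : ℤ => ∑' m : ℕ,
      2 / (((m + 1 : ℕ) : ℂ) * t - 2 * Real.pi * Complex.I * n) ^ 3 :=
    (summable_lattice hre).prod_symm.prod
  have hg := hasSum_lambertQTerm t
  rw [lambertQ_exp_neg hre, ← tsum_mul_left, ← hg.tsum_eq,
    ← (hsumn.mul_left t).tsum_sub hg.summable]
  refine (tsum_of_norm_bounded ((hs3.mul_left _).hasSum)
    (norm_lattice_column_le ht hsec)).trans (le_of_eq ?_)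
  rw [tsum_mul_left]
  ring

end SimpleWalk

namespace SimpleWalk

open scoped ENNReal

/-! ### The number of closed walks and the size of the coefficients -/

lemma card_closedWalks (n : ℕ) : (closedWalks n).card = n.centralBinom := by
  classical
  rw [Nat.centralBinom_eq_two_mul_choose]
  have hc : (Finset.powersetCard n (Finset.univ : Finset (Fin (2 * n)))).card = (2 * n).choose n := by
    rw [Finset.card_powersetCard, Finset.card_univ, Fintype.card_fin]
  rw [← hc]
  have hpt : ∀ s : Fin (2 * n) → ℤˣ, point s (2 * n)
      = 2 * ((Finset.univ.filter fun i => s i = 1).card : ℤ) - 2 * n := by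
    intro s
    have h1 : ∀ j, ((s j : ℤˣ) : ℤ) = 2 * (if s j = 1 then 1 else 0) - 1 := by
      intro j
      rcases Int.units_eq_one_or (s j) with h | h <;> simp [h]
    rw [point, Finset.filter_true_of_mem (fun j _ => j.2), Finset.sum_congr rfl fun j _ => h1 j,
      Finset.sum_sub_distrib, ← Finset.mul_sum, Finset.sum_boole]
    simp
  refine Finset.card_bij' (fun s _ => Finset.univ.filter fun i => s i = 1)
    (fun S _ i => if i ∈ S then 1 else -1) ?_ ?_ ?_ ?_
  · intro s hs
    rw [closedWalks, Finset.mem_filter, hpt] at hs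
    rw [Finset.mem_powersetCard]
    refine ⟨Finset.subset_univ _, ?_⟩
    have := hs.2
    omega
  · intro S hS
    rw [Finset.mem_powersetCard] at hS
    rw [closedWalks, Finset.mem_filter, hpt]
    refine ⟨Finset.mem_univ _, ?_⟩
    have : (Finset.univ.filter fun i => (if i ∈ S then (1 : ℤˣ) else -1) = 1) = S := by
      ext i
      by_cases h : i ∈ S <;> simp [h]
    rw [this, hS.2]
    ring
  · intro s _
    funext i
    rcases Int.units_eq_one_or (s i) with h | h <;> simp [h]
  · intro S _
    ext i
    by_cases h : i ∈ S <;> simp [h]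

lemma centralBinom_eq_coef {n : ℕ} (hn : 0 < n) :
    (n.centralBinom : ℝ≥0∞) = 2 * n * coef (fun _ => True) n := by
  classical
  rw [← card_filter_closedWalks hn (fun _ => True) (fun _ => True) (fun _ _ _ _ _ => Iff.rfl),
    Finset.filter_true_of_mem (fun _ _ => trivial), card_closedWalks]

/-- This crude bound makes all the power series converge for `|z| < 1/4`. -/
lemma coef_le (P : List ℕ → Prop) (n : ℕ) : coef P n ≤ 4 ^ n := by
  rcases Nat.eq_zero_or_pos n with rfl | hn
  · rw [coef_zero]; exact zero_le
  refine (coef_mono (Q := fun _ => True) (fun _ _ => trivial) n).trans ?_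
  have h1 : (1 : ℝ≥0∞) ≤ 2 * n := by
    have : 1 ≤ 2 * n := by omega
    exact_mod_cast this
  calc coef (fun _ => True) n ≤ 2 * n * coef (fun _ => True) n := le_mul_of_one_le_left' h1
    _ = (n.centralBinom : ℝ≥0∞) := (centralBinom_eq_coef hn).symm
    _ ≤ 4 ^ n := by exact_mod_cast n.centralBinom_le_four_pow

lemma coef_ne_top (P : List ℕ → Prop) (n : ℕ) : coef P n ≠ ⊤ :=
  ne_top_of_le_ne_top (ENNReal.pow_ne_top ENNReal.ofNat_ne_top) (coef_le P n)

lemma coef_toReal_le (P : List ℕ → Prop) (n : ℕ) : (coef P n).toReal ≤ 4 ^ n := by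
  refine ENNReal.toReal_le_of_le_ofReal (by positivity) ((coef_le P n).trans (le_of_eq ?_))
  rw [ENNReal.ofReal_pow (by norm_num), ENNReal.ofReal_ofNat]

lemma coef_congr {P Q : List ℕ → Prop} (h : ∀ L, Valid L → (P L ↔ Q L)) (n : ℕ) :
    coef P n = coef Q n := by
  classical
  refine tsum_congr fun L => ?_
  by_cases hV : Valid L
  · simp [hV, h L hV]
  · simp [hV]

lemma coef_add {P Q R : List ℕ → Prop} (h : ∀ L, Valid L → (P L ↔ (Q L ∨ R L)))
    (hd : ∀ L, Valid L → ¬ (Q L ∧ R L)) (n : ℕ) : coef P n = coef Q n + coef R n := by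
  classical
  rw [coef, coef, coef, ← ENNReal.tsum_add]
  refine tsum_congr fun L => ?_
  by_cases hV : Valid L
  · have := h L hV
    have := hd L hV
    by_cases hQ : Q L <;> by_cases hR : R L <;> simp_all
  · simp [hV]

lemma prob_eq_coef {n : ℕ} (hn : 0 < n) (Q : (Fin (2 * n) → ℤˣ) → Prop)
    [DecidablePred Q] (P : List ℕ → Prop)
    (hQ : ∀ L j s, Valid L → s ∈ trails (2 * n) 0 (profile L j) (profile L j) → (Q s ↔ P L)) :
    prob n Q = 2 * n * (coef P n).toReal / n.centralBinom := by
  have h := congrArg ENNReal.toReal (card_filter_closedWalks hn Q P hQ)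
  rw [ENNReal.toReal_natCast, ENNReal.toReal_mul, ENNReal.toReal_mul, ENNReal.toReal_natCast,
    ENNReal.toReal_ofNat] at h
  rw [prob, h, card_closedWalks]

lemma prob_multRange {n : ℕ} (hn : 0 < n) {k : ℕ} (hk : 0 < k) (l : ℕ) :
    prob n (fun s => multRange k s = l)
      = 2 * n * (coef (fun L => pairCount k (0 :: L) = l) n).toReal / n.centralBinom :=
  prob_eq_coef hn _ _ fun L j s _ hs => by rw [multRange_eq (by omega) hs hk]

/-- `4 ^ n` is at most a constant times `√n` times the central binomial coefficient. -/
lemma four_pow_le_sqrt_mul_centralBinom {n : ℕ} (hn : 1 ≤ n) :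
    (4 : ℝ) ^ n ≤ 2 * (n : ℝ) ^ (1 / 2 : ℝ) * n.centralBinom := by
  have h : ∀ n : ℕ, 1 ≤ n → (16 : ℝ) ^ n ≤ 4 * n * (n.centralBinom : ℝ) ^ 2 := by
    intro n hn
    induction n, hn using Nat.le_induction with
    | base => norm_num [Nat.centralBinom, Nat.choose]
    | succ n hn ih =>
      have hr : ((n : ℝ) + 1) * (n + 1).centralBinom = 2 * (2 * n + 1) * n.centralBinom := by
        exact_mod_cast Nat.succ_mul_centralBinom_succ n
      have hn0 : (0 : ℝ) < n := by exact_mod_cast hn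
      have hc : ((n + 1).centralBinom : ℝ) = 2 * (2 * n + 1) * n.centralBinom / (n + 1) := by
        rw [← hr]; field_simp
      rw [hc, pow_succ]
      calc (16 : ℝ) ^ n * 16 ≤ (4 * n * (n.centralBinom : ℝ) ^ 2) * 16 := by gcongr
        _ ≤ 16 * (2 * n + 1) ^ 2 * (n.centralBinom : ℝ) ^ 2 / (n + 1) := by
          rw [le_div_iff₀ (by positivity)]
          nlinarith [sq_nonneg (n.centralBinom : ℝ)]
        _ = _ := by push_cast; field_simp; ring
  have h1 := h n hn
  rw [← Real.sqrt_eq_rpow]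
  refine le_of_sq_le_sq ?_ (by positivity)
  rw [mul_pow, mul_pow, Real.sq_sqrt (by positivity), ← pow_mul, mul_comm n 2, pow_mul]
  norm_num
  exact h1

/-! ### From real to complex generating functions -/

lemma norm_four_mul_lt {z : ℂ} (hz : ‖z‖ < 1 / 4) : ‖(1 - 4 * z) - 1‖ < 1 := by
  rw [sub_sub_cancel_left, norm_neg, norm_mul, Complex.norm_ofNat]
  linarith

lemma mem_slitPlane_of_norm_sub_one_lt {w : ℂ} (h : ‖w - 1‖ < 1) : w ∈ Complex.slitPlane := by
  have := Complex.mem_slitPlane_of_norm_lt_one h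
  rwa [add_sub_cancel] at this

lemma xOf_lt {u : ℝ} (h0 : 0 < u) (h1 : u < 1) : xOf u < 1 / 4 := by
  rw [xOf, div_lt_div_iff₀ (by positivity) (by norm_num)]
  nlinarith [sq_pos_of_pos (sub_pos.2 h1)]

lemma one_sub_four_mul_xOf {u : ℝ} (h0 : 0 < u) :
    1 - 4 * xOf u = ((1 - u) / (1 + u)) ^ 2 := by
  have : 1 + u ≠ 0 := by linarith
  rw [xOf]
  field_simp
  ring

lemma eq_of_xOf_eq {u v : ℝ} (hu0 : 0 < u) (hu1 : u < 1) (hv0 : 0 < v) (hv1 : v < 1)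
    (h : xOf u = xOf v) : u = v := by
  rw [xOf, xOf, div_eq_div_iff (by positivity) (by positivity)] at h
  have h2 : (u - v) * (1 - u * v) = 0 := by linear_combination h
  rcases mul_eq_zero.1 h2 with h3 | h3
  · linarith
  · nlinarith

/-- A power series that agrees with `F (1 - 4 z)` for real `z` does so for all complex `z`. -/
theorem hasSum_of_hasSum_real {g : ℕ → ℂ} (hg : ∀ n, ‖g n‖ ≤ 4 ^ n) {F : ℂ → ℂ}
    (hF : DifferentiableOn ℂ F (Metric.ball 1 1))
    (h : ∀ u : ℝ, 0 < u → u < 1 →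
      HasSum (fun n => g n * (xOf u : ℂ) ^ n) (F (1 - 4 * (xOf u : ℂ)))) :
    ∀ z : ℂ, ‖z‖ < 1 / 4 → HasSum (fun n => g n * z ^ n) (F (1 - 4 * z)) := by
  have hterm : ∀ (r : ℝ) (z : ℂ), ‖z‖ ≤ r → ∀ n, ‖g n * z ^ n‖ ≤ (4 * r) ^ n := by
    intro r z hz n
    rw [norm_mul, norm_pow, mul_pow]
    gcongr
    exact hg n
  have hsum : ∀ z : ℂ, ‖z‖ < 1 / 4 → Summable fun n => g n * z ^ n := fun z hz =>
    Summable.of_norm_bounded (summable_geometric_of_lt_one (by positivity)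
      (by linarith : 4 * ‖z‖ < 1)) (hterm _ z le_rfl)
  have hGd : DifferentiableOn ℂ (fun z => ∑' n, g n * z ^ n) (Metric.ball 0 (1 / 4)) := by
    intro z hz
    rw [mem_ball_zero_iff] at hz
    obtain ⟨r, hr0, hr1⟩ := exists_between hz
    have hr : 0 ≤ r := (norm_nonneg z).trans hr0.le
    have := Complex.differentiableOn_tsum_of_summable_norm (U := Metric.ball (0 : ℂ) r)
      (F := fun n z => g n * z ^ n)
      (summable_geometric_of_lt_one (by positivity) (by linarith : 4 * r < 1))
      (fun n => by fun_prop) Metric.isOpen_ball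
      (fun n w hw => hterm r w (mem_ball_zero_iff.1 hw).le n)
    exact ((this z (mem_ball_zero_iff.2 hr0)).differentiableAt
      (Metric.isOpen_ball.mem_nhds (mem_ball_zero_iff.2 hr0))).differentiableWithinAt
  have hFd : DifferentiableOn ℂ (fun z : ℂ => F (1 - 4 * z)) (Metric.ball 0 (1 / 4)) := by
    refine hF.comp (by fun_prop) fun z hz => ?_
    exact mem_ball_iff_norm.2 (norm_four_mul_lt (mem_ball_zero_iff.1 hz))
  have hx : ∀ u : ℝ, 0 < u → u < 1 → ‖(xOf u : ℂ)‖ < 1 / 4 := fun u h0 h1 => by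
    rw [Complex.norm_real, Real.norm_of_nonneg (xOf_pos h0).le]
    exact xOf_lt h0 h1
  have hcont : ContinuousAt (fun u : ℝ => (xOf u : ℂ)) (1 / 2) := by
    refine Complex.continuous_ofReal.continuousAt.comp ?_
    unfold xOf
    exact ContinuousAt.div (by fun_prop) (by fun_prop) (by norm_num)
  have hnear : ∀ᶠ u : ℝ in nhdsWithin (1 / 2) {1 / 2}ᶜ, 0 < u ∧ u < 1 :=
    nhdsWithin_le_nhds (Ioo_mem_nhds (by norm_num) (by norm_num))
  have htend : Tendsto (fun u : ℝ => (xOf u : ℂ)) (nhdsWithin (1 / 2) {1 / 2}ᶜ)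
      (nhdsWithin (xOf (1 / 2) : ℂ) {(xOf (1 / 2) : ℂ)}ᶜ) := by
    refine tendsto_nhdsWithin_iff.2 ⟨hcont.tendsto.mono_left nhdsWithin_le_nhds, ?_⟩
    filter_upwards [hnear, self_mem_nhdsWithin] with u hu hne h
    exact hne (eq_of_xOf_eq hu.1 hu.2 (by norm_num) (by norm_num) (Complex.ofReal_injective h))
  -- The real points `xOf u` accumulate at `xOf (1 / 2)`, inside the disc, so the identity theorem
  -- applies there.
  have hfreq : ∃ᶠ z in nhdsWithin (xOf (1 / 2) : ℂ) {(xOf (1 / 2) : ℂ)}ᶜ,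
      (fun z => ∑' n, g n * z ^ n) z = F (1 - 4 * z) := by
    refine htend.frequently (Eventually.frequently ?_)
    filter_upwards [hnear] with u hu
    exact (h u hu.1 hu.2).tsum_eq
  have heq := AnalyticOnNhd.eqOn_of_preconnected_of_frequently_eq
    (hGd.analyticOnNhd Metric.isOpen_ball) (hFd.analyticOnNhd Metric.isOpen_ball)
    (convex_ball (0 : ℂ) (1 / 4)).isPreconnected
    (mem_ball_zero_iff.2 (hx (1 / 2) (by norm_num) (by norm_num))) hfreq
  intro z hz
  have := (hsum z hz).hasSum
  rwa [show ∑' n, g n * z ^ n = F (1 - 4 * z) from heq (mem_ball_zero_iff.2 hz)] at this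

lemma hasSum_coef_of_gf_eq {P : List ℕ → Prop} {x y : ℝ} (hx : 0 ≤ x) (hy : 0 ≤ y)
    (h : gf P (ENNReal.ofReal x) = ENNReal.ofReal y) :
    HasSum (fun n => (coef P n).toReal * x ^ n) y := by
  rw [← tsum_coef_mul_pow] at h
  have h1 : ∀ n, (coef P n * ENNReal.ofReal x ^ n).toReal = (coef P n).toReal * x ^ n := fun n => by
    rw [ENNReal.toReal_mul, ENNReal.toReal_pow, ENNReal.toReal_ofReal hx]
  have h2 := ENNReal.hasSum_toReal (f := fun n => coef P n * ENNReal.ofReal x ^ n)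
    (by rw [h]; exact ENNReal.ofReal_ne_top)
  simp only [h1] at h2
  rwa [← tsum_congr h1, ← ENNReal.tsum_toReal_eq (fun n => ENNReal.mul_ne_top (coef_ne_top P n)
    (ENNReal.pow_ne_top ENNReal.ofReal_ne_top)), h, ENNReal.toReal_ofReal hy] at h2

/-- The coefficients of a class whose generating function is known for real arguments. -/
theorem hasSum_coef {P : List ℕ → Prop} {F : ℂ → ℂ}
    (hF : DifferentiableOn ℂ F (Metric.ball 1 1))
    (h : ∀ u : ℝ, 0 < u → u < 1 → ∃ y : ℝ, 0 ≤ y ∧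
      gf P (ENNReal.ofReal (xOf u)) = ENNReal.ofReal y ∧ F (1 - 4 * (xOf u : ℂ)) = y) :
    ∀ z : ℂ, ‖z‖ < 1 / 4 → HasSum (fun n => ((coef P n).toReal : ℂ) * z ^ n) (F (1 - 4 * z)) := by
  refine hasSum_of_hasSum_real (fun n => ?_) hF fun u h0 h1 => ?_
  · rw [Complex.norm_real, Real.norm_of_nonneg ENNReal.toReal_nonneg]
    exact coef_toReal_le P n
  · obtain ⟨y, hy, hgf, hFy⟩ := h u h0 h1
    rw [hFy]
    have := Complex.hasSum_ofReal.2 (hasSum_coef_of_gf_eq (xOf_pos h0).le hy hgf)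
    push_cast at this
    exact this

lemma coeff_unique {f : ℂ → ℂ} {a b : ℕ → ℂ}
    (ha : ∀ z : ℂ, ‖z‖ < 1 / 4 → HasSum (fun n => a n * z ^ n) (f z))
    (hb : ∀ z : ℂ, ‖z‖ < 1 / 4 → HasSum (fun n => b n * z ^ n) (f z)) (n : ℕ) : a n = b n := by
  have h1 := iteratedDeriv_of_hasSum (by norm_num) ha n
  have h2 := iteratedDeriv_of_hasSum (by norm_num) hb n
  rw [h1] at h2
  exact mul_left_cancel₀ (by exact_mod_cast n.factorial_ne_zero) h2

/-! ### The coefficients of the square root -/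

/-- The principal square root. -/
noncomputable def sqrtC (w : ℂ) : ℂ := w ^ (1 / 2 : ℂ)

noncomputable def sqrtCoeff (n : ℕ) : ℝ := -(n.centralBinom : ℝ) / (2 * n - 1)

lemma choose_half_mul (n : ℕ) : Ring.choose (1 / 2 : ℂ) n * (-4) ^ n = (sqrtCoeff n : ℂ) := by
  have hrec : ∀ n : ℕ, (n + 1 : ℂ) * Ring.choose (1 / 2 : ℂ) (n + 1)
      = (1 / 2 - n) * Ring.choose (1 / 2 : ℂ) n := by
    intro n
    have h1 : ((n.factorial : ℕ) : ℂ) ≠ 0 := by exact_mod_cast n.factorial_ne_zero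
    have h2 : (n + 1 : ℂ) ≠ 0 := by exact_mod_cast n.succ_ne_zero
    rw [Ring.choose_eq_smul, Ring.choose_eq_smul, descPochhammer_succ_right, Nat.factorial_succ]
    simp only [Polynomial.smeval_mul, Polynomial.smeval_sub, Polynomial.smeval_X,
      Polynomial.smeval_natCast, smul_eq_mul]
    push_cast
    field_simp
    simp [mul_comm]
  induction n with
  | zero => simp [sqrtCoeff]
  | succ n ih =>
    have h2 : (n + 1 : ℂ) ≠ 0 := by exact_mod_cast n.succ_ne_zero
    have h3 : (2 * n - 1 : ℂ) ≠ 0 := by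
      have : (2 * n - 1 : ℤ) ≠ 0 := by omega
      exact_mod_cast this
    have h4 : (2 * n + 1 : ℂ) ≠ 0 := by
      have : (2 * n + 1 : ℤ) ≠ 0 := by omega
      exact_mod_cast this
    have hr : ((n : ℂ) + 1) * (n + 1).centralBinom = 2 * (2 * n + 1) * n.centralBinom := by
      exact_mod_cast Nat.succ_mul_centralBinom_succ n
    refine mul_left_cancel₀ h2 ?_
    rw [← mul_assoc, hrec, pow_succ,
      show (1 / 2 - (n : ℂ)) * Ring.choose (1 / 2 : ℂ) n * ((-4) ^ n * -4)
        = (1 / 2 - n) * (-4) * (Ring.choose (1 / 2 : ℂ) n * (-4) ^ n) by ring, ih]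
    simp only [sqrtCoeff]
    push_cast
    rw [mul_div_assoc', mul_div_assoc', mul_neg ((n : ℂ) + 1), hr,
      show 2 * ((n : ℂ) + 1) - 1 = 2 * n + 1 by ring]
    field_simp
    ring

lemma hasSum_sqrtCoeff {z : ℂ} (hz : ‖z‖ < 1 / 4) :
    HasSum (fun n => (sqrtCoeff n : ℂ) * z ^ n) (sqrtC (1 - 4 * z)) := by
  have h := (Complex.one_add_cpow_hasFPowerSeriesOnBall_zero (a := 1 / 2)).hasSum (y := -4 * z) (by
    rw [← ENNReal.ofReal_one, Metric.eball_ofReal, mem_ball_zero_iff, norm_mul, norm_neg,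
      Complex.norm_ofNat]
    linarith)
  simp only [binomialSeries_apply, List.ofFn_const, List.prod_replicate, smul_eq_mul, zero_add,
    mul_pow, ← mul_assoc, choose_half_mul] at h
  rw [sqrtC, sub_eq_add_neg, ← neg_mul]
  exact h

end SimpleWalk

namespace SimpleWalk

open scoped ENNReal

/-! ### The square root on the slit plane -/

lemma sqrtC_sq (w : ℂ) : sqrtC w ^ 2 = w := by
  rw [sqrtC, ← Complex.cpow_nat_mul]
  simp

lemma norm_sqrtC_sq (w : ℂ) : ‖sqrtC w‖ ^ 2 = ‖w‖ := by
  rw [← norm_pow, sqrtC_sq]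

lemma sqrtC_re_pos {w : ℂ} (hw : w ∈ Complex.slitPlane) : 0 < (sqrtC w).re := by
  have hw0 := Complex.slitPlane_ne_zero hw
  have harg := Complex.mem_slitPlane_iff_arg.1 hw
  rw [sqrtC, Complex.cpow_def_of_ne_zero hw0, Complex.exp_re]
  refine mul_pos (Real.exp_pos _) (Real.cos_pos_of_mem_Ioo ?_)
  have : (Complex.log w * (1 / 2)).im = Complex.arg w / 2 := by
    rw [show (1 / 2 : ℂ) = ((1 / 2 : ℝ) : ℂ) by push_cast; rfl, Complex.im_mul_ofReal,
      Complex.log_im]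
    ring
  rw [this]
  have h1 := Complex.neg_pi_lt_arg w
  have h2 := lt_of_le_of_ne (Complex.arg_le_pi w) harg.1
  constructor <;> linarith

lemma differentiableAt_sqrtC {w : ℂ} (hw : w ∈ Complex.slitPlane) : DifferentiableAt ℂ sqrtC w :=
  DifferentiableAt.cpow_const differentiableAt_id hw

lemma sqrtC_ofReal_sq {r : ℝ} (hr : 0 ≤ r) : sqrtC ((r : ℂ) ^ 2) = r := by
  have h := Complex.ofReal_cpow (sq_nonneg r) (1 / 2)
  rw [← Real.sqrt_eq_rpow, Real.sqrt_sq hr] at h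
  push_cast at h
  rw [sqrtC, ← h]

lemma sqrtC_one_sub_four_mul_xOf {u : ℝ} (h0 : 0 < u) (h1 : u < 1) :
    sqrtC (1 - 4 * (xOf u : ℂ)) = ((1 - u) / (1 + u) : ℝ) := by
  have h := one_sub_four_mul_xOf h0
  have h2 : (1 - 4 * (xOf u : ℂ)) = ((((1 - u) / (1 + u) : ℝ)) : ℂ) ^ 2 := by
    rw [← Complex.ofReal_pow, ← h]
    push_cast
    rfl
  rw [h2, sqrtC_ofReal_sq]
  exact div_nonneg (by linarith) (by linarith)

/-- The parameter `u` with `w = ((1 - u) / (1 + u))²`. -/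
noncomputable def nome (w : ℂ) : ℂ := (1 - sqrtC w) / (1 + sqrtC w)

lemma one_add_sqrtC_ne_zero {w : ℂ} (hw : w ∈ Complex.slitPlane) : 1 + sqrtC w ≠ 0 := by
  intro h
  have := congrArg Complex.re h
  have h2 := sqrtC_re_pos hw
  simp at this
  linarith

/-- The Möbius map `s ↦ (1 - s) / (1 + s)` sends the right half-plane, where `√w` lies, into the
unit disc. -/
lemma norm_nome_lt {w : ℂ} (hw : w ∈ Complex.slitPlane) : ‖nome w‖ < 1 := by
  have h := sqrtC_re_pos hw
  rw [nome, norm_div, div_lt_one (norm_pos_iff.2 (one_add_sqrtC_ne_zero hw)),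
    ← sq_lt_sq₀ (norm_nonneg _) (norm_nonneg _), ← Complex.normSq_eq_norm_sq,
    ← Complex.normSq_eq_norm_sq, Complex.normSq_apply, Complex.normSq_apply]
  simp only [Complex.sub_re, Complex.sub_im, Complex.add_re, Complex.add_im, Complex.one_re,
    Complex.one_im]
  nlinarith

lemma differentiableAt_nome {w : ℂ} (hw : w ∈ Complex.slitPlane) : DifferentiableAt ℂ nome w :=
  ((differentiableAt_const _).sub (differentiableAt_sqrtC hw)).div
    ((differentiableAt_const _).add (differentiableAt_sqrtC hw)) (one_add_sqrtC_ne_zero hw)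

lemma nome_one_sub_four_mul_xOf {u : ℝ} (h0 : 0 < u) (h1 : u < 1) :
    nome (1 - 4 * (xOf u : ℂ)) = u := by
  rw [nome, sqrtC_one_sub_four_mul_xOf h0 h1]
  have : (1 + u : ℂ) ≠ 0 := by
    have : 1 + u ≠ 0 := by linarith
    exact_mod_cast this
  push_cast
  field_simp
  ring

/-! ### The generating functions as analytic functions of `w = 1 - 4 z` -/

/-- The generating function of the lists beginning and ending with `1`. -/
noncomputable def oneOne (w : ℂ) : ℂ := w * lambertP (nome w)

/-- The generating function of the lists beginning with `1` and ending with `2`. -/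
noncomputable def oneTwo (w : ℂ) : ℂ :=
  (w * lambertP (nome w) - sqrtC w ^ 3 * lambertQ (nome w)) / 2

/-- The generating function of the lists beginning with `1`. -/
noncomputable def oneAny (w : ℂ) : ℂ := (1 - sqrtC w) / 2

lemma differentiableAt_oneOne {w : ℂ} (hw : w ∈ Complex.slitPlane) :
    DifferentiableAt ℂ oneOne w :=
  differentiableAt_id.mul ((differentiableAt_lambertP (norm_nome_lt hw)).comp w
    (differentiableAt_nome hw))

lemma differentiableAt_oneTwo {w : ℂ} (hw : w ∈ Complex.slitPlane) :
    DifferentiableAt ℂ oneTwo w :=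
  ((differentiableAt_oneOne hw).sub (((differentiableAt_sqrtC hw).pow 3).mul
    ((differentiableAt_lambertQ (norm_nome_lt hw)).comp w (differentiableAt_nome hw)))).div_const 2

lemma differentiableAt_oneAny {w : ℂ} (hw : w ∈ Complex.slitPlane) :
    DifferentiableAt ℂ oneAny w :=
  ((differentiableAt_const _).sub (differentiableAt_sqrtC hw)).div_const 2

lemma mem_slitPlane_of_mem_ball {w : ℂ} (hw : w ∈ Metric.ball (1 : ℂ) 1) :
    w ∈ Complex.slitPlane :=
  mem_slitPlane_of_norm_sub_one_lt (mem_ball_iff_norm.1 hw)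

lemma sq_ofReal_one_sub_four_mul_xOf {u : ℝ} (h0 : 0 < u) :
    (1 - 4 * (xOf u : ℂ)) = ((((1 - u) / (1 + u)) ^ 2 : ℝ) : ℂ) := by
  rw [← one_sub_four_mul_xOf h0]
  push_cast
  rfl

section RealArguments

variable {u : ℝ} (h0 : 0 < u) (h1 : u < 1)
include h0 h1

lemma exists_gf_one_one : ∃ y : ℝ, 0 ≤ y ∧
    gf (cls (· = 1) (· = 1) fun _ => True) (ENNReal.ofReal (xOf u)) = ENNReal.ofReal y ∧
    oneOne (1 - 4 * (xOf u : ℂ)) = y := by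
  have hnn : ∀ m : ℕ, 0 ≤ ((1 - u) / (1 + u)) ^ 2 * (u ^ (m + 1) / (1 - u ^ (m + 1)) ^ 2) :=
    fun m => by positivity
  have hu : ‖(u : ℂ)‖ < 1 := by rwa [Complex.norm_real, Real.norm_of_nonneg h0.le]
  have hs : Summable fun m : ℕ => u ^ (m + 1) / (1 - u ^ (m + 1)) ^ 2 := by
    have := summable_lambertP hu
    exact_mod_cast this
  refine ⟨_, tsum_nonneg (L := .unconditional ℕ) hnn, ?_, ?_⟩
  · rw [gf_one_one h0 h1, ENNReal.ofReal_tsum_of_nonneg hnn (hs.mul_left _)]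
  · rw [oneOne, nome_one_sub_four_mul_xOf h0 h1, sq_ofReal_one_sub_four_mul_xOf h0, tsum_mul_left,
      lambertP]
    push_cast
    rfl

lemma exists_gf_one_two : ∃ y : ℝ, 0 ≤ y ∧
    gf (cls (· = 1) (· = 2) fun _ => True) (ENNReal.ofReal (xOf u)) = ENNReal.ofReal y ∧
    oneTwo (1 - 4 * (xOf u : ℂ)) = y := by
  have hpow : ∀ m : ℕ, u ^ (m + 1) < 1 := fun m => pow_lt_one₀ h0.le h1 (by omega)
  have hnn : ∀ m : ℕ, 0 ≤ ((1 - u) / (1 + u)) ^ 2 / (1 + u) *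
      (u ^ (m + 1) * (u - u ^ (m + 1)) / (1 - u ^ (m + 1)) ^ 3) := fun m => by
    have h2 : 0 < 1 - u ^ (m + 1) := sub_pos.2 (hpow m)
    have h3 : 0 ≤ u - u ^ (m + 1) := sub_nonneg.2 (pow_le_of_le_one h0.le h1.le (by omega))
    positivity
  have hu : ‖(u : ℂ)‖ < 1 := by rwa [Complex.norm_real, Real.norm_of_nonneg h0.le]
  have hp := summable_lambertP hu
  have hq := summable_lambertQ hu
  -- With `U = u ^ (m + 1)` the splitting is `2 (u - U) = (1 + u) (1 - U) - (1 - u) (1 + U)`.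
  have hterm : ∀ m : ℕ, ((((1 - u) / (1 + u)) ^ 2 / (1 + u) *
      (u ^ (m + 1) * (u - u ^ (m + 1)) / (1 - u ^ (m + 1)) ^ 3) : ℝ) : ℂ)
      = ((((1 - u) / (1 + u)) ^ 2 : ℝ) : ℂ) / 2 *
        ((u : ℂ) ^ (m + 1) / (1 - (u : ℂ) ^ (m + 1)) ^ 2)
      - (((1 - u) / (1 + u) : ℝ) : ℂ) ^ 3 / 2 *
        ((u : ℂ) ^ (m + 1) * (1 + (u : ℂ) ^ (m + 1)) / (1 - (u : ℂ) ^ (m + 1)) ^ 3) := by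
    intro m
    have h3 : (1 - (u : ℂ) ^ (m + 1)) ≠ 0 := one_sub_pow_ne_zero hu m
    have h4 : (1 + u : ℂ) ≠ 0 := by
      have : 1 + u ≠ 0 := by linarith
      exact_mod_cast this
    push_cast
    generalize (u : ℂ) ^ (m + 1) = U at h3 ⊢
    field_simp
    ring
  have hsub := (hp.hasSum.mul_left ((((1 - u) / (1 + u)) ^ 2 : ℝ) / 2 : ℂ)).sub
    (hq.hasSum.mul_left ((((1 - u) / (1 + u) : ℝ) : ℂ) ^ 3 / 2))
  have hsum := hsub.congr_fun hterm
  refine ⟨_, tsum_nonneg (L := .unconditional ℕ) hnn, ?_, ?_⟩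
  · rw [gf_one_two h0 h1, ENNReal.ofReal_tsum_of_nonneg hnn (Complex.summable_ofReal.1 hsum.summable)]
  · rw [Complex.ofReal_tsum, hsum.tsum_eq, oneTwo, nome_one_sub_four_mul_xOf h0 h1,
      sqrtC_one_sub_four_mul_xOf h0 h1, sq_ofReal_one_sub_four_mul_xOf h0, lambertP, lambertQ]
    ring

lemma gf_one_any_eq : gf (cls (· = 1) (fun _ => True) fun _ => True) (ENNReal.ofReal (xOf u))
      = ENNReal.ofReal (u / (1 + u)) ∧ oneAny (1 - 4 * (xOf u : ℂ)) = ((u / (1 + u) : ℝ) : ℂ) := by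
  refine ⟨gf_one_any h0 h1, ?_⟩
  rw [oneAny, sqrtC_one_sub_four_mul_xOf h0 h1]
  have h4 : (1 + u : ℂ) ≠ 0 := by
    have : 1 + u ≠ 0 := by linarith
    exact_mod_cast this
  push_cast
  field_simp
  ring

end RealArguments

theorem hasSum_coef_one_one {z : ℂ} (hz : ‖z‖ < 1 / 4) :
    HasSum (fun n => ((coef (cls (· = 1) (· = 1) fun _ => True) n).toReal : ℂ) * z ^ n)
      (oneOne (1 - 4 * z)) :=
  hasSum_coef (fun _ hw => (differentiableAt_oneOne
    (mem_slitPlane_of_mem_ball hw)).differentiableWithinAt)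
    (fun _ h0 h1 => exists_gf_one_one h0 h1) z hz

theorem hasSum_coef_one_any {z : ℂ} (hz : ‖z‖ < 1 / 4) :
    HasSum (fun n =>
      ((coef (cls (· = 1) (fun _ => True) fun _ => True) n).toReal : ℂ) * z ^ n)
      (oneAny (1 - 4 * z)) :=
  hasSum_coef (fun _ hw => (differentiableAt_oneAny
    (mem_slitPlane_of_mem_ball hw)).differentiableWithinAt)
    (fun u h0 h1 => ⟨u / (1 + u), by positivity, gf_one_any_eq h0 h1⟩) z hz

theorem hasSum_coef_any_one {z : ℂ} (hz : ‖z‖ < 1 / 4) :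
    HasSum (fun n =>
      ((coef (cls (fun _ => True) (· = 1) fun _ => True) n).toReal : ℂ) * z ^ n)
      (oneAny (1 - 4 * z)) :=
  hasSum_coef (fun _ hw => (differentiableAt_oneAny
    (mem_slitPlane_of_mem_ball hw)).differentiableWithinAt)
    (fun u h0 h1 => ⟨u / (1 + u), by positivity, by rw [gf_cls_symm]; exact gf_one_any_eq h0 h1⟩) z hz

/-- The generating function of the lists counted by `pairCount 2 = k + 3`. -/
noncomputable def doubleGF (k : ℕ) (w : ℂ) : ℂ :=
  (oneOne w / (1 + oneOne w)) ^ k * ((oneAny w * oneOne w + oneTwo w) / (1 + oneOne w) ^ 2) ^ 2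

lemma exists_gf_pairCount_two (k : ℕ) {u : ℝ} (h0 : 0 < u) (h1 : u < 1) : ∃ y : ℝ, 0 ≤ y ∧
    gf (fun L => pairCount 2 (0 :: L) = k + 3) (ENNReal.ofReal (xOf u)) = ENNReal.ofReal y ∧
    doubleGF k (1 - 4 * (xOf u : ℂ)) = y := by
  obtain ⟨A, hA0, hA, hAc⟩ := exists_gf_one_one h0 h1
  obtain ⟨D, hD0, hD, hDc⟩ := exists_gf_one_two h0 h1
  obtain ⟨hc, hcc⟩ := gf_one_any_eq h0 h1
  set c : ℝ := u / (1 + u)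
  have hc0 : 0 ≤ c := by positivity
  set x := ENNReal.ofReal (xOf u)
  have hA1 : 1 + A ≠ 0 := by linarith
  -- Solves `gf_cls_true` for the series without adjacent ones. Finiteness is needed to leave the
  -- extended nonnegative reals.
  have key : ∀ (H : ℕ → Prop) (B : ℝ), 0 ≤ B →
      gf (cls H (· = 1) fun _ => True) x = ENNReal.ofReal B →
      gf (cls H (· = 1) (· = 0)) x = ENNReal.ofReal (B / (1 + A)) := by
    intro H B hB h
    have h2 := gf_cls_true H (· = 1) x
    rw [h, hA] at h2
    have hfin : gf (cls H (· = 1) (· = 0)) x ≠ ⊤ := by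
      refine ne_top_of_le_ne_top (ENNReal.ofReal_ne_top (r := B)) ?_
      rw [h2]; exact le_self_add
    have h3 := congrArg ENNReal.toReal h2
    rw [ENNReal.toReal_add hfin (ENNReal.mul_ne_top hfin ENNReal.ofReal_ne_top), ENNReal.toReal_mul,
      ENNReal.toReal_ofReal hB, ENNReal.toReal_ofReal hA0] at h3
    rw [← ENNReal.ofReal_toReal hfin]
    congr 1
    rw [eq_div_iff hA1]
    linarith
  have k1 := key (· = 1) A hA0 hA
  have k2 := key (· = 2) D hD0 (by rw [gf_cls_symm]; exact hD)
  have k3 := key (fun _ => True) c hc0 (by rw [gf_cls_symm]; exact hc)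
  have hadd : gf (cls (fun _ => True) (· = 1) (· = 0)) x
      = gf (cls (· ≠ 2) (· = 1) (· = 0)) x + gf (cls (· = 2) (· = 1) (· = 0)) x :=
    gf_add (fun L _ => by simp only [cls]; tauto) (fun L _ => by simp only [cls]; tauto) x
  rw [k3, k2] at hadd
  have hfin : gf (cls (· ≠ 2) (· = 1) (· = 0)) x ≠ ⊤ := by
    refine ne_top_of_le_ne_top (ENNReal.ofReal_ne_top (r := c / (1 + A))) ?_
    rw [hadd]; exact le_self_add
  have h3 := congrArg ENNReal.toReal hadd
  rw [ENNReal.toReal_add hfin ENNReal.ofReal_ne_top, ENNReal.toReal_ofReal (by positivity),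
    ENNReal.toReal_ofReal (by positivity)] at h3
  set X := (gf (cls (· ≠ 2) (· = 1) (· = 0)) x).toReal with hX
  have hX0 : 0 ≤ X := ENNReal.toReal_nonneg
  refine ⟨(A / (1 + A)) ^ k * (X * (A / (1 + A)) + D / (1 + A)) ^ 2, by positivity, ?_, ?_⟩
  · rw [gf_pairCount_two, k1, k2, ← ENNReal.ofReal_toReal hfin, ← hX,
      ENNReal.ofReal_mul (by positivity), ENNReal.ofReal_pow (by positivity),
      ENNReal.ofReal_pow (by positivity), ENNReal.ofReal_add (by positivity) (by positivity),
      ENNReal.ofReal_mul hX0]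
  -- The squared factor simplifies since `(c - D) A + D (1 + A) = c A + D`.
  · have hXe : X = (c - D) / (1 + A) := by rw [sub_div]; linarith
    rw [doubleGF, hAc, hDc, hcc, hXe]
    have hA1c : (1 + A : ℂ) ≠ 0 := by exact_mod_cast hA1
    push_cast
    congr 2
    field_simp
    ring

end SimpleWalk

namespace SimpleWalk

/-! ### Sectors -/

/-- A sector of opening `4π/3`, cut at distance `3` from its vertex. -/
def sector : Set ℂ := {w | w ≠ 0 ∧ -‖w‖ / 2 ≤ w.re ∧ ‖w‖ ≤ 3}

/-- Here `Re w₀ > 0`, so `Re w > -|w₀| / 3` while `|w| > 2 |w₀| / 3`; also `|w| ≤ 4/3 * 2 < 3`. -/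
lemma discNbhd_subset_sector {δ : ℝ} (hδ : δ ≤ 1 / 3) : discNbhd δ ⊆ sector := by
  rintro w ⟨w₀, h0, h1⟩
  have hw0 : 0 < ‖w₀‖ := norm_pos_iff.2 (ne_zero_of_norm_sub_one_lt h0)
  have h2 : ‖w - w₀‖ < ‖w₀‖ / 3 := by nlinarith
  have hlow : ‖w₀‖ - ‖w - w₀‖ ≤ ‖w‖ := by
    have := norm_sub_norm_le w₀ w
    rw [norm_sub_rev] at this
    linarith
  have hup : ‖w‖ ≤ ‖w₀‖ + ‖w - w₀‖ := by
    have := norm_add_le w₀ (w - w₀)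
    rwa [add_sub_cancel] at this
  have hre0 : 0 < w₀.re := by
    have := mem_slitPlane_of_norm_sub_one_lt h0
    have h3 : (1 - w₀).re < 1 := lt_of_le_of_lt (Complex.re_le_norm _) (by rwa [norm_sub_rev])
    simp at h3
    exact h3
  have hre : -‖w - w₀‖ ≤ (w - w₀).re := neg_le_of_abs_le (Complex.abs_re_le_norm _)
  rw [Complex.sub_re] at hre
  have h2' : ‖w₀‖ ≤ 2 := by
    have := norm_add_le (w₀ - 1) 1
    rw [sub_add_cancel, norm_one] at this
    linarith
  refine ⟨norm_pos_iff.1 (by linarith), by linarith, by linarith⟩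

lemma sector_subset_slitPlane {w : ℂ} (hw : w ∈ sector) : w ∈ Complex.slitPlane := by
  obtain ⟨h0, h1, -⟩ := hw
  rw [Complex.mem_slitPlane_iff]
  by_contra! h
  have h2 : w = (w.re : ℂ) := Complex.ext (by simp) (by simpa using h.2)
  have h3 : ‖w‖ = -w.re := by
    rw [h2, Complex.norm_real, Real.norm_of_nonpos (by simpa using h.1), Complex.ofReal_re]
  have := norm_pos_iff.2 h0
  linarith

/-- The square root halves the argument, from at most `2π/3` to at most `π/3`, whose cosine is
`1/2`. -/
lemma sqrtC_re_ge {w : ℂ} (hw : w ∈ sector) : ‖sqrtC w‖ / 2 ≤ (sqrtC w).re := by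
  have hpos := sqrtC_re_pos (sector_subset_slitPlane hw)
  have h1 := hw.2.1
  have h2 := congrArg Complex.re (sqrtC_sq w)
  have h3 := norm_sqrtC_sq w
  have h4 : ‖sqrtC w‖ ^ 2 = (sqrtC w).re ^ 2 + (sqrtC w).im ^ 2 := by
    rw [← Complex.normSq_eq_norm_sq, Complex.normSq_apply]; ring
  rw [pow_two, Complex.mul_re] at h2
  nlinarith [norm_nonneg (sqrtC w)]

/-! ### The logarithmic parameter -/

/-- The Taylor polynomial of `log ((1 + √w) / (1 - √w)) / (2 √w)`, even in `√w` and hence a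
polynomial in `w`. `recipPoly` is its reciprocal to the same order. -/
noncomputable def logTrunc (w : ℂ) : ℂ :=
  1 + w / 3 + w ^ 2 / 5 + w ^ 3 / 7 + w ^ 4 / 9 + w ^ 5 / 11

/-- The Taylor polynomial of the function `2 √w / log ((1 + √w) / (1 - √w))`. -/
noncomputable def recipPoly (w : ℂ) : ℂ :=
  1 - w / 3 - 4 * w ^ 2 / 45 - 44 * w ^ 3 / 945 - 428 * w ^ 4 / 14175 - 10196 * w ^ 5 / 467775

lemma norm_logTrunc_sub_le {w : ℂ} (hw : ‖w‖ ≤ 1 / 16) : ‖logTrunc w - 1‖ ≤ ‖w‖ / 2 := by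
  have h0 := norm_nonneg w
  have e : logTrunc w - 1 = w * (1 / 3 + w * (1 / 5 + w * (1 / 7 + w * (1 / 9 + w * (1 / 11))))) := by
    rw [logTrunc]; ring
  have step : ∀ (a : ℂ) (b : ℂ) (r q : ℝ), ‖a‖ ≤ r → ‖b‖ ≤ q → ‖a + w * b‖ ≤ r + q / 16 := by
    intro a b r q ha hb
    refine (norm_add_le _ _).trans ?_
    rw [norm_mul]
    have : ‖w‖ * ‖b‖ ≤ 1 / 16 * q := mul_le_mul hw hb (norm_nonneg _) (by norm_num)
    linarith
  have h11 : ‖(1 / 11 : ℂ)‖ ≤ 1 / 11 := by norm_num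
  have h9 := step (1 / 9) _ (1 / 9) _ (by norm_num) h11
  have h7 := step (1 / 7) _ (1 / 7) _ (by norm_num) h9
  have h5 := step (1 / 5) _ (1 / 5) _ (by norm_num) h7
  have h3 := step (1 / 3) _ (1 / 3) _ (by norm_num) h5
  rw [e, norm_mul, div_eq_mul_inv]
  refine mul_le_mul_of_nonneg_left (h3.trans ?_) h0
  norm_num

lemma exists_recipPoly_mul_logTrunc : ∃ C : ℝ, ∀ w : ℂ, ‖w‖ ≤ 1 →
    ‖recipPoly w * logTrunc w - 1‖ ≤ C * ‖w‖ ^ 6 := by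
  obtain ⟨q, hq, hqe⟩ : ∃ q : ℂ → ℂ, Continuous q ∧
      ∀ w, recipPoly w * logTrunc w - 1 = q w * w ^ 6 := by
    refine ⟨fun w => -(2953639 / 49116375 : ℂ) * w ^ 0 - (4432 / 202125 : ℂ) * w ^ 1 - (105124 / 9823275 : ℂ) * w ^ 2 - (21752 / 4209975 : ℂ) * w ^ 3 - (10196 / 5145525 : ℂ) * w ^ 4, by fun_prop, fun w => ?_⟩
    rw [recipPoly, logTrunc]
    ring
  obtain ⟨C, hC⟩ := (isCompact_closedBall (0 : ℂ) 1).exists_bound_of_continuousOn hq.continuousOn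
  refine ⟨C, fun w hw => ?_⟩
  rw [hqe, norm_mul, norm_pow]
  gcongr
  exact hC w (mem_closedBall_zero_iff.2 hw)

lemma norm_log_sub_log_le {s : ℂ} (hs : ‖s‖ ≤ 1 / 4) :
    ‖Complex.log (1 + s) - Complex.log (1 - s) - 2 * s * logTrunc (s ^ 2)‖ ≤ ‖s‖ ^ 13 := by
  have h1 : ‖s‖ < 1 := by linarith
  have ha := Complex.norm_log_sub_logTaylor_le 12 h1
  have hb := Complex.norm_log_sub_logTaylor_le 12 (z := -s) (by rwa [norm_neg])
  rw [norm_neg, ← sub_eq_add_neg] at hb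
  have hinv : (1 - ‖s‖)⁻¹ ≤ 4 / 3 := by
    rw [inv_le_comm₀ (by linarith) (by norm_num)]
    norm_num
    linarith
  have hbound : ‖s‖ ^ (12 + 1) * (1 - ‖s‖)⁻¹ / ((12 : ℕ) + 1) ≤ ‖s‖ ^ 13 / 2 := by
    have : ‖s‖ ^ 13 * (1 - ‖s‖)⁻¹ ≤ ‖s‖ ^ 13 * (4 / 3) := by gcongr
    norm_num
    have h0 : 0 ≤ ‖s‖ ^ 13 := by positivity
    linarith
  have e : Complex.log (1 + s) - Complex.log (1 - s) - 2 * s * logTrunc (s ^ 2)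
      = (Complex.log (1 + s) - Complex.logTaylor (12 + 1) s)
        - (Complex.log (1 - s) - Complex.logTaylor (12 + 1) (-s)) := by
    simp only [Complex.logTaylor_succ, Complex.logTaylor_zero, logTrunc, Pi.add_apply]
    push_cast
    ring
  rw [e]
  refine (norm_sub_le _ _).trans ?_
  linarith

/-- Near the vertex of the sector, `nome w = exp (-t)` where `2 √w / t` is close to `recipPoly w`. -/
theorem exists_log_parameter : ∃ C : ℝ, 0 ≤ C ∧ ∀ w ∈ sector, ‖w‖ ≤ 1 / 16 → ∃ t l : ℂ,
    t ≠ 0 ∧ ‖t‖ ≤ 1 ∧ ‖t‖ / 4 ≤ t.re ∧ nome w = Complex.exp (-t) ∧ t * l = 2 * sqrtC w ∧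
    ‖t‖ ≤ 4 * ‖sqrtC w‖ ∧ ‖l‖ ≤ 2 ∧ ‖l - recipPoly w‖ ≤ C * ‖w‖ ^ 6 := by
  obtain ⟨K, hK⟩ := exists_recipPoly_mul_logTrunc
  have hp : Continuous recipPoly := by unfold recipPoly; fun_prop
  obtain ⟨M, hM⟩ := (isCompact_closedBall (0 : ℂ) 1).exists_bound_of_continuousOn hp.continuousOn
  have hM0 : 0 ≤ M := (norm_nonneg _).trans (hM 0 (by simp))
  refine ⟨2 * (|K| + M), by positivity, ?_⟩
  intro w hw hsmall
  set s := sqrtC w with hs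
  have hsq : s ^ 2 = w := sqrtC_sq w
  have hnsq : ‖s‖ ^ 2 = ‖w‖ := norm_sqrtC_sq w
  have hre : ‖s‖ / 2 ≤ s.re := sqrtC_re_ge hw
  have hs4 : ‖s‖ ≤ 1 / 4 := by nlinarith [norm_nonneg s]
  have hs0 : s ≠ 0 := by rintro h; rw [h] at hsq; exact hw.1 (by rw [← hsq]; simp)
  have hspos : 0 < ‖s‖ := norm_pos_iff.2 hs0
  -- The witness `l = 1 / L` is `2 √w / t`. Since `L` is within `1/16` of `1`, the argument of `t`
  -- stays close to that of `√w`.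
  set t := Complex.log (1 + s) - Complex.log (1 - s) with ht
  have h1 := norm_log_sub_log_le hs4
  rw [hsq, ← ht] at h1
  set L := t / (2 * s) with hL
  have htL : t = 2 * s * L := by rw [hL]; field_simp
  have hLtrunc : ‖L - logTrunc w‖ ≤ ‖w‖ ^ 6 / 2 := by
    have e : L - logTrunc w = (t - 2 * s * logTrunc w) / (2 * s) := by
      rw [hL]; field_simp
    rw [e, norm_div, norm_mul, Complex.norm_ofNat, div_le_iff₀ (by positivity), ← hnsq]
    refine h1.trans (le_of_eq ?_)
    ring
  have hL1 : ‖L - 1‖ ≤ 1 / 16 := by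
    have h2 := norm_logTrunc_sub_le hsmall
    have h3 := norm_add_le (L - logTrunc w) (logTrunc w - 1)
    rw [sub_add_sub_cancel] at h3
    have h4 : ‖w‖ ^ 6 ≤ ‖w‖ := pow_le_of_le_one (norm_nonneg _) (by linarith) (by norm_num)
    linarith
  have hLlow : 15 / 16 ≤ ‖L‖ := by
    have := norm_sub_norm_le (1 : ℂ) L
    rw [norm_one, norm_sub_rev] at this
    linarith
  have hLup : ‖L‖ ≤ 17 / 16 := by
    have := norm_add_le (L - 1) 1
    rw [sub_add_cancel, norm_one] at this
    linarith
  have hL0 : L ≠ 0 := norm_pos_iff.1 (by linarith)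
  have hnt : ‖t‖ = 2 * ‖s‖ * ‖L‖ := by rw [htL, norm_mul, norm_mul, Complex.norm_ofNat]
  refine ⟨t, 1 / L, ?_, ?_, ?_, ?_, ?_, ?_, ?_, ?_⟩
  · rw [htL]; exact mul_ne_zero (mul_ne_zero two_ne_zero hs0) hL0
  · rw [hnt]; nlinarith
  · have e : t = 2 * s + 2 * s * (L - 1) := by rw [htL]; ring
    have h2 : (2 * s * (L - 1)).re ≥ -(2 * ‖s‖ * (1 / 16)) := by
      have h3 := neg_le_of_abs_le (Complex.abs_re_le_norm (2 * s * (L - 1)))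
      rw [norm_mul, norm_mul, Complex.norm_ofNat] at h3
      have : 2 * ‖s‖ * ‖L - 1‖ ≤ 2 * ‖s‖ * (1 / 16) := by gcongr
      linarith
    have h4 : t.re = 2 * s.re + (2 * s * (L - 1)).re := by
      conv_lhs => rw [e, Complex.add_re]
      congr 1
      simp
    rw [h4, hnt]
    nlinarith
  · have ha : 1 + s ≠ 0 := one_add_sqrtC_ne_zero (sector_subset_slitPlane hw)
    have hb : 1 - s ≠ 0 := by
      intro h
      have : s = 1 := (sub_eq_zero.1 h).symm
      rw [this, norm_one] at hs4
      norm_num at hs4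
    rw [ht, neg_sub, Complex.exp_sub, Complex.exp_log ha, Complex.exp_log hb, nome]
  · rw [htL]; field_simp
  · rw [hnt]; nlinarith
  · rw [norm_div, norm_one, div_le_iff₀ (by linarith)]; linarith
  · have hw1 : ‖w‖ ≤ 1 := by linarith
    have e : 1 / L - recipPoly w
        = -((recipPoly w * logTrunc w - 1) + recipPoly w * (L - logTrunc w)) / L := by
      field_simp
      ring
    have h2 : ‖(recipPoly w * logTrunc w - 1) + recipPoly w * (L - logTrunc w)‖
        ≤ (|K| + M) * ‖w‖ ^ 6 := by
      refine (norm_add_le _ _).trans ?_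
      rw [norm_mul]
      have h3 := (hK w hw1).trans (mul_le_mul_of_nonneg_right (le_abs_self K) (by positivity))
      have h4 : ‖recipPoly w‖ * ‖L - logTrunc w‖ ≤ M * (‖w‖ ^ 6 / 2) :=
        mul_le_mul (hM w (mem_closedBall_zero_iff.2 hw1)) hLtrunc (norm_nonneg _) hM0
      have h5 : 0 ≤ M * ‖w‖ ^ 6 := by positivity
      linarith
    rw [e, norm_div, norm_neg, div_le_iff₀ (by linarith)]
    refine h2.trans ?_
    have h5 : 0 ≤ (|K| + M) * ‖w‖ ^ 6 := by positivity
    nlinarith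

/-! ### Expansions of the generating functions at the vertex -/

/-- `oneOne` up to a high power of `√w`, and `√w ^ 3 * lambertQ` up to the third power of `√w`. -/
theorem exists_expansion : ∃ C : ℝ, 0 ≤ C ∧ ∀ w ∈ sector, ‖w‖ ≤ 1 / 16 → ∃ l : ℂ,
    ‖l‖ ≤ 2 ∧ ‖l - recipPoly w‖ ≤ C * ‖w‖ ^ 6 ∧
    ‖oneOne w - (w / 24 + Real.pi ^ 2 / 24 * l ^ 2 - sqrtC w / 4 * l)‖ ≤ C * ‖sqrtC w‖ ^ 11 ∧
    ‖sqrtC w ^ 3 * lambertQ (nome w) - (zeta3 / 4 * l ^ 3 - w / 24 * l)‖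
      ≤ C * ‖sqrtC w‖ ^ 3 := by
  obtain ⟨C₁, hC₁, h1⟩ := exists_log_parameter
  -- The exponent `9` and the factor `w = √w²` give an error of order `√w ^ 11`, which transfers to
  -- `n ^ (-5)`.
  obtain ⟨C₂, h2⟩ := norm_lambertP_sub_le 9
  obtain ⟨C₃, h3⟩ := norm_lambertQ_sub_le
  refine ⟨C₁ + |C₂| * 4 ^ 9 + |C₃| * 4, by positivity, ?_⟩
  intro w hw hsmall
  obtain ⟨t, l, ht0, ht1, hre, hnome, htl, hts, hl2, hl⟩ := h1 w hw hsmall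
  set s := sqrtC w with hs
  have hsq : s ^ 2 = w := sqrtC_sq w
  have hp2 : 0 ≤ |C₂| * 4 ^ 9 := by positivity
  have hp3 : 0 ≤ |C₃| * 4 := by positivity
  have hse : s = t * l / 2 := by rw [htl]; ring
  refine ⟨l, hl2, hl.trans ?_, ?_, ?_⟩
  · exact mul_le_mul_of_nonneg_right (by linarith) (by positivity)
  · have h4 := h2 t ht0 ht1 hre
    have e : oneOne w - (w / 24 + Real.pi ^ 2 / 24 * l ^ 2 - s / 4 * l)
        = s ^ 2 * (lambertP (Complex.exp (-t)) - (1 / 24 + Real.pi ^ 2 / (6 * t ^ 2) - 1 / (2 * t))) := by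
      rw [oneOne, hnome, ← hsq, hse]
      field_simp
      ring
    rw [e, norm_mul, norm_pow]
    calc ‖s‖ ^ 2 * _ ≤ ‖s‖ ^ 2 * (|C₂| * (4 * ‖s‖) ^ 9) := by
          gcongr
          refine h4.trans ?_
          gcongr
          exact le_abs_self _
      _ = |C₂| * 4 ^ 9 * ‖s‖ ^ 11 := by ring
      _ ≤ _ := mul_le_mul_of_nonneg_right (by linarith) (by positivity)
  · have h4 := h3 t ht0 hre
    have e : s ^ 3 * lambertQ (nome w) - (zeta3 / 4 * l ^ 3 - w / 24 * l)
        = s ^ 2 * (l / 2) * (t * lambertQ (Complex.exp (-t)) - (2 * zeta3 / t ^ 2 - 1 / 12)) := by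
      rw [hnome, ← hsq, hse]
      field_simp
      ring
    rw [e, norm_mul, norm_mul, norm_pow, norm_div, Complex.norm_ofNat]
    calc ‖s‖ ^ 2 * (‖l‖ / 2) * _ ≤ ‖s‖ ^ 2 * (2 / 2) * (|C₃| * (4 * ‖s‖)) := by
          gcongr
          refine h4.trans ?_
          gcongr
          exact le_abs_self _
      _ = |C₃| * 4 * ‖s‖ ^ 3 := by ring
      _ ≤ _ := mul_le_mul_of_nonneg_right (by linarith) (by positivity)

end SimpleWalk

namespace SimpleWalk

/-! ### Bounds on the sector and transfer to probabilities -/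

lemma exists_bound_of_continuousOn_slitPlane {f : ℂ → ℂ} (hf : ContinuousOn f Complex.slitPlane)
    {ε : ℝ} (hε : 0 < ε) : ∃ M : ℝ, 0 ≤ M ∧ ∀ w ∈ sector, ε ≤ ‖w‖ → ‖f w‖ ≤ M := by
  have hcl : IsClosed {w : ℂ | ε ≤ ‖w‖ ∧ -‖w‖ / 2 ≤ w.re ∧ ‖w‖ ≤ 3} := by
    have h1 : IsClosed {w : ℂ | ε ≤ ‖w‖} := isClosed_le (by fun_prop) (by fun_prop)
    have h2 : IsClosed {w : ℂ | -‖w‖ / 2 ≤ w.re} := isClosed_le (by fun_prop) (by fun_prop)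
    have h3 : IsClosed {w : ℂ | ‖w‖ ≤ 3} := isClosed_le (by fun_prop) (by fun_prop)
    exact h1.inter (h2.inter h3)
  have hsub : {w : ℂ | ε ≤ ‖w‖ ∧ -‖w‖ / 2 ≤ w.re ∧ ‖w‖ ≤ 3} ⊆ sector :=
    fun w hw => ⟨norm_pos_iff.1 (hε.trans_le hw.1), hw.2.1, hw.2.2⟩
  have hcomp : IsCompact {w : ℂ | ε ≤ ‖w‖ ∧ -‖w‖ / 2 ≤ w.re ∧ ‖w‖ ≤ 3} :=
    (isCompact_closedBall (0 : ℂ) 3).of_isClosed_subset hcl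
      fun w hw => mem_closedBall_zero_iff.2 hw.2.2
  obtain ⟨M, hM⟩ := hcomp.exists_bound_of_continuousOn
    (hf.mono fun w hw => sector_subset_slitPlane (hsub hw))
  exact ⟨|M|, abs_nonneg _, fun w hw h => (hM w ⟨h, hw.2⟩).trans (le_abs_self M)⟩

lemma norm_sqrtC_pow (w : ℂ) (k : ℕ) : ‖sqrtC w‖ ^ k = ‖w‖ ^ ((k : ℝ) / 2) := by
  rw [← norm_sqrtC_sq w, ← Real.rpow_natCast ‖sqrtC w‖ 2, ← Real.rpow_mul (norm_nonneg _),
    ← Real.rpow_natCast]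
  congr 1
  push_cast
  ring

/-- A bound near the vertex extends to the whole sector, because the rest of the sector is compact
and avoids the cut. -/
lemma exists_rpow_bound {f : ℂ → ℂ} (hf : ContinuousOn f Complex.slitPlane) {ε C : ℝ}
    (hε : 0 < ε) (k : ℕ) (h : ∀ w ∈ sector, ‖w‖ ≤ ε → ‖f w‖ ≤ C * ‖sqrtC w‖ ^ k) :
    ∃ C' : ℝ, 0 ≤ C' ∧ ∀ w ∈ sector, ‖f w‖ ≤ C' * ‖w‖ ^ ((k : ℝ) / 2) := by
  obtain ⟨M, hM0, hM⟩ := exists_bound_of_continuousOn_slitPlane hf hε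
  refine ⟨|C| + M / ε ^ ((k : ℝ) / 2), by positivity, fun w hw => ?_⟩
  have hw0 : 0 < ‖w‖ := norm_pos_iff.2 hw.1
  rw [add_mul]
  rcases le_total ‖w‖ ε with h1 | h1
  · refine (h w hw h1).trans ?_
    rw [norm_sqrtC_pow]
    have h2 : C * ‖w‖ ^ ((k : ℝ) / 2) ≤ |C| * ‖w‖ ^ ((k : ℝ) / 2) := by
      gcongr
      exact le_abs_self C
    have h3 : 0 ≤ M / ε ^ ((k : ℝ) / 2) * ‖w‖ ^ ((k : ℝ) / 2) := by positivity
    linarith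
  · have h2 : ε ^ ((k : ℝ) / 2) ≤ ‖w‖ ^ ((k : ℝ) / 2) := by gcongr
    have h3 : M ≤ M / ε ^ ((k : ℝ) / 2) * ‖w‖ ^ ((k : ℝ) / 2) := by
      rw [div_mul_eq_mul_div, le_div_iff₀ (by positivity)]
      gcongr
    have h4 : 0 ≤ |C| * ‖w‖ ^ ((k : ℝ) / 2) := by positivity
    linarith [hM w hw h1]

/-- The contribution to a probability of a function that is small at the vertex. -/
theorem two_mul_norm_coeff_div_centralBinom_le {δ : ℝ} (hδ : 0 < δ) (k : ℕ) :
    ∃ K : ℝ, ∃ N : ℕ, ∀ (F : ℂ → ℂ) (C : ℝ) (g : ℕ → ℂ), DifferentiableOn ℂ F (discNbhd δ) →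
      (∀ w ∈ discNbhd δ, ‖F w‖ ≤ C * ‖w‖ ^ ((k : ℝ) / 2)) →
      (∀ z : ℂ, ‖z‖ < 1 / 4 → HasSum (fun n => g n * z ^ n) (F (1 - 4 * z))) →
      ∀ n, N ≤ n → 2 * n * ‖g n‖ / n.centralBinom ≤ K * C * (n : ℝ) ^ ((1 - k : ℝ) / 2) := by
  obtain ⟨K, N, h⟩ := norm_coeff_le_of_discNbhd (κ := (k : ℝ) / 2) hδ (by positivity)
  refine ⟨4 * K, max N 1, fun F C g hF hb hg n hn => ?_⟩
  have h1 := h F C g hF hb hg n (le_of_max_le_left hn)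
  have hn1 : 1 ≤ n := le_of_max_le_right hn
  have hn0 : (0 : ℝ) < n := by exact_mod_cast hn1
  have hB : (0 : ℝ) < n.centralBinom := by exact_mod_cast n.centralBinom_pos
  -- Since `2n / C(2n, n)` is at most a multiple of `n ^ (3/2) * 4 ^ (-n)`, the exponent `-k/2 - 1`
  -- becomes `(1 - k) / 2`.
  have hB4 := four_pow_le_sqrt_mul_centralBinom hn1
  have hKC : 0 ≤ K * C := by
    have h2 := (norm_nonneg _).trans h1
    have h3 : (0 : ℝ) < 4 ^ n * (n : ℝ) ^ (-((k : ℝ) / 2) - 1) := by positivity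
    rw [mul_assoc] at h2
    exact nonneg_of_mul_nonneg_left h2 h3
  rw [div_le_iff₀ hB]
  calc 2 * n * ‖g n‖ ≤ 2 * n * (K * C * 4 ^ n * (n : ℝ) ^ (-((k : ℝ) / 2) - 1)) := by gcongr
    _ ≤ 2 * n * (K * C * (2 * (n : ℝ) ^ (1 / 2 : ℝ) * n.centralBinom)
          * (n : ℝ) ^ (-((k : ℝ) / 2) - 1)) := by gcongr
    _ = 4 * (K * C) * ((n : ℝ) ^ (1 : ℝ) * (n : ℝ) ^ (1 / 2 : ℝ) * (n : ℝ) ^ (-((k : ℝ) / 2) - 1))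
          * n.centralBinom := by rw [Real.rpow_one]; ring
    _ = _ := by
      rw [← Real.rpow_add hn0, ← Real.rpow_add hn0, mul_assoc 4 K C]
      congr 3
      ring

/-! ### Coefficients of `w ^ k * √w` and of polynomials -/

lemma hasSum_mul_one_sub {a : ℕ → ℂ} {z f : ℂ} (h : HasSum (fun n => a n * z ^ n) f) :
    HasSum (fun n => (a n - if n = 0 then 0 else 4 * a (n - 1)) * z ^ n) ((1 - 4 * z) * f) := by
  have h1 : HasSum (fun n => (if n = 0 then 0 else 4 * a (n - 1)) * z ^ n) (4 * z * f) := by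
    rw [← hasSum_nat_add_iff' 1]
    simp only [Finset.range_one, Finset.sum_singleton, if_true, zero_mul, sub_zero]
    refine (h.mul_left (4 * z)).congr_fun fun n => ?_
    rw [if_neg (Nat.succ_ne_zero n), Nat.add_sub_cancel, pow_succ]
    ring
  have h2 := h.sub h1
  rw [show f - 4 * z * f = (1 - 4 * z) * f by ring] at h2
  refine h2.congr_fun fun n => ?_
  ring

/-- The coefficients of `(1 - 4 z) ^ (k + 1 / 2)`. -/
noncomputable def halfPowCoeff (k n : ℕ) : ℝ :=
  sqrtCoeff n * ∏ j ∈ Finset.range k, (-(2 * j + 3 : ℝ) / (2 * n - 2 * j - 3))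

lemma two_mul_sub_odd_ne_zero (n j : ℕ) : (2 * n - 2 * j - 3 : ℝ) ≠ 0 := by
  have : (2 * n - 2 * j - 3 : ℤ) ≠ 0 := by omega
  exact_mod_cast this

lemma two_mul_sub_one_ne_zero (n : ℕ) : (2 * n - 1 : ℝ) ≠ 0 := by
  have : (2 * n - 1 : ℤ) ≠ 0 := by omega
  exact_mod_cast this

lemma sqrtCoeff_succ (n : ℕ) : (n + 1 : ℝ) * sqrtCoeff (n + 1) = 2 * (2 * n - 1) * sqrtCoeff n := by
  have h1 := two_mul_sub_one_ne_zero n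
  have h2 : (2 * (n + 1 : ℕ) - 1 : ℝ) ≠ 0 := two_mul_sub_one_ne_zero (n + 1)
  have hr : ((n : ℝ) + 1) * (n + 1).centralBinom = 2 * (2 * n + 1) * n.centralBinom := by
    exact_mod_cast Nat.succ_mul_centralBinom_succ n
  rw [sqrtCoeff, sqrtCoeff, mul_div_assoc', mul_neg, hr]
  push_cast at h2 ⊢
  field_simp
  ring

/-- The coefficient form of multiplication by `1 - 4 z`, which links the closed product to the
powers of `w`. -/
lemma halfPowCoeff_succ (k n : ℕ) : halfPowCoeff (k + 1) n
    = halfPowCoeff k n - if n = 0 then 0 else 4 * halfPowCoeff k (n - 1) := by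
  rcases n with _ | n
  · rw [if_pos rfl, sub_zero, halfPowCoeff, halfPowCoeff, Finset.prod_range_succ]
    have h := two_mul_sub_odd_ne_zero 0 k
    have e : (-(2 * k + 3 : ℝ) / (2 * (0 : ℕ) - 2 * k - 3)) = 1 := by
      rw [div_eq_one_iff_eq h]; push_cast; ring
    rw [e, mul_one]
  · rw [if_neg (Nat.succ_ne_zero n), Nat.add_sub_cancel]
    have hprod : ∀ k : ℕ, (2 * n - 1 : ℝ) * ∏ j ∈ Finset.range k,
        (-(2 * j + 3 : ℝ) / (2 * (n + 1 : ℕ) - 2 * j - 3))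
        = (2 * n - 2 * k - 1) * ∏ j ∈ Finset.range k, (-(2 * j + 3 : ℝ) / (2 * n - 2 * j - 3)) := by
      intro k
      induction k with
      | zero => simp
      | succ k ih =>
        rw [Finset.prod_range_succ, Finset.prod_range_succ, ← mul_assoc, ih]
        have h1 := two_mul_sub_odd_ne_zero n k
        have h2 := two_mul_sub_odd_ne_zero (n + 1) k
        generalize ∏ j ∈ Finset.range k, (-(2 * j + 3 : ℝ) / (2 * n - 2 * j - 3)) = Q
        push_cast at h2 ⊢
        rw [show 2 * ((n : ℝ) + 1) - 2 * k - 3 = 2 * n - 2 * k - 1 by ring] at h2 ⊢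
        rw [show 2 * (n : ℝ) - 2 * (k + 1) - 1 = 2 * n - 2 * k - 3 by ring]
        generalize 2 * (n : ℝ) - 2 * k - 3 = a at h1 ⊢
        generalize 2 * (n : ℝ) - 2 * k - 1 = b at h2 ⊢
        field_simp
    have h0 := two_mul_sub_one_ne_zero n
    have hs := sqrtCoeff_succ n
    have hk := hprod k
    have h1 := two_mul_sub_odd_ne_zero (n + 1) k
    have hn : (n + 1 : ℝ) ≠ 0 := by positivity
    rw [halfPowCoeff, halfPowCoeff, halfPowCoeff, Finset.prod_range_succ]
    set Q := ∏ j ∈ Finset.range k, (-(2 * j + 3 : ℝ) / (2 * n - 2 * j - 3))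
    set Q' := ∏ j ∈ Finset.range k, (-(2 * j + 3 : ℝ) / (2 * (n + 1 : ℕ) - 2 * j - 3))
    have e1 : sqrtCoeff (n + 1) = 2 * (2 * n - 1) * sqrtCoeff n / (n + 1) := by
      rw [← hs]; field_simp
    have e2 : Q' = (2 * n - 2 * k - 1) * Q / (2 * n - 1) := by rw [← hk]; field_simp
    rw [e1, e2]
    push_cast at h1 ⊢
    rw [show 2 * ((n : ℝ) + 1) - 2 * k - 3 = 2 * n - 2 * k - 1 by ring] at h1 ⊢
    generalize ha : 2 * (n : ℝ) - 2 * k - 1 = a at h1 ⊢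
    field_simp
    rw [← ha]
    ring

lemma hasSum_halfPowCoeff (k : ℕ) {z : ℂ} (hz : ‖z‖ < 1 / 4) :
    HasSum (fun n => (halfPowCoeff k n : ℂ) * z ^ n)
      ((1 - 4 * z) ^ k * sqrtC (1 - 4 * z)) := by
  induction k with
  | zero => simpa [halfPowCoeff] using hasSum_sqrtCoeff hz
  | succ k ih =>
    have := hasSum_mul_one_sub ih
    rw [← mul_assoc, ← pow_succ'] at this
    refine this.congr_fun fun n => ?_
    rw [halfPowCoeff_succ]
    push_cast
    split_ifs <;> simp

lemma hasSum_polynomial (P : Polynomial ℂ) (z : ℂ) :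
    HasSum (fun n => P.coeff n * z ^ n) (P.eval z) := by
  rw [Polynomial.eval_eq_sum_range]
  refine hasSum_sum_of_ne_finset_zero fun n hn => ?_
  rw [Finset.mem_range, not_lt] at hn
  rw [Polynomial.coeff_eq_zero_of_natDegree_lt (by omega), zero_mul]

end SimpleWalk

namespace SimpleWalk

/-! ### Sites visited only once: the distribution of `multRange 1` -/

/-- The coefficients of `recipPoly` that matter for the expansions to fourth order. -/
noncomputable def recipTrunc (w : ℂ) : ℂ :=
  1 - 1 / 3 * w - 4 / 45 * w ^ 2 - 44 / 945 * w ^ 3 - 428 / 14175 * w ^ 4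

/-- In the expansion of `oneOne` the terms `w / 24` and `π² l² / 24` are polynomials in `w` up to
the error, so only `-√w l / 4` matters for large `n`. Its term of order `w ^ 5 √w` already belongs
to the error. -/
lemma exists_polynomial_oneOne : ∃ P : Polynomial ℂ, ∃ C : ℝ, ∀ w ∈ sector,
    ‖oneOne w - P.eval w + 1 / 4 * (recipTrunc w * sqrtC w)‖ ≤ C * ‖w‖ ^ ((11 : ℕ) / 2 : ℝ) := by
  obtain ⟨C, hC, h⟩ := exists_expansion
  have hp : Continuous recipPoly := by unfold recipPoly; fun_prop
  obtain ⟨M, hM⟩ := (isCompact_closedBall (0 : ℂ) 1).exists_bound_of_continuousOn hp.continuousOn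
  have hM0 : 0 ≤ M := (norm_nonneg _).trans (hM 0 (by simp))
  set R : Polynomial ℂ := 1 - Polynomial.C (1 / 3) * Polynomial.X
    - Polynomial.C (4 / 45) * Polynomial.X ^ 2 - Polynomial.C (44 / 945) * Polynomial.X ^ 3
    - Polynomial.C (428 / 14175) * Polynomial.X ^ 4
    - Polynomial.C (10196 / 467775) * Polynomial.X ^ 5 with hR
  have hRe : ∀ w, R.eval w = recipPoly w := fun w => by
    simp only [hR, recipPoly, Polynomial.eval_sub, Polynomial.eval_mul, Polynomial.eval_C,
      Polynomial.eval_X, Polynomial.eval_pow, Polynomial.eval_one]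
    ring
  set P : Polynomial ℂ := Polynomial.C (1 / 24) * Polynomial.X
    + Polynomial.C ((Real.pi : ℂ) ^ 2 / 24) * R ^ 2 with hP
  have hPe : ∀ w, P.eval w = w / 24 + Real.pi ^ 2 / 24 * recipPoly w ^ 2 := fun w => by
    simp only [hP, Polynomial.eval_add, Polynomial.eval_mul, Polynomial.eval_C,
      Polynomial.eval_X, Polynomial.eval_pow, hRe]
    ring
  have hcont : ContinuousOn
      (fun w => oneOne w - P.eval w + 1 / 4 * (recipTrunc w * sqrtC w)) Complex.slitPlane := by
    intro w hw
    have h1 := (differentiableAt_oneOne hw).continuousAt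
    have h2 := (differentiableAt_sqrtC hw).continuousAt
    have h3 : ContinuousAt recipTrunc w := by
      have : Continuous recipTrunc := by unfold recipTrunc; fun_prop
      exact this.continuousAt
    exact ((h1.sub P.continuous.continuousAt).add
      (continuousAt_const.mul (h3.mul h2))).continuousWithinAt
  have hb : ∀ w ∈ sector, ‖w‖ ≤ 1 / 16 →
      ‖oneOne w - P.eval w + 1 / 4 * (recipTrunc w * sqrtC w)‖
        ≤ (C + Real.pi ^ 2 / 24 * (C * (2 + M)) + C + 1) * ‖sqrtC w‖ ^ 11 := by
    intro w hw hsmall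
    obtain ⟨l, hl2, hl, hA, -⟩ := h w hw hsmall
    set s := sqrtC w with hs
    have hsn : ‖s‖ ^ 2 = ‖w‖ := norm_sqrtC_sq w
    have hs1 : ‖s‖ ≤ 1 := by nlinarith [norm_nonneg s]
    have hw6 : ‖w‖ ^ 6 ≤ ‖s‖ ^ 11 := by
      rw [← hsn, ← pow_mul]
      exact pow_le_pow_of_le_one (norm_nonneg _) hs1 (by norm_num)
    have hw5 : ‖s‖ * ‖w‖ ^ 5 = ‖s‖ ^ 11 := by rw [← hsn]; ring
    have e : oneOne w - P.eval w + 1 / 4 * (recipTrunc w * s)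
        = (oneOne w - (w / 24 + Real.pi ^ 2 / 24 * l ^ 2 - s / 4 * l))
          + ((Real.pi ^ 2 / 24 : ℝ) : ℂ) * ((l - recipPoly w) * (l + recipPoly w))
          - (1 / 4) * (s * (l - recipPoly w)) + (1 / 4) * (10196 / 467775) * (s * w ^ 5) := by
      rw [hPe, recipTrunc, recipPoly]
      push_cast
      ring
    have b2 : ‖((Real.pi ^ 2 / 24 : ℝ) : ℂ) * ((l - recipPoly w) * (l + recipPoly w))‖
        ≤ Real.pi ^ 2 / 24 * (C * (2 + M)) * ‖s‖ ^ 11 := by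
      rw [norm_mul, norm_mul, Complex.norm_real, Real.norm_of_nonneg (by positivity)]
      have h1 : ‖l + recipPoly w‖ ≤ 2 + M := (norm_add_le _ _).trans
        (add_le_add hl2 (hM w (mem_closedBall_zero_iff.2 (by linarith))))
      calc _ ≤ Real.pi ^ 2 / 24 * (C * ‖s‖ ^ 11 * (2 + M)) := by
            gcongr
            exact hl.trans (by gcongr)
        _ = _ := by ring
    have b3 : ‖(1 / 4) * (s * (l - recipPoly w))‖ ≤ C * ‖s‖ ^ 11 := by
      rw [norm_mul, norm_mul]
      have h4 : ‖(1 / 4 : ℂ)‖ ≤ 1 := by norm_num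
      calc _ ≤ 1 * (1 * (C * ‖s‖ ^ 11)) := by
            gcongr
            exact hl.trans (by gcongr)
        _ = _ := by ring
    have b4 : ‖(1 / 4) * (10196 / 467775) * (s * w ^ 5)‖ ≤ 1 * ‖s‖ ^ 11 := by
      rw [norm_mul, norm_mul s, norm_pow, hw5]
      gcongr
      norm_num
    rw [e]
    refine (norm_add_le _ _).trans ((add_le_add ((norm_sub_le _ _).trans
      (add_le_add ((norm_add_le _ _).trans (add_le_add hA b2)) b3)) b4).trans (le_of_eq ?_))
    ring
  obtain ⟨C', -, hC'⟩ := exists_rpow_bound hcont (by norm_num) 11 hb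
  exact ⟨P, C', hC'⟩

/-- The coefficients of `recipTrunc w * √w`. -/
noncomputable def recipCoeff (n : ℕ) : ℝ :=
  halfPowCoeff 0 n - 1 / 3 * halfPowCoeff 1 n - 4 / 45 * halfPowCoeff 2 n
    - 44 / 945 * halfPowCoeff 3 n - 428 / 14175 * halfPowCoeff 4 n

lemma hasSum_recipCoeff {z : ℂ} (hz : ‖z‖ < 1 / 4) :
    HasSum (fun n => (recipCoeff n : ℂ) * z ^ n) (recipTrunc (1 - 4 * z) * sqrtC (1 - 4 * z)) := by
  have h := ((((hasSum_halfPowCoeff 0 hz).sub ((hasSum_halfPowCoeff 1 hz).mul_left (1 / 3))).sub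
    ((hasSum_halfPowCoeff 2 hz).mul_left (4 / 45))).sub
    ((hasSum_halfPowCoeff 3 hz).mul_left (44 / 945))).sub
    ((hasSum_halfPowCoeff 4 hz).mul_left (428 / 14175))
  convert! h using 1
  · funext n
    rw [recipCoeff]
    push_cast
    ring
  · rw [recipTrunc]
    ring

lemma exists_coef_one_one_bound : ∃ C : ℝ, ∃ N : ℕ, ∀ n, N ≤ n →
    |2 * n * (coef (cls (· = 1) (· = 1) fun _ => True) n).toReal / n.centralBinom
      - -(1 / 4) * (2 * n * recipCoeff n / n.centralBinom)| ≤ C / (n : ℝ) ^ 5 := by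
  obtain ⟨P, C, hC⟩ := exists_polynomial_oneOne
  obtain ⟨K, N, hK⟩ := two_mul_norm_coeff_div_centralBinom_le (δ := 1 / 3) (by norm_num) 11
  set P' := P.comp (1 - 4 * Polynomial.X) with hP'
  set A : ℕ → ℝ := fun n => (coef (cls (· = 1) (· = 1) fun _ => True) n).toReal with hA
  have hsub : discNbhd (1 / 3) ⊆ sector := discNbhd_subset_sector le_rfl
  have hdiff : DifferentiableOn ℂ
      (fun w => oneOne w - P.eval w + 1 / 4 * (recipTrunc w * sqrtC w)) (discNbhd (1 / 3)) := by
    intro w hw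
    have hw' := sector_subset_slitPlane (hsub hw)
    have h1 := differentiableAt_oneOne hw'
    have h2 := differentiableAt_sqrtC hw'
    have h3 : DifferentiableAt ℂ recipTrunc w := by unfold recipTrunc; fun_prop
    exact ((h1.sub P.differentiable.differentiableAt).add
      ((differentiableAt_const _).mul (h3.mul h2))).differentiableWithinAt
  have hsum : ∀ z : ℂ, ‖z‖ < 1 / 4 →
      HasSum (fun n => ((A n : ℂ) - P'.coeff n + 1 / 4 * recipCoeff n) * z ^ n)
      ((fun w => oneOne w - P.eval w + 1 / 4 * (recipTrunc w * sqrtC w)) (1 - 4 * z)) := by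
    intro z hz
    have hP : P'.eval z = P.eval (1 - 4 * z) := by simp [hP']
    have h := ((hasSum_coef_one_one hz).sub (hasSum_polynomial P' z)).add
      ((hasSum_recipCoeff hz).mul_left (1 / 4))
    rw [hP] at h
    refine h.congr_fun fun n => ?_
    ring
  refine ⟨K * C, max (max N 1) (P'.natDegree + 1), fun n hn => ?_⟩
  have hn1 : N ≤ n := le_of_max_le_left (le_of_max_le_left hn)
  have hn0 : 1 ≤ n := le_of_max_le_right (le_of_max_le_left hn)
  have hdeg : P'.natDegree < n := le_of_max_le_right hn
  have hB : (0 : ℝ) < n.centralBinom := by exact_mod_cast n.centralBinom_pos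
  have h := hK _ C _ hdiff (fun w hw => hC w (hsub hw)) hsum n hn1
  rw [Polynomial.coeff_eq_zero_of_natDegree_lt hdeg, sub_zero] at h
  have e : ‖(A n : ℂ) + 1 / 4 * recipCoeff n‖ = |A n + 1 / 4 * recipCoeff n| := by
    rw [← Real.norm_eq_abs, ← Complex.norm_real]
    push_cast
    rfl
  have e2 : (n : ℝ) ^ ((1 - (11 : ℕ) : ℝ) / 2) = 1 / (n : ℝ) ^ 5 := by
    rw [show ((1 - (11 : ℕ) : ℝ) / 2) = -((5 : ℕ) : ℝ) by norm_num, Real.rpow_neg (by positivity),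
      Real.rpow_natCast, one_div]
  rw [e, e2, mul_one_div] at h
  refine le_trans (le_of_eq ?_) h
  have e3 : 2 * n * A n / n.centralBinom - -(1 / 4) * (2 * n * recipCoeff n / n.centralBinom)
      = 2 * n / n.centralBinom * (A n + 1 / 4 * recipCoeff n) := by ring
  rw [e3, abs_mul, abs_of_nonneg (by positivity)]
  ring

/-- The central binomial coefficient cancels and leaves a rational function of `n`. Subtracting the
claimed expansion is exact algebra, with a remainder of order `n ^ (-5)`. -/
lemma recipCoeff_eq {n : ℕ} (hn : 9 ≤ n) :
    -(1 / 4) * (2 * n * recipCoeff n / n.centralBinom)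
      - (1 / 4 + 1 / (4 * (n : ℝ)) + 11 / (48 * (n : ℝ) ^ 2) + 31 / (144 * (n : ℝ) ^ 3)
          + 601 / (2880 * (n : ℝ) ^ 4))
      = (12621 / 64 - 240713 / 480 * n + 40657 / 144 * n ^ 2 - 2491 / 24 * n ^ 3
          - 901 / 18 * n ^ 4)
        / (n ^ 4 * ((2 * n - 1) * (2 * n - 3) * (2 * n - 5) * (2 * n - 7) * (2 * n - 9))) := by
  have hB : (n.centralBinom : ℝ) ≠ 0 := by exact_mod_cast n.centralBinom_ne_zero
  have hn' : (9 : ℝ) ≤ n := by exact_mod_cast hn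
  have h0 : (n : ℝ) ≠ 0 := by linarith
  have h1 : (2 * n - 1 : ℝ) ≠ 0 := by linarith
  have h3 : (2 * n - 3 : ℝ) ≠ 0 := by linarith
  have h5 : (2 * n - 5 : ℝ) ≠ 0 := by linarith
  have h7 : (2 * n - 7 : ℝ) ≠ 0 := by linarith
  have h9 : (2 * n - 9 : ℝ) ≠ 0 := by linarith
  have e : -(1 / 4) * (2 * n * recipCoeff n / n.centralBinom)
      = n / (2 * (2 * n - 1)) * (1 + 1 / (2 * n - 3) - 4 / 3 / ((2 * n - 3) * (2 * n - 5))
        + 44 / 9 / ((2 * n - 3) * (2 * n - 5) * (2 * n - 7))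
        - 428 / 15 / ((2 * n - 3) * (2 * n - 5) * (2 * n - 7) * (2 * n - 9))) := by
    simp only [recipCoeff, halfPowCoeff, sqrtCoeff, Finset.prod_range_succ, Finset.prod_range_zero,
      Nat.cast_zero, Nat.cast_one, Nat.cast_ofNat]
    rw [show (2 * (n : ℝ) - 2 * 0 - 3) = 2 * n - 3 by ring,
      show (2 * (n : ℝ) - 2 * 1 - 3) = 2 * n - 5 by ring,
      show (2 * (n : ℝ) - 2 * 2 - 3) = 2 * n - 7 by ring,
      show (2 * (n : ℝ) - 2 * 3 - 3) = 2 * n - 9 by ring]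
    field_simp
    ring
  rw [e]
  generalize ha1 : (2 * n - 1 : ℝ) = a1 at h1 ⊢
  generalize ha3 : (2 * n - 3 : ℝ) = a3 at h3 ⊢
  generalize ha5 : (2 * n - 5 : ℝ) = a5 at h5 ⊢
  generalize ha7 : (2 * n - 7 : ℝ) = a7 at h7 ⊢
  generalize ha9 : (2 * n - 9 : ℝ) = a9 at h9 ⊢
  field_simp
  rw [← ha1, ← ha3, ← ha5, ← ha7, ← ha9]
  ring

lemma abs_quotient_le {n : ℕ} (hn : 9 ≤ n) :
    |(12621 / 64 - 240713 / 480 * n + 40657 / 144 * n ^ 2 - 2491 / 24 * n ^ 3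
          - 901 / 18 * n ^ 4 : ℝ)
        / (n ^ 4 * ((2 * n - 1) * (2 * n - 3) * (2 * n - 5) * (2 * n - 7) * (2 * n - 9)))|
      ≤ 1200 / (n : ℝ) ^ 5 := by
  have hn' : (9 : ℝ) ≤ n := by exact_mod_cast hn
  have hn1 : (1 : ℝ) ≤ n := by linarith
  have hn0 : (0 : ℝ) < n := by linarith
  have hden : (n : ℝ) ^ 4 * (n * n * n * n * n) ≤
      n ^ 4 * ((2 * n - 1) * (2 * n - 3) * (2 * n - 5) * (2 * n - 7) * (2 * n - 9)) := by
    have h1 : (n : ℝ) ≤ 2 * n - 1 := by linarith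
    have h3 : (n : ℝ) ≤ 2 * n - 3 := by linarith
    have h5 : (n : ℝ) ≤ 2 * n - 5 := by linarith
    have h7 : (n : ℝ) ≤ 2 * n - 7 := by linarith
    have h9 : (n : ℝ) ≤ 2 * n - 9 := by linarith
    generalize (2 * n - 1 : ℝ) = a1 at h1 ⊢
    generalize (2 * n - 3 : ℝ) = a3 at h3 ⊢
    generalize (2 * n - 5 : ℝ) = a5 at h5 ⊢
    generalize (2 * n - 7 : ℝ) = a7 at h7 ⊢
    generalize (2 * n - 9 : ℝ) = a9 at h9 ⊢
    have p1 : 0 < a1 := by linarith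
    have p3 : 0 < a3 := by linarith
    have p5 : 0 < a5 := by linarith
    have p7 : 0 < a7 := by linarith
    gcongr
  -- The absolute values of the coefficients add up to less than `1200`.
  have hnum : |(12621 / 64 - 240713 / 480 * n + 40657 / 144 * n ^ 2 - 2491 / 24 * n ^ 3
      - 901 / 18 * n ^ 4 : ℝ)| ≤ 1200 * n ^ 4 := by
    have p0 : (1 : ℝ) ≤ (n : ℝ) ^ 4 := one_le_pow₀ hn1
    have p1 : (n : ℝ) ≤ (n : ℝ) ^ 4 := le_self_pow₀ hn1 (by norm_num)
    have p2 : (n : ℝ) ^ 2 ≤ (n : ℝ) ^ 4 := pow_le_pow_right₀ hn1 (by norm_num)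
    have p3 : (n : ℝ) ^ 3 ≤ (n : ℝ) ^ 4 := pow_le_pow_right₀ hn1 (by norm_num)
    have q2 : (0 : ℝ) ≤ (n : ℝ) ^ 2 := by positivity
    have q3 : (0 : ℝ) ≤ (n : ℝ) ^ 3 := by positivity
    rw [abs_le]
    constructor <;> linarith
  rw [abs_div]
  have hpos : (0 : ℝ) < n ^ 4 * (n * n * n * n * n) := by positivity
  rw [abs_of_pos (hpos.trans_le hden)]
  calc _ ≤ 1200 * (n : ℝ) ^ 4 / (n ^ 4 * (n * n * n * n * n)) := by gcongr
    _ = _ := by field_simp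

theorem exists_prob_multRange_one_two : ∃ C : ℝ, ∃ N : ℕ, ∀ n, N ≤ n →
    |prob n (fun s => multRange 1 s = 2)
      - (1 / 4 + 1 / (4 * (n : ℝ)) + 11 / (48 * (n : ℝ) ^ 2) + 31 / (144 * (n : ℝ) ^ 3)
          + 601 / (2880 * (n : ℝ) ^ 4))| ≤ C / (n : ℝ) ^ 5 := by
  obtain ⟨C, N, h⟩ := exists_coef_one_one_bound
  refine ⟨C + 1200, max N 9, fun n hn => ?_⟩
  have hn9 : 9 ≤ n := le_of_max_le_right hn
  have h1 := h n (le_of_max_le_left hn)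
  have h2 := abs_quotient_le hn9
  rw [← recipCoeff_eq hn9] at h2
  rw [prob_multRange (by omega) one_pos, coef_congr (Q := cls (· = 1) (· = 1) fun _ => True)]
  · have h3 := (abs_add_le _ _).trans (add_le_add h1 h2)
    rw [sub_add_sub_cancel, ← add_div] at h3
    exact h3
  · intro L hL
    rw [pairCount_one hL]
    simp only [cls]
    split_ifs <;> simp_all

/-- Both series equal `oneAny = (1 - √w) / 2`, so the probability that a given end entry is `1` is
exact. With the probability of `multRange 1 = 2` this determines the other two by inclusion and
exclusion. -/
lemma coef_head_one {n : ℕ} (hn : 0 < n) :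
    2 * n * (coef (cls (· = 1) (fun _ => True) fun _ => True) n).toReal / n.centralBinom
      = n / (2 * n - 1) ∧
    2 * n * (coef (cls (fun _ => True) (· = 1) fun _ => True) n).toReal / n.centralBinom
      = n / (2 * n - 1) := by
  have hs : ∀ z : ℂ, ‖z‖ < 1 / 4 →
      HasSum (fun n => ((Polynomial.C (1 / 2 : ℂ)).coeff n - 1 / 2 * (sqrtCoeff n : ℂ)) * z ^ n)
      (oneAny (1 - 4 * z)) := by
    intro z hz
    have h := (hasSum_polynomial (Polynomial.C (1 / 2)) z).sub
      ((hasSum_sqrtCoeff hz).mul_left (1 / 2))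
    rw [Polynomial.eval_C] at h
    convert! h using 1
    · funext n; ring
    · rw [oneAny]; ring
  have h1 := coeff_unique (fun z hz => hasSum_coef_one_any hz) hs n
  have h2 := coeff_unique (fun z hz => hasSum_coef_any_one hz) hs n
  rw [Polynomial.coeff_C_of_ne_zero hn.ne'] at h1 h2
  have hB : (n.centralBinom : ℝ) ≠ 0 := by exact_mod_cast n.centralBinom_ne_zero
  have h3 := two_mul_sub_one_ne_zero n
  have key : ∀ x : ℝ, (x : ℂ) = 0 - 1 / 2 * (sqrtCoeff n : ℂ) →
      2 * n * x / n.centralBinom = n / (2 * n - 1) := by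
    intro x hx
    have : x = -(1 / 2) * sqrtCoeff n := by
      apply Complex.ofReal_injective
      rw [hx]; push_cast; ring
    rw [this, sqrtCoeff]
    field_simp
  exact ⟨key _ h1, key _ h2⟩

/-- The probabilities of `multRange 1 = 0` and `multRange 1 = 1` in terms of that of
`multRange 1 = 2`. -/
lemma prob_multRange_one {n : ℕ} (hn : 0 < n) :
    prob n (fun s => multRange 1 s = 1)
      = 2 * n / (2 * n - 1) - 2 * prob n (fun s => multRange 1 s = 2) ∧
    prob n (fun s => multRange 1 s = 0)
      = 1 - 2 * n / (2 * n - 1) + prob n (fun s => multRange 1 s = 2) := by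
  obtain ⟨h1, h2⟩ := coef_head_one hn
  rw [prob_multRange hn one_pos, prob_multRange hn one_pos, prob_multRange hn one_pos]
  set E := fun k n => coef (fun L => pairCount 1 (0 :: L) = k) n with hE
  set A := coef (fun L => L.headD 0 = 1 ∧ L.getLastD 0 ≠ 1) n
  set B := coef (fun L => L.headD 0 ≠ 1 ∧ L.getLastD 0 = 1) n
  have c1 : coef (cls (· = 1) (fun _ => True) fun _ => True) n = E 2 n + A := by
    refine coef_add (fun L hL => ?_) (fun L hL => ?_) n <;> rw [pairCount_one hL]
    · simp only [cls]; split_ifs <;> simp_all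
    · split_ifs <;> simp_all
  have c2 : coef (cls (fun _ => True) (· = 1) fun _ => True) n = E 2 n + B := by
    refine coef_add (fun L hL => ?_) (fun L hL => ?_) n <;> rw [pairCount_one hL]
    · simp only [cls]; split_ifs <;> simp_all
    · split_ifs <;> simp_all
  have c3 : E 1 n = A + B := by
    refine coef_add (fun L hL => ?_) (fun L hL => ?_) n
    · rw [pairCount_one hL]; split_ifs <;> simp_all
    · tauto
  have c4 : coef (fun L => pairCount 1 (0 :: L) ≠ 0) n = E 1 n + E 2 n := by
    refine coef_add (fun L hL => ?_) (fun L hL => ?_) n <;> rw [pairCount_one hL]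
    · split_ifs <;> simp
    · split_ifs <;> simp
  have c5 : coef (fun _ => True) n = E 0 n + coef (fun L => pairCount 1 (0 :: L) ≠ 0) n := by
    exact coef_add (fun L _ => by simp only [true_iff]; exact em _) (fun L _ => by tauto) n
  have hB : (n.centralBinom : ℝ) ≠ 0 := by exact_mod_cast n.centralBinom_ne_zero
  have htot : 2 * n * (coef (fun _ => True) n).toReal / n.centralBinom = 1 := by
    have := congrArg ENNReal.toReal (centralBinom_eq_coef hn)
    rw [ENNReal.toReal_natCast, ENNReal.toReal_mul, ENNReal.toReal_mul, ENNReal.toReal_natCast,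
      ENNReal.toReal_ofNat] at this
    rw [← this, div_self hB]
  rw [c4] at c5
  have hA : A ≠ ⊤ := coef_ne_top _ n
  have hB' : B ≠ ⊤ := coef_ne_top _ n
  have hEt : ∀ k, E k n ≠ ⊤ := fun k => coef_ne_top _ n
  rw [c1, ENNReal.toReal_add (hEt 2) hA] at h1
  rw [c2, ENNReal.toReal_add (hEt 2) hB'] at h2
  rw [c5, ENNReal.toReal_add (hEt 0) (by simp [hEt]), ENNReal.toReal_add (hEt 1) (hEt 2)] at htot
  have c6 := congrArg ENNReal.toReal c3
  rw [ENNReal.toReal_add hA hB'] at c6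
  have e1 : 2 * n * (E 1 n).toReal / n.centralBinom
      = 2 * n / (2 * n - 1) - 2 * (2 * n * (E 2 n).toReal / n.centralBinom) := by
    rw [c6]
    linear_combination h1 + h2
  refine ⟨e1, ?_⟩
  linear_combination htot - e1

lemma abs_two_mul_div_sub_le {n : ℕ} (hn : 1 ≤ n) :
    |2 * n / (2 * n - 1) - (1 + 1 / (2 * (n : ℝ)) + 1 / (4 * (n : ℝ) ^ 2) + 1 / (8 * (n : ℝ) ^ 3)
      + 1 / (16 * (n : ℝ) ^ 4))| ≤ 1 / (n : ℝ) ^ 5 := by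
  have hn' : (1 : ℝ) ≤ n := by exact_mod_cast hn
  have h1 : (2 * n - 1 : ℝ) ≠ 0 := by linarith
  have h0 : (n : ℝ) ≠ 0 := by linarith
  have e : 2 * n / (2 * n - 1) - (1 + 1 / (2 * (n : ℝ)) + 1 / (4 * (n : ℝ) ^ 2)
      + 1 / (8 * (n : ℝ) ^ 3) + 1 / (16 * (n : ℝ) ^ 4)) = 1 / 16 / (n ^ 4 * (2 * n - 1)) := by
    field_simp
    ring
  have h2 : (n : ℝ) ^ 5 ≤ n ^ 4 * (2 * n - 1) := by
    rw [pow_succ]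
    gcongr
    linarith
  have hpos : 0 < 2 * (n : ℝ) - 1 := by linarith
  rw [e, abs_of_nonneg (by positivity)]
  have h3 : (0 : ℝ) < (n : ℝ) ^ 5 := by positivity
  gcongr
  norm_num

theorem exists_prob_multRange_one_one : ∃ C : ℝ, ∃ N : ℕ, ∀ n, N ≤ n →
    |prob n (fun s => multRange 1 s = 1)
      - (1 / 2 - 5 / (24 * (n : ℝ) ^ 2) - 11 / (36 * (n : ℝ) ^ 3)
          - 511 / (1440 * (n : ℝ) ^ 4))| ≤ C / (n : ℝ) ^ 5 := by
  obtain ⟨C, N, h⟩ := exists_prob_multRange_one_two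
  refine ⟨1 + 2 * C, max N 1, fun n hn => ?_⟩
  have hn1 : 1 ≤ n := le_of_max_le_right hn
  have h1 := h n (le_of_max_le_left hn)
  have h2 := abs_two_mul_div_sub_le hn1
  have h0 : (n : ℝ) ≠ 0 := by positivity
  rw [(prob_multRange_one hn1).1, add_div, mul_div_assoc 2 C]
  rw [abs_le] at *
  have e : 2 * n / (2 * n - 1) - 2 * prob n (fun s => multRange 1 s = 2)
      - (1 / 2 - 5 / (24 * (n : ℝ) ^ 2) - 11 / (36 * (n : ℝ) ^ 3) - 511 / (1440 * (n : ℝ) ^ 4))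
      = (2 * n / (2 * n - 1) - (1 + 1 / (2 * (n : ℝ)) + 1 / (4 * (n : ℝ) ^ 2)
        + 1 / (8 * (n : ℝ) ^ 3) + 1 / (16 * (n : ℝ) ^ 4)))
      - 2 * (prob n (fun s => multRange 1 s = 2)
      - (1 / 4 + 1 / (4 * (n : ℝ)) + 11 / (48 * (n : ℝ) ^ 2) + 31 / (144 * (n : ℝ) ^ 3)
          + 601 / (2880 * (n : ℝ) ^ 4))) := by
    generalize prob n (fun s => multRange 1 s = 2) = p
    generalize 2 * (n : ℝ) / (2 * n - 1) = q
    field_simp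
    ring
  rw [e]
  constructor <;> linarith

theorem exists_prob_multRange_one_zero : ∃ C : ℝ, ∃ N : ℕ, ∀ n, N ≤ n →
    |prob n (fun s => multRange 1 s = 0)
      - (1 / 4 - 1 / (4 * (n : ℝ)) - 1 / (48 * (n : ℝ) ^ 2) + 13 / (144 * (n : ℝ) ^ 3)
            + 421 / (2880 * (n : ℝ) ^ 4))| ≤ C / (n : ℝ) ^ 5 := by
  obtain ⟨C, N, h⟩ := exists_prob_multRange_one_two
  refine ⟨1 + C, max N 1, fun n hn => ?_⟩
  have hn1 : 1 ≤ n := le_of_max_le_right hn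
  have h1 := h n (le_of_max_le_left hn)
  have h2 := abs_two_mul_div_sub_le hn1
  have h0 : (n : ℝ) ≠ 0 := by positivity
  rw [(prob_multRange_one hn1).2, add_div]
  rw [abs_le] at *
  have e : 1 - 2 * n / (2 * n - 1) + prob n (fun s => multRange 1 s = 2)
      - (1 / 4 - 1 / (4 * (n : ℝ)) - 1 / (48 * (n : ℝ) ^ 2) + 13 / (144 * (n : ℝ) ^ 3)
            + 421 / (2880 * (n : ℝ) ^ 4))
      = (prob n (fun s => multRange 1 s = 2)
      - (1 / 4 + 1 / (4 * (n : ℝ)) + 11 / (48 * (n : ℝ) ^ 2) + 31 / (144 * (n : ℝ) ^ 3)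
          + 601 / (2880 * (n : ℝ) ^ 4)))
      - (2 * n / (2 * n - 1) - (1 + 1 / (2 * (n : ℝ)) + 1 / (4 * (n : ℝ) ^ 2)
        + 1 / (8 * (n : ℝ) ^ 3) + 1 / (16 * (n : ℝ) ^ 4))) := by
    generalize prob n (fun s => multRange 1 s = 2) = p
    generalize 2 * (n : ℝ) / (2 * n - 1) = q
    field_simp
    ring
  rw [e]
  constructor <;> linarith

end SimpleWalk

namespace SimpleWalk

/-! ### Expansions to second order in `√w` at the vertex of the sector -/

/-- `f = a + b √w + O(w)`, with an expansion that continues to the second order. -/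
def HasExp (f : ℂ → ℂ) (a b : ℂ) : Prop :=
  ∃ c : ℂ, (fun w => f w - (a + b * sqrtC w + c * sqrtC w ^ 2))
    =O[nhdsWithin 0 sector] fun w => sqrtC w ^ 3

lemma tendsto_sqrtC : Tendsto sqrtC (nhdsWithin 0 sector) (nhds 0) := by
  rw [tendsto_zero_iff_norm_tendsto_zero]
  have h : ∀ w, ‖sqrtC w‖ = ‖w‖ ^ (1 / 2 : ℝ) := fun w => by
    have := norm_sqrtC_pow w 1
    simpa using this
  simp only [h]
  have h1 : ContinuousAt (fun w : ℂ => ‖w‖ ^ (1 / 2 : ℝ)) 0 :=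
    continuousAt_id.norm.rpow_const (Or.inr (by norm_num))
  have h2 := h1.tendsto
  simp only [norm_zero] at h2
  rw [Real.zero_rpow (by norm_num)] at h2
  exact h2.mono_left nhdsWithin_le_nhds

lemma isBigO_quadratic (a b c : ℂ) :
    (fun w => a + b * sqrtC w + c * sqrtC w ^ 2) =O[nhdsWithin 0 sector] fun _ => (1 : ℂ) := by
  have h : Tendsto (fun w => a + b * sqrtC w + c * sqrtC w ^ 2) (nhdsWithin 0 sector)
      (nhds (a + b * 0 + c * 0 ^ 2)) :=
    (tendsto_const_nhds.add (tendsto_sqrtC.const_mul b)).add ((tendsto_sqrtC.pow 2).const_mul c)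
  exact h.isBigO_one ℂ

lemma HasExp.tendsto {f : ℂ → ℂ} {a b : ℂ} (h : HasExp f a b) :
    Tendsto f (nhdsWithin 0 sector) (nhds a) := by
  obtain ⟨c, hc⟩ := h
  have h1 : Tendsto (fun w => a + b * sqrtC w + c * sqrtC w ^ 2) (nhdsWithin 0 sector)
      (nhds (a + b * 0 + c * 0 ^ 2)) :=
    (tendsto_const_nhds.add (tendsto_sqrtC.const_mul b)).add ((tendsto_sqrtC.pow 2).const_mul c)
  have h2 : Tendsto (fun w => sqrtC w ^ 3) (nhdsWithin 0 sector) (nhds 0) := by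
    simpa using tendsto_sqrtC.pow 3
  have h3 := (hc.trans_tendsto h2).add h1
  simpa using h3

lemma HasExp.isBigO_one {f : ℂ → ℂ} {a b : ℂ} (h : HasExp f a b) :
    f =O[nhdsWithin 0 sector] fun _ => (1 : ℂ) := h.tendsto.isBigO_one ℂ

lemma HasExp.congr_isBigO {f g : ℂ → ℂ} {a b : ℂ} (h : HasExp f a b)
    (hg : (fun w => g w - f w) =O[nhdsWithin 0 sector] fun w => sqrtC w ^ 3) : HasExp g a b := by
  obtain ⟨c, hc⟩ := h
  refine ⟨c, (hg.add hc).congr_left fun w => ?_⟩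
  ring

lemma HasExp.add {f g : ℂ → ℂ} {a b a' b' : ℂ} (hf : HasExp f a b) (hg : HasExp g a' b') :
    HasExp (fun w => f w + g w) (a + a') (b + b') := by
  obtain ⟨c, hc⟩ := hf
  obtain ⟨c', hc'⟩ := hg
  refine ⟨c + c', (hc.add hc').congr_left fun w => ?_⟩
  ring

lemma HasExp.mul {f g : ℂ → ℂ} {a b a' b' : ℂ} (hf : HasExp f a b) (hg : HasExp g a' b') :
    HasExp (fun w => f w * g w) (a * a') (a * b' + b * a') := by
  have hf1 := hf.isBigO_one
  obtain ⟨c, hc⟩ := hf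
  obtain ⟨c', hc'⟩ := hg
  refine ⟨a * c' + b * b' + c * a', ?_⟩
  have h1 := hf1.mul hc'
  have h2 := hc.mul (isBigO_quadratic a' b' c')
  have h3 := (isBigO_refl (fun w => sqrtC w ^ 3) (nhdsWithin 0 sector)).mul
    (isBigO_quadratic (b * c' + c * b') (c * c') 0)
  simp only [one_mul, mul_one] at h1 h2 h3
  refine ((h1.add h2).add h3).congr_left fun w => ?_
  ring

lemma hasExp_const (a : ℂ) : HasExp (fun _ => a) a 0 :=
  ⟨0, (isBigO_zero _ _).congr_left fun w => by ring⟩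

lemma hasExp_sqrtC : HasExp sqrtC 0 1 :=
  ⟨0, (isBigO_zero _ _).congr_left fun w => by ring⟩

lemma hasExp_id : HasExp (fun w => w) 0 0 :=
  ⟨1, (isBigO_zero _ _).congr_left fun w => by rw [sqrtC_sq]; ring⟩

lemma HasExp.const_mul {f : ℂ → ℂ} {a b : ℂ} (h : HasExp f a b) (x : ℂ) :
    HasExp (fun w => x * f w) (x * a) (x * b) := by
  have := (hasExp_const x).mul h
  rwa [zero_mul, add_zero] at this

lemma HasExp.sub {f g : ℂ → ℂ} {a b a' b' : ℂ} (hf : HasExp f a b) (hg : HasExp g a' b') :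
    HasExp (fun w => f w - g w) (a - a') (b - b') := by
  have := hf.add (hg.const_mul (-1))
  simpa [sub_eq_add_neg] using this

lemma HasExp.pow {f : ℂ → ℂ} {a b : ℂ} (h : HasExp f a b) (n : ℕ) :
    HasExp (fun w => f w ^ n) (a ^ n) (n * a ^ (n - 1) * b) := by
  induction n with
  | zero => simpa using hasExp_const 1
  | succ n ih =>
    have := ih.mul h
    simp only [pow_succ] at this ⊢
    convert! this using 1
    rcases n with _ | n
    · simp
    · simp only [Nat.add_sub_cancel, pow_succ]
      push_cast
      ring

lemma HasExp.inv {f : ℂ → ℂ} {a b : ℂ} (h : HasExp f a b) (ha : a ≠ 0) :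
    HasExp (fun w => (f w)⁻¹) a⁻¹ (-b / a ^ 2) := by
  have ht := h.tendsto
  have hinv : (fun w => (f w)⁻¹) =O[nhdsWithin 0 sector] fun _ => (1 : ℂ) :=
    (ht.inv₀ ha).isBigO_one ℂ
  have hne : ∀ᶠ w in nhdsWithin 0 sector, f w ≠ 0 := ht.eventually_ne ha
  obtain ⟨c, hc⟩ := h
  -- The second coefficient of the reciprocal of `a + b s + c s²`.
  set c' := b ^ 2 / a ^ 3 - c / a ^ 2 with hc'
  refine ⟨c', ?_⟩
  have h1 := hc.mul (isBigO_quadratic a⁻¹ (-b / a ^ 2) c')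
  have h2 := (isBigO_refl (fun w => sqrtC w ^ 3) (nhdsWithin 0 sector)).mul
    (isBigO_quadratic (b * c' + c * (-b / a ^ 2)) (c * c') 0)
  have h3 := hinv.mul (h1.add h2).neg_left
  simp only [mul_one, one_mul] at h3
  refine h3.congr' ?_ EventuallyEq.rfl
  filter_upwards [hne] with w hw
  rw [hc']
  field_simp
  ring

/-! ### The generating functions at the vertex -/

lemma hasExp_oneAny : HasExp oneAny (1 / 2) (-1 / 2) := by
  have := ((hasExp_const 1).sub hasExp_sqrtC).const_mul (1 / 2)
  convert! this using 1
  · funext w; rw [oneAny]; ring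
  · ring
  · ring

/-- Since `l = 2 √w / t` is `1 + O(w)`, the only terms linear in `√w` come from `-√w l / 4`; the
`σ₂` series contributes the constant `ζ(3) / 4`. -/
lemma hasExp_oneOne_oneTwo : HasExp oneOne (Real.pi ^ 2 / 24) (-1 / 4) ∧
    HasExp oneTwo ((Real.pi ^ 2 / 24 - zeta3 / 4) / 2) (-1 / 8) := by
  obtain ⟨C, hC, h⟩ := exists_expansion
  have hev : ∀ᶠ w in nhdsWithin 0 sector, w ∈ sector ∧ ‖w‖ ≤ 1 / 16 := by
    filter_upwards [self_mem_nhdsWithin,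
      nhdsWithin_le_nhds (Metric.closedBall_mem_nhds (0 : ℂ) (by norm_num : (0 : ℝ) < 1 / 16))]
      with w h1 h2
    exact ⟨h1, mem_closedBall_zero_iff.1 h2⟩
  choose! l hl using h
  have hpow : ∀ m : ℕ, 3 ≤ m → ∀ w : ℂ, ‖w‖ ≤ 1 / 16 → ‖sqrtC w‖ ^ m ≤ ‖sqrtC w ^ 3‖ := by
    intro m hm w hw
    rw [norm_pow]
    refine pow_le_pow_of_le_one (norm_nonneg _) ?_ hm
    have := norm_sqrtC_sq w
    nlinarith [norm_nonneg (sqrtC w)]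
  have hp : HasExp recipPoly 1 0 := by
    have h3 := (isBigO_refl (fun w => sqrtC w ^ 3) (nhdsWithin 0 sector)).mul
      ((hasExp_id.const_mul (-44 / 945)).add (((hasExp_id.pow 2).const_mul (-428 / 14175)).add
        ((hasExp_id.pow 3).const_mul (-10196 / 467775))) |>.add (hasExp_const (-4 / 45))
        |>.mul hasExp_sqrtC).isBigO_one
    simp only [mul_one] at h3
    refine ⟨-1 / 3, h3.congr_left fun w => ?_⟩
    rw [show sqrtC w ^ 3 * (((-44 / 945 * w + (-428 / 14175 * w ^ 2 + -10196 / 467775 * w ^ 3))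
      + -4 / 45) * sqrtC w) = (sqrtC w ^ 2) ^ 2 * ((-44 / 945 * w
      + (-428 / 14175 * w ^ 2 + -10196 / 467775 * w ^ 3)) + -4 / 45) by ring, sqrtC_sq, recipPoly]
    ring
  have hle : HasExp l 1 0 := by
    refine hp.congr_isBigO (IsBigO.of_bound C ?_)
    filter_upwards [hev] with w hw
    have h1 := (hl w hw.1 hw.2).2.1
    rw [← norm_sqrtC_sq w, ← pow_mul] at h1
    exact h1.trans (mul_le_mul_of_nonneg_left (hpow _ (by norm_num) w hw.2) hC)
  have hA : HasExp oneOne (Real.pi ^ 2 / 24) (-1 / 4) := by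
    have h1 : HasExp (fun w => w / 24 + Real.pi ^ 2 / 24 * l w ^ 2 - sqrtC w / 4 * l w)
        (Real.pi ^ 2 / 24) (-1 / 4) := by
      have := ((hasExp_id.const_mul (1 / 24)).add ((hle.pow 2).const_mul (Real.pi ^ 2 / 24))).sub
        ((hasExp_sqrtC.const_mul (1 / 4)).mul hle)
      convert! this using 1
      · funext w; ring
      · ring
      · push_cast; ring
    refine h1.congr_isBigO (IsBigO.of_bound C ?_)
    filter_upwards [hev] with w hw
    exact (hl w hw.1 hw.2).2.2.1.trans
      (mul_le_mul_of_nonneg_left (hpow _ (by norm_num) w hw.2) hC)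
  refine ⟨hA, ?_⟩
  have hQ : HasExp (fun w => sqrtC w ^ 3 * lambertQ (nome w)) (zeta3 / 4) 0 := by
    have h1 : HasExp (fun w => zeta3 / 4 * l w ^ 3 - w / 24 * l w) (zeta3 / 4) 0 := by
      have := ((hle.pow 3).const_mul (zeta3 / 4)).sub ((hasExp_id.const_mul (1 / 24)).mul hle)
      convert! this using 1
      · funext w; ring
      · ring
      · ring
    refine h1.congr_isBigO (IsBigO.of_bound C ?_)
    filter_upwards [hev] with w hw
    rw [norm_pow]
    exact (hl w hw.1 hw.2).2.2.2
  have := (hA.sub hQ).const_mul (1 / 2)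
  convert! this using 1
  · funext w; rw [oneTwo, oneOne]; ring
  · ring
  · ring

end SimpleWalk

namespace SimpleWalk

/-! ### The size of `oneOne` near the unit disc -/

lemma ball_subset_discNbhd {δ : ℝ} (hδ : 0 < δ) : Metric.ball (1 : ℂ) 1 ⊆ discNbhd δ := by
  intro w hw
  have hw' : ‖w - 1‖ < 1 := mem_ball_iff_norm.1 hw
  have hpos : 0 < ‖w‖ := norm_pos_iff.2 (ne_zero_of_norm_sub_one_lt hw')
  refine ⟨w, hw', ?_⟩
  rw [sub_self, norm_zero]
  positivity

lemma one_sub_four_mul_mem_ball {z : ℂ} (hz : ‖z‖ < 1 / 4) :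
    1 - 4 * z ∈ Metric.ball (1 : ℂ) 1 := mem_ball_iff_norm.2 (norm_four_mul_lt hz)

lemma ball_subset_sector : Metric.ball (1 : ℂ) 1 ⊆ sector :=
  (ball_subset_discNbhd (by norm_num : (0 : ℝ) < 1 / 3)).trans (discNbhd_subset_sector le_rfl)

/-- The coefficients are nonnegative, so the modulus at `z` is at most the value at any larger real
`r`, and `r → 1/4` gives the limit at the vertex. -/
lemma norm_oneOne_le_of_mem_ball {w : ℂ} (hw : w ∈ Metric.ball (1 : ℂ) 1) :
    ‖oneOne w‖ ≤ Real.pi ^ 2 / 24 := by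
  obtain ⟨z, rfl⟩ : ∃ z, w = 1 - 4 * z := ⟨(1 - w) / 4, by ring⟩
  have hz : ‖z‖ < 1 / 4 := by
    have := mem_ball_iff_norm.1 hw
    rw [sub_sub_cancel_left, norm_neg, norm_mul, Complex.norm_ofNat] at this
    linarith
  set A : ℕ → ℝ := fun n => (coef (cls (· = 1) (· = 1) fun _ => True) n).toReal with hA
  have hA0 : ∀ n, 0 ≤ A n := fun n => ENNReal.toReal_nonneg
  have hle : ∀ r : ℝ, ‖z‖ < r → r < 1 / 4 → ‖oneOne (1 - 4 * z)‖ ≤ ‖oneOne (1 - 4 * (r : ℂ))‖ := by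
    intro r hr hr4
    have hr0 : 0 ≤ r := (norm_nonneg z).trans hr.le
    have hrn : ‖(r : ℂ)‖ < 1 / 4 := by rwa [Complex.norm_real, Real.norm_of_nonneg hr0]
    have h1 := hasSum_coef_one_one hz
    have h2 := hasSum_coef_one_one hrn
    have h3 : Summable fun n => A n * r ^ n := by
      have := h2.summable
      exact_mod_cast this
    have h4 : oneOne (1 - 4 * (r : ℂ)) = ((∑' n, A n * r ^ n : ℝ) : ℂ) := by
      rw [← h2.tsum_eq]
      push_cast
      rfl
    rw [h4, Complex.norm_real, Real.norm_of_nonneg (tsum_nonneg fun n => by have := hA0 n; positivity),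
      ← h1.tsum_eq]
    refine tsum_of_norm_bounded h3.hasSum fun n => ?_
    rw [norm_mul, norm_pow, Complex.norm_real, Real.norm_of_nonneg (hA0 n)]
    have := hA0 n
    gcongr
  have hmem : ∀ᶠ r : ℝ in nhdsWithin (1 / 4) (Set.Iio (1 / 4)), ‖z‖ < r ∧ r < 1 / 4 := by
    filter_upwards [self_mem_nhdsWithin, nhdsWithin_le_nhds (Ioi_mem_nhds hz)] with r h1 h2
    exact ⟨h2, h1⟩
  have hlim : Tendsto (fun r : ℝ => 1 - 4 * (r : ℂ)) (nhdsWithin (1 / 4) (Set.Iio (1 / 4)))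
      (nhdsWithin 0 sector) := by
    refine tendsto_nhdsWithin_iff.2 ⟨?_, ?_⟩
    · have h1 : ContinuousAt (fun r : ℝ => 1 - 4 * (r : ℂ)) (1 / 4) := by fun_prop
      have h2 := h1.tendsto
      rw [show (1 - 4 * (((1 / 4 : ℝ)) : ℂ)) = 0 by push_cast; norm_num] at h2
      exact h2.mono_left nhdsWithin_le_nhds
    · filter_upwards [hmem] with r hr
      refine ball_subset_sector (one_sub_four_mul_mem_ball ?_)
      rw [Complex.norm_real, Real.norm_of_nonneg ((norm_nonneg z).trans hr.1.le)]
      exact hr.2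
  have ht := ((hasExp_oneOne_oneTwo.1.tendsto).comp hlim).norm
  have hn : ‖((Real.pi : ℂ) ^ 2 / 24)‖ = Real.pi ^ 2 / 24 := by
    rw [norm_div, norm_pow, Complex.norm_real, Real.norm_of_nonneg Real.pi_pos.le,
      Complex.norm_ofNat]
  rw [hn] at ht
  have hbot : (nhdsWithin (1 / 4 : ℝ) (Set.Iio (1 / 4))).NeBot := inferInstance
  refine ge_of_tendsto ht ?_
  filter_upwards [hmem] with r hr
  exact hle r hr.1 hr.2

lemma pi_sq_div_lt : Real.pi ^ 2 / 24 < 21 / 50 := by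
  have := Real.pi_lt_d2
  nlinarith [Real.pi_pos]

/-- On a neighbourhood of the disc the function `oneOne` is bounded by `9 / 20`. -/
theorem exists_norm_oneOne_le : ∃ δ : ℝ, 0 < δ ∧ δ ≤ 1 / 3 ∧
    ∀ w ∈ discNbhd δ, ‖oneOne w‖ ≤ 9 / 20 := by
  have hev : ∀ᶠ w in nhdsWithin 0 sector, ‖oneOne w‖ < 9 / 20 := by
    have ht := hasExp_oneOne_oneTwo.1.tendsto.norm
    refine ht.eventually_lt_const ?_
    rw [norm_div, norm_pow, Complex.norm_real, Real.norm_of_nonneg Real.pi_pos.le,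
      Complex.norm_ofNat]
    have := pi_sq_div_lt
    linarith
  obtain ⟨ε, hε, hnear⟩ := Metric.mem_nhdsWithin_iff.1 hev
  -- Near the vertex the limit `π² / 24` is used. Away from it, uniform continuity on the compact
  -- set `K` compares `w` with its centre `w₀` in the disc, and `21/50 + 3/100 = 9/20`.
  set K : Set ℂ := {w : ℂ | ε / 2 ≤ ‖w‖ ∧ -‖w‖ / 2 ≤ w.re ∧ ‖w‖ ≤ 3} with hK
  have hKc : IsCompact K := by
    have h1 : IsClosed {w : ℂ | ε / 2 ≤ ‖w‖} := isClosed_le (by fun_prop) (by fun_prop)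
    have h2 : IsClosed {w : ℂ | -‖w‖ / 2 ≤ w.re} := isClosed_le (by fun_prop) (by fun_prop)
    have h3 : IsClosed {w : ℂ | ‖w‖ ≤ 3} := isClosed_le (by fun_prop) (by fun_prop)
    exact (isCompact_closedBall (0 : ℂ) 3).of_isClosed_subset (h1.inter (h2.inter h3))
      fun w hw => mem_closedBall_zero_iff.2 hw.2.2
  have hKs : K ⊆ Complex.slitPlane := fun w hw => sector_subset_slitPlane
    ⟨norm_pos_iff.1 (lt_of_lt_of_le (by positivity) hw.1), hw.2⟩
  have hcont : ContinuousOn oneOne K := fun w hw =>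
    (differentiableAt_oneOne (hKs hw)).continuousAt.continuousWithinAt
  obtain ⟨η, hη, huc⟩ := Metric.uniformContinuousOn_iff.1
    (hKc.uniformContinuousOn_of_continuous hcont) (3 / 100) (by norm_num)
  refine ⟨min (1 / 3) (η / 2), by positivity, min_le_left _ _, fun w hw => ?_⟩
  have hws : w ∈ sector := discNbhd_subset_sector (min_le_left _ _) hw
  rcases lt_or_ge ‖w‖ ε with h | h
  · exact le_of_lt (hnear ⟨mem_ball_zero_iff.2 h, hws⟩)
  obtain ⟨w₀, h0, h1⟩ := hw
  have hw0b : w₀ ∈ Metric.ball (1 : ℂ) 1 := mem_ball_iff_norm.2 h0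
  have hw0s := ball_subset_sector hw0b
  have hw0pos : 0 < ‖w₀‖ := norm_pos_iff.2 hw0s.1
  have hw02 : ‖w₀‖ ≤ 2 := by
    have := norm_add_le (w₀ - 1) 1
    rw [sub_add_cancel, norm_one] at this
    linarith
  have hd1 : ‖w - w₀‖ < 1 / 3 * ‖w₀‖ :=
    h1.trans_le (mul_le_mul_of_nonneg_right (min_le_left _ _) hw0pos.le)
  have hd2 : ‖w - w₀‖ < η := by
    have h2 : min (1 / 3) (η / 2) * ‖w₀‖ ≤ η / 2 * 2 :=
      mul_le_mul (min_le_right _ _) hw02 hw0pos.le (by positivity)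
    linarith
  have hw0low : ε / 2 ≤ ‖w₀‖ := by
    have := norm_add_le w₀ (w - w₀)
    rw [add_sub_cancel] at this
    linarith
  have h3 := huc w ⟨by linarith, hws.2⟩ w₀ ⟨hw0low, hw0s.2⟩ (by rwa [dist_eq_norm])
  rw [dist_eq_norm] at h3
  have h4 := norm_oneOne_le_of_mem_ball hw0b
  have h5 := norm_add_le (oneOne w - oneOne w₀) (oneOne w₀)
  rw [sub_add_cancel] at h5
  have := pi_sq_div_lt
  linarith

/-! ### The expansion of the generating functions `doubleGF` -/

noncomputable def ratio (w : ℂ) : ℂ := oneOne w / (1 + oneOne w)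

noncomputable def weight (w : ℂ) : ℂ :=
  ((oneAny w * oneOne w + oneTwo w) / (1 + oneOne w) ^ 2) ^ 2

lemma doubleGF_eq (k : ℕ) (w : ℂ) : doubleGF k w = ratio w ^ k * weight w := rfl

/-- At the vertex `ratio = alpha + ratioSlope * √w + …` and `weight = weightRoot ^ 2 + weightSlope *
√w + …`. -/
noncomputable def ratioSlope : ℝ := -(1 / 4) / (1 + Real.pi ^ 2 / 24) ^ 2

noncomputable def weightRoot : ℝ := (Real.pi ^ 2 / 24 - zeta3 / 8) / (1 + Real.pi ^ 2 / 24) ^ 2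

noncomputable def weightSlope : ℝ :=
  2 * weightRoot * ((-(Real.pi ^ 2 / 48) - 1 / 4) / (1 + Real.pi ^ 2 / 24) ^ 2
    + (Real.pi ^ 2 / 24 - zeta3 / 8) / (2 * (1 + Real.pi ^ 2 / 24) ^ 3))

lemma one_add_pi_sq_ne_zero : (1 + (Real.pi : ℂ) ^ 2 / 24) ≠ 0 := by
  have : (1 + Real.pi ^ 2 / 24 : ℝ) ≠ 0 := by positivity
  exact_mod_cast this

lemma hasExp_inv : HasExp (fun w => (1 + oneOne w)⁻¹) (1 + (Real.pi : ℂ) ^ 2 / 24)⁻¹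
    (1 / 4 / (1 + (Real.pi : ℂ) ^ 2 / 24) ^ 2) := by
  have := ((hasExp_const 1).add hasExp_oneOne_oneTwo.1).inv one_add_pi_sq_ne_zero
  convert! this using 1
  ring

lemma hasExp_ratio : HasExp ratio (alpha : ℂ) (ratioSlope : ℂ) := by
  have hne := one_add_pi_sq_ne_zero
  have hne' : (24 + (Real.pi : ℂ) ^ 2) ≠ 0 := by
    have : (24 + Real.pi ^ 2 : ℝ) ≠ 0 := by positivity
    exact_mod_cast this
  have := hasExp_oneOne_oneTwo.1.mul hasExp_inv
  convert! this using 1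
  · rw [alpha]; push_cast; field_simp
  · rw [ratioSlope]; push_cast; field_simp; ring

lemma hasExp_weight : HasExp weight ((weightRoot ^ 2 : ℝ) : ℂ) (weightSlope : ℂ) := by
  have hne := one_add_pi_sq_ne_zero
  have := (((hasExp_oneAny.mul hasExp_oneOne_oneTwo.1).add hasExp_oneOne_oneTwo.2).mul
    (hasExp_inv.pow 2)).pow 2
  convert! this using 1
  · funext w; rw [weight, div_eq_mul_inv, inv_pow]
  · rw [weightRoot]; push_cast; field_simp; ring
  · rw [weightSlope, weightRoot]; push_cast; field_simp; ring

/-- The second coefficient of the expansion of `doubleGF k`. -/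
lemma slope_eq (k : ℕ) :
    -(alpha ^ k * (weightSlope + k * (ratioSlope / alpha * weightRoot ^ 2)))
      = alpha ^ (k + 3) * (theta0 + ((k + 3 : ℕ) : ℝ) * theta1) := by
  have hpi := Real.pi_ne_zero
  have hne : (1 + Real.pi ^ 2 / 24 : ℝ) ≠ 0 := by positivity
  have hne' : (24 + Real.pi ^ 2 : ℝ) ≠ 0 := by positivity
  have key : -(weightSlope + k * (ratioSlope / alpha * weightRoot ^ 2))
      = alpha ^ 3 * (theta0 + (k + 3) * theta1) := by
    rw [weightSlope, ratioSlope, weightRoot, alpha, theta0, theta1]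
    have hz : Real.pi ^ 2 / 24 - zeta3 / 8 = (Real.pi ^ 2 / 3 - zeta3) / 8 := by ring
    rw [hz]
    -- `theta0` contains a division by this number. If it were zero, the squares in front would
    -- annihilate both sides, so no numerical bound for `ζ(3)` is needed.
    by_cases h0 : Real.pi ^ 2 / 3 - zeta3 = 0
    · rw [h0]; simp
    · generalize Real.pi ^ 2 / 3 - zeta3 = Z at h0 ⊢
      field_simp
      ring
  rw [pow_add, mul_assoc]
  push_cast
  rw [← key]
  ring

end SimpleWalk

namespace SimpleWalk

/-! ### Uniform bounds for the expansion of `doubleGF` -/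

lemma exists_bound_of_isBigO {f : ℂ → ℂ} {U : Set ℂ} (hU : U ⊆ sector) (m : ℕ)
    (h : f =O[nhdsWithin 0 sector] fun w => sqrtC w ^ m) {M : ℝ} (hM : ∀ w ∈ U, ‖f w‖ ≤ M) :
    ∃ C : ℝ, 0 ≤ C ∧ ∀ w ∈ U, ‖f w‖ ≤ C * ‖sqrtC w‖ ^ m := by
  obtain ⟨c, hc⟩ := h.bound
  obtain ⟨ε, hε, hnear⟩ := Metric.mem_nhdsWithin_iff.1 hc
  refine ⟨|c| + |M| / ε ^ ((m : ℝ) / 2), by positivity, fun w hw => ?_⟩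
  have hM' := (hM w hw).trans (le_abs_self M)
  rw [add_mul]
  rcases lt_or_ge ‖w‖ ε with h1 | h1
  · have h2 : ‖f w‖ ≤ c * ‖sqrtC w ^ m‖ := hnear ⟨mem_ball_zero_iff.2 h1, hU hw⟩
    rw [norm_pow] at h2
    have h3 : c * ‖sqrtC w‖ ^ m ≤ |c| * ‖sqrtC w‖ ^ m := by
      gcongr
      exact le_abs_self c
    have h4 : 0 ≤ |M| / ε ^ ((m : ℝ) / 2) * ‖sqrtC w‖ ^ m := by positivity
    linarith
  · have h2 : ε ^ ((m : ℝ) / 2) ≤ ‖sqrtC w‖ ^ m := by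
      rw [norm_sqrtC_pow]
      gcongr
    have h3 : |M| ≤ |M| / ε ^ ((m : ℝ) / 2) * ‖sqrtC w‖ ^ m := by
      rw [div_mul_eq_mul_div, le_div_iff₀ (by positivity)]
      gcongr
    have h4 : 0 ≤ |c| * ‖sqrtC w‖ ^ m := by positivity
    linarith

lemma exists_bound_sector {f : ℂ → ℂ} (hf : ContinuousOn f Complex.slitPlane)
    (h : f =O[nhdsWithin 0 sector] fun _ => (1 : ℂ)) :
    ∃ M : ℝ, 0 ≤ M ∧ ∀ w ∈ sector, ‖f w‖ ≤ M := by
  obtain ⟨c, hc⟩ := h.bound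
  obtain ⟨ε, hε, hnear⟩ := Metric.mem_nhdsWithin_iff.1 hc
  obtain ⟨M, hM0, hM⟩ := exists_bound_of_continuousOn_slitPlane hf hε
  refine ⟨|c| + M, by positivity, fun w hw => ?_⟩
  rcases lt_or_ge ‖w‖ ε with h1 | h1
  · have h2 : ‖f w‖ ≤ c * ‖(1 : ℂ)‖ := hnear ⟨mem_ball_zero_iff.2 h1, hw⟩
    rw [norm_one, mul_one] at h2
    linarith [le_abs_self c]
  · linarith [hM w hw h1, abs_nonneg c]

/-- Taylor expansion of a power to second order, with an error that is uniform in the exponent. -/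
lemma norm_pow_sub_le {a α y : ℂ} {ρ : ℝ} (ha : ‖a‖ ≤ ρ) (hα : ‖α‖ ≤ ρ) (hy : a = α * (1 + y))
    (k : ℕ) :
    ‖a ^ k - α ^ k * (1 + k * y + ((k * (k - 1) / 2 : ℝ) : ℂ) * y ^ 2)‖
      ≤ (k : ℝ) ^ 3 * ρ ^ k * ‖y‖ ^ 3 := by
  have hρ : 0 ≤ ρ := (norm_nonneg _).trans ha
  induction k with
  | zero => simp
  | succ k ih =>
    have e : a ^ (k + 1) - α ^ (k + 1) * (1 + (k + 1 : ℕ) * y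
          + (((k + 1 : ℕ) * ((k + 1 : ℕ) - 1) / 2 : ℝ) : ℂ) * y ^ 2)
        = a * (a ^ k - α ^ k * (1 + k * y + ((k * (k - 1) / 2 : ℝ) : ℂ) * y ^ 2))
          + ((k * (k - 1) / 2 : ℝ) : ℂ) * (α ^ (k + 1) * y ^ 3) := by
      rw [pow_succ' a, pow_succ α]
      push_cast
      rw [hy]
      ring
    have hk : ‖((k * (k - 1) / 2 : ℝ) : ℂ)‖ ≤ (k : ℝ) ^ 2 := by
      rw [Complex.norm_real, Real.norm_eq_abs, abs_le]
      have : (0 : ℝ) ≤ k := k.cast_nonneg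
      have : (k : ℝ) ≤ (k : ℝ) ^ 2 := by exact_mod_cast Nat.le_self_pow two_ne_zero k
      constructor <;> nlinarith
    rw [e]
    refine (norm_add_le _ _).trans ?_
    rw [norm_mul, norm_mul, norm_mul, norm_pow, norm_pow]
    calc _ ≤ ρ * ((k : ℝ) ^ 3 * ρ ^ k * ‖y‖ ^ 3) + (k : ℝ) ^ 2 * (ρ ^ (k + 1) * ‖y‖ ^ 3) := by
          gcongr
      _ = ((k : ℝ) ^ 3 + k ^ 2) * (ρ ^ (k + 1) * ‖y‖ ^ 3) := by ring
      _ ≤ ((k + 1 : ℕ) : ℝ) ^ 3 * (ρ ^ (k + 1) * ‖y‖ ^ 3) := by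
          gcongr
          push_cast
          have : (0 : ℝ) ≤ k := k.cast_nonneg
          nlinarith
      _ = _ := by ring

/-- The Taylor remainder of a `k`-th power grows like `k³`; geometric decay absorbs this and makes
the estimates uniform in `k`. -/
lemma exists_cube_mul_pow_le {ρ : ℝ} (h0 : 0 < ρ) (h1 : ρ < 1) :
    ∃ B : ℝ, 0 ≤ B ∧ ∀ k : ℕ, ((k : ℝ) + 1) ^ 3 * ρ ^ k ≤ B := by
  obtain ⟨B, hB⟩ := (tendsto_pow_const_mul_const_pow_of_abs_lt_one 3
    (by rwa [abs_of_pos h0] : |ρ| < 1)).bddAbove_range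
  have h : ∀ k : ℕ, ((k : ℝ) + 1) ^ 3 * ρ ^ k ≤ B / ρ := fun k => by
    have := hB ⟨k + 1, rfl⟩
    simp only [Nat.cast_add, Nat.cast_one] at this
    rw [le_div_iff₀ h0]
    refine le_trans (le_of_eq ?_) this
    ring
  exact ⟨B / ρ, le_trans (by positivity) (h 0), h⟩

lemma alpha_pos : 0 < alpha := by
  rw [alpha]
  positivity

lemma alpha_le : alpha ≤ 9 / 11 := by
  rw [alpha, div_le_div_iff₀ (by positivity) (by norm_num)]
  have := pi_sq_div_lt
  linarith

section Neighbourhood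

variable {δ : ℝ} (hδ : δ ≤ 1 / 3) (hA : ∀ w ∈ discNbhd δ, ‖oneOne w‖ ≤ 9 / 20)
include hδ hA

omit hδ in
lemma le_norm_one_add_oneOne {w : ℂ} (hw : w ∈ discNbhd δ) : 11 / 20 ≤ ‖1 + oneOne w‖ := by
  have h := norm_sub_norm_le (1 : ℂ) (-oneOne w)
  rw [norm_one, norm_neg, sub_neg_eq_add] at h
  linarith [hA w hw]

omit hδ in
lemma one_add_oneOne_ne_zero {w : ℂ} (hw : w ∈ discNbhd δ) : 1 + oneOne w ≠ 0 :=
  norm_pos_iff.1 (lt_of_lt_of_le (by norm_num) (le_norm_one_add_oneOne hA hw))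

-- The quotient of the bounds `9/20` and `1 - 9/20 = 11/20`.
omit hδ in
lemma norm_ratio_le {w : ℂ} (hw : w ∈ discNbhd δ) : ‖ratio w‖ ≤ 9 / 11 := by
  have h := le_norm_one_add_oneOne hA hw
  rw [ratio, norm_div, div_le_iff₀ (by linarith)]
  linarith [hA w hw]

lemma differentiableAt_ratio {w : ℂ} (hw : w ∈ discNbhd δ) : DifferentiableAt ℂ ratio w := by
  have hw' := sector_subset_slitPlane (discNbhd_subset_sector hδ hw)
  exact (differentiableAt_oneOne hw').div
    ((differentiableAt_const _).add (differentiableAt_oneOne hw')) (one_add_oneOne_ne_zero hA hw)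

lemma differentiableAt_weight {w : ℂ} (hw : w ∈ discNbhd δ) : DifferentiableAt ℂ weight w := by
  have hw' := sector_subset_slitPlane (discNbhd_subset_sector hδ hw)
  exact ((((differentiableAt_oneAny hw').mul (differentiableAt_oneOne hw')).add
    (differentiableAt_oneTwo hw')).div
    (((differentiableAt_const _).add (differentiableAt_oneOne hw')).pow 2)
    (pow_ne_zero 2 (one_add_oneOne_ne_zero hA hw))).pow 2

lemma differentiableAt_doubleGF (k : ℕ) {w : ℂ} (hw : w ∈ discNbhd δ) :
    DifferentiableAt ℂ (doubleGF k) w :=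
  ((differentiableAt_ratio hδ hA hw).pow k).mul (differentiableAt_weight hδ hA hw)

lemma exists_norm_weight_le : ∃ M : ℝ, 0 ≤ M ∧ ∀ w ∈ discNbhd δ, ‖weight w‖ ≤ M := by
  obtain ⟨M₁, h01, h1⟩ := exists_bound_sector (f := oneAny)
    (fun w hw => (differentiableAt_oneAny hw).continuousAt.continuousWithinAt)
    hasExp_oneAny.isBigO_one
  obtain ⟨M₂, h02, h2⟩ := exists_bound_sector (f := oneTwo)
    (fun w hw => (differentiableAt_oneTwo hw).continuousAt.continuousWithinAt)
    hasExp_oneOne_oneTwo.2.isBigO_one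
  refine ⟨((M₁ * (9 / 20) + M₂) / (11 / 20) ^ 2) ^ 2, by positivity, fun w hw => ?_⟩
  have hw' := discNbhd_subset_sector hδ hw
  rw [weight, norm_pow, norm_div, norm_pow]
  have h3 : ‖oneAny w * oneOne w + oneTwo w‖ ≤ M₁ * (9 / 20) + M₂ := by
    refine (norm_add_le _ _).trans ?_
    rw [norm_mul]
    have := h1 w hw'
    have := h2 w hw'
    have := hA w hw
    gcongr
  have h4 := le_norm_one_add_oneOne hA hw
  gcongr

/-- The expansion of `doubleGF k` at the vertex, uniformly in `k`. -/
theorem exists_doubleGF_expansion : ∃ B : ℝ, ∀ k : ℕ, ∃ f₀ f₂ : ℂ, ∀ w ∈ discNbhd δ,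
    ‖doubleGF k w - (f₀
      + ((alpha ^ k * (weightSlope + k * (ratioSlope / alpha * weightRoot ^ 2)) : ℝ) : ℂ) * sqrtC w
      + f₂ * w)‖ ≤ B * ‖w‖ ^ (((3 : ℕ) : ℝ) / 2) := by
  have hα0 : (alpha : ℂ) ≠ 0 := by exact_mod_cast alpha_pos.ne'
  have hαn : ‖(alpha : ℂ)‖ ≤ 9 / 11 := by
    rw [Complex.norm_real, Real.norm_of_nonneg alpha_pos.le]; exact alpha_le
  have hU : discNbhd δ ⊆ sector := discNbhd_subset_sector hδ
  -- Thus `ratio = alpha * (1 + y)` with `y = O(√w)`. The powers of `1 + y` are expanded to second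
  -- order, and the terms `weight`, `y * weight` and `y² * weight` separately in `√w`, so that `k`
  -- enters only through explicit factors.
  set y : ℂ → ℂ := fun w => (alpha : ℂ)⁻¹ * (ratio w - alpha) with hy
  have hyE : HasExp y 0 (ratioSlope / alpha) := by
    have := (hasExp_ratio.sub (hasExp_const (alpha : ℂ))).const_mul (alpha : ℂ)⁻¹
    convert! this using 1
    · ring
    · ring
  obtain ⟨M, hM0, hM⟩ := exists_norm_weight_le hδ hA
  have hyb : ∀ w ∈ discNbhd δ, ‖y w‖ ≤ alpha⁻¹ * (9 / 11 + 9 / 11) := fun w hw => by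
    simp only [hy]
    rw [norm_mul, norm_inv, Complex.norm_real, Real.norm_of_nonneg alpha_pos.le]
    have := alpha_pos
    gcongr
    exact (norm_sub_le _ _).trans (add_le_add (norm_ratio_le hA hw) hαn)
  set Y := alpha⁻¹ * (9 / 11 + 9 / 11) with hY
  have hY0 : 0 ≤ Y := by have := alpha_pos; positivity
  have hsb : ∀ w ∈ discNbhd δ, ‖sqrtC w‖ ≤ 2 := fun w hw => by
    have h1 := norm_sqrtC_sq w
    have h2 := (hU hw).2.2
    nlinarith [norm_nonneg (sqrtC w)]
  obtain ⟨Cy, hCy0, hCy⟩ := exists_bound_of_isBigO hU 1 (f := y) (by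
    obtain ⟨c, hc⟩ := hyE
    have h3 := (isBigO_refl (fun w => sqrtC w) (nhdsWithin 0 sector)).mul
      (isBigO_quadratic (ratioSlope / alpha) c 0)
    have h4 := (isBigO_refl (fun w => sqrtC w) (nhdsWithin 0 sector)).mul
      (isBigO_quadratic 0 0 1)
    simp only [mul_one] at h3 h4
    have h5 : (fun w => sqrtC w ^ 3) =O[nhdsWithin 0 sector] fun w => sqrtC w :=
      h4.congr_left fun w => by ring
    refine ((hc.trans h5).add h3).congr (fun w => by ring) (fun w => by ring)) hyb
  have quad : ∀ (f : ℂ → ℂ) (a b : ℂ), HasExp f a b → (∃ M, ∀ w ∈ discNbhd δ, ‖f w‖ ≤ M) →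
      ∃ c : ℂ, ∃ C : ℝ, 0 ≤ C ∧ ∀ w ∈ discNbhd δ,
        ‖f w - (a + b * sqrtC w + c * w)‖ ≤ C * ‖sqrtC w‖ ^ 3 := by
    rintro f a b ⟨c, hc⟩ ⟨M, hM⟩
    simp only [sqrtC_sq] at hc
    obtain ⟨C, hC0, hC⟩ := exists_bound_of_isBigO hU 3 hc
      (M := M + (‖a‖ + ‖b‖ * 2 + ‖c‖ * 3)) (fun w hw => by
        refine (norm_sub_le _ _).trans (add_le_add (hM w hw) ?_)
        refine (norm_add_le _ _).trans (add_le_add ((norm_add_le _ _).trans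
          (add_le_add le_rfl ?_)) ?_)
        · rw [norm_mul]
          have := hsb w hw
          gcongr
        · rw [norm_mul]
          have := (hU hw).2.2
          gcongr)
    exact ⟨c, C, hC0, hC⟩
  have hE1 : HasExp (fun w => y w * weight w) 0 (ratioSlope / alpha * (weightRoot ^ 2 : ℝ)) := by
    have := hyE.mul hasExp_weight
    convert! this using 1
    · ring
    · ring
  have hE2 : HasExp (fun w => y w ^ 2 * weight w) 0 0 := by
    have := (hyE.pow 2).mul hasExp_weight
    convert! this using 1
    · ring
    · push_cast; ring
  obtain ⟨c₀, C₀, hC₀, h0⟩ := quad _ _ _ hasExp_weight ⟨M, hM⟩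
  obtain ⟨c₁, C₁, hC₁, h1⟩ := quad _ _ _ hE1 ⟨Y * M, fun w hw => by
    rw [norm_mul]
    have := hyb w hw
    have := hM w hw
    gcongr⟩
  obtain ⟨c₂, C₂, hC₂, h2⟩ := quad _ _ _ hE2 ⟨Y ^ 2 * M, fun w hw => by
    rw [norm_mul, norm_pow]
    have := hyb w hw
    have := hM w hw
    gcongr⟩
  obtain ⟨B, hB0, hB⟩ := exists_cube_mul_pow_le (ρ := 9 / 11) (by norm_num) (by norm_num)
  refine ⟨B * (Cy ^ 3 * M + C₀ + C₁ + C₂), fun k => ?_⟩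
  set q : ℂ := ((k * (k - 1) / 2 : ℝ) : ℂ) with hq
  have hk0 : (0 : ℝ) ≤ k := k.cast_nonneg
  have hqn : ‖q‖ ≤ ((k : ℝ) + 1) ^ 3 := by
    rw [hq, Complex.norm_real, Real.norm_eq_abs, abs_le]
    constructor <;> nlinarith [mul_nonneg hk0 hk0, mul_nonneg hk0 (mul_nonneg hk0 hk0)]
  have hkn : ‖(k : ℂ)‖ ≤ ((k : ℝ) + 1) ^ 3 := by
    rw [Complex.norm_natCast]
    nlinarith [mul_nonneg hk0 hk0, mul_nonneg hk0 (mul_nonneg hk0 hk0)]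
  have hk1 : (1 : ℝ) ≤ ((k : ℝ) + 1) ^ 3 := one_le_pow₀ (by linarith)
  have hk3 : (k : ℝ) ^ 3 ≤ ((k : ℝ) + 1) ^ 3 := by gcongr; linarith
  have hαk : ‖(alpha : ℂ) ^ k‖ ≤ (9 / 11) ^ k := by rw [norm_pow]; gcongr
  refine ⟨(alpha : ℂ) ^ k * (weightRoot ^ 2 : ℝ), (alpha : ℂ) ^ k * (c₀ + k * c₁ + q * c₂),
    fun w hw => ?_⟩
  have hpow := norm_pow_sub_le (norm_ratio_le hA hw) hαn (y := y w)
    (by simp only [hy]; field_simp; ring) k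
  rw [← hq] at hpow
  set T := ratio w ^ k - (alpha : ℂ) ^ k * (1 + k * y w + q * y w ^ 2) with hT
  have e : doubleGF k w - ((alpha : ℂ) ^ k * (weightRoot ^ 2 : ℝ)
      + ((alpha ^ k * (weightSlope + k * (ratioSlope / alpha * weightRoot ^ 2)) : ℝ) : ℂ) * sqrtC w
      + (alpha : ℂ) ^ k * (c₀ + k * c₁ + q * c₂) * w)
      = T * weight w
        + (alpha : ℂ) ^ k * (weight w - ((weightRoot ^ 2 : ℝ) + weightSlope * sqrtC w + c₀ * w))
        + (alpha : ℂ) ^ k * (k * (y w * weight w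
          - (0 + ratioSlope / alpha * (weightRoot ^ 2 : ℝ) * sqrtC w + c₁ * w)))
        + (alpha : ℂ) ^ k * (q * (y w ^ 2 * weight w - (0 + 0 * sqrtC w + c₂ * w))) := by
    rw [doubleGF_eq, hT]
    push_cast
    ring
  have hBk := hB k
  have b0 : ‖T * weight w‖ ≤ B * (Cy ^ 3 * M) * ‖sqrtC w‖ ^ 3 := by
    rw [norm_mul]
    have hyw := hCy w hw
    rw [pow_one] at hyw
    have hMw := hM w hw
    calc _ ≤ (((k : ℝ) + 1) ^ 3 * (9 / 11) ^ k * (Cy * ‖sqrtC w‖) ^ 3) * M := by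
          gcongr
          exact hpow.trans (by gcongr)
      _ ≤ (B * (Cy * ‖sqrtC w‖) ^ 3) * M := by gcongr
      _ = _ := by ring
  have gen : ∀ (x v : ℂ) (C : ℝ), 0 ≤ C → ‖x‖ ≤ ((k : ℝ) + 1) ^ 3 → ‖v‖ ≤ C * ‖sqrtC w‖ ^ 3 →
      ‖(alpha : ℂ) ^ k * (x * v)‖ ≤ B * C * ‖sqrtC w‖ ^ 3 := by
    intro x v C hC hx hv
    rw [norm_mul, norm_mul]
    calc _ ≤ (9 / 11) ^ k * (((k : ℝ) + 1) ^ 3 * (C * ‖sqrtC w‖ ^ 3)) := by gcongr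
      _ = ((k : ℝ) + 1) ^ 3 * (9 / 11) ^ k * (C * ‖sqrtC w‖ ^ 3) := by ring
      _ ≤ B * (C * ‖sqrtC w‖ ^ 3) := by gcongr
      _ = _ := by ring
  have b1 := gen 1 _ C₀ hC₀ (by simpa using hk1) (h0 w hw)
  rw [one_mul] at b1
  have b2 := gen k _ C₁ hC₁ hkn (h1 w hw)
  have b3 := gen q _ C₂ hC₂ hqn (h2 w hw)
  rw [e, ← norm_sqrtC_pow]
  refine (norm_add_le _ _).trans ((add_le_add ((norm_add_le _ _).trans
    (add_le_add ((norm_add_le _ _).trans (add_le_add b0 b1)) b2)) b3).trans (le_of_eq ?_))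
  ring

end Neighbourhood

/-! ### The limit law of the number of sites of multiplicity four. -/

lemma prob_le_one (n : ℕ) (E : (Fin (2 * n) → ℤˣ) → Prop) [DecidablePred E] :
    0 ≤ prob n E ∧ prob n E ≤ 1 := by
  rw [prob]
  refine ⟨by positivity, div_le_one_of_le₀ ?_ (by positivity)⟩
  exact_mod_cast Finset.card_filter_le _ _

/-- The distribution of `multRange 2`. -/
theorem exists_prob_multRange_two : ∃ C : ℝ, ∀ n : ℕ, 1 ≤ n → ∀ l : ℕ, 2 < l →
    |prob n (fun s => multRange 2 s = l) - alpha ^ l * (theta0 + (l : ℝ) * theta1)|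
      ≤ C / (n : ℝ) := by
  obtain ⟨δ, hδ0, hδ, hA⟩ := exists_norm_oneOne_le
  obtain ⟨B, hB⟩ := exists_doubleGF_expansion hδ hA
  obtain ⟨K, N, hK⟩ := two_mul_norm_coeff_div_centralBinom_le hδ0 3
  set φ : ℕ → ℝ := fun k => alpha ^ k * (weightSlope + k * (ratioSlope / alpha * weightRoot ^ 2))
    with hφ
  obtain ⟨D, hD0, hD⟩ := exists_cube_mul_pow_le (ρ := 9 / 11) (by norm_num) (by norm_num)
  set E : ℝ := D * (|weightSlope| + |ratioSlope / alpha * weightRoot ^ 2|) with hE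
  have hφb : ∀ k, |φ k| ≤ E := by
    intro k
    have hk0 : (0 : ℝ) ≤ k := k.cast_nonneg
    have hk1 : (1 : ℝ) ≤ ((k : ℝ) + 1) ^ 3 := one_le_pow₀ (by linarith)
    have hkn : (k : ℝ) ≤ ((k : ℝ) + 1) ^ 3 := by
      nlinarith [mul_nonneg hk0 hk0, mul_nonneg hk0 (mul_nonneg hk0 hk0)]
    simp only [hφ]
    rw [abs_mul, abs_of_nonneg (pow_nonneg alpha_pos.le k)]
    have h1 : |weightSlope + k * (ratioSlope / alpha * weightRoot ^ 2)|
        ≤ ((k : ℝ) + 1) ^ 3 * (|weightSlope| + |ratioSlope / alpha * weightRoot ^ 2|) := by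
      refine (abs_add_le _ _).trans ?_
      rw [abs_mul, Nat.abs_cast, mul_add]
      have := abs_nonneg weightSlope
      gcongr
      exact le_mul_of_one_le_left this hk1
    calc _ ≤ (9 / 11) ^ k
          * (((k : ℝ) + 1) ^ 3 * (|weightSlope| + |ratioSlope / alpha * weightRoot ^ 2|)) := by
          have := alpha_pos.le
          have := alpha_le
          gcongr
      _ = ((k : ℝ) + 1) ^ 3 * (9 / 11) ^ k
          * (|weightSlope| + |ratioSlope / alpha * weightRoot ^ 2|) := by ring
      _ ≤ _ := by
          rw [hE]
          have := hD k
          gcongr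
  have hE0 : 0 ≤ E := (abs_nonneg _).trans (hφb 0)
  -- The three parts bound the transferred error, the replacement of `2n / (2n - 1)` by `1`, and the
  -- finitely many `n < N + 2`, where a probability is simply at most `1`.
  refine ⟨|K * B| + E + (1 + E) * (N + 2), fun n hn l hl => ?_⟩
  obtain ⟨k, rfl⟩ : ∃ k, l = k + 3 := ⟨l - 3, by omega⟩
  rw [← slope_eq, sub_neg_eq_add]
  change |_ + φ k| ≤ _
  have hn0 : (0 : ℝ) < n := by exact_mod_cast hn
  rcases lt_or_ge n (N + 2) with hsmall | hlarge
  · obtain ⟨h1, h2⟩ := prob_le_one n (fun s => multRange 2 s = k + 3)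
    have h3 : |prob n (fun s => multRange 2 s = k + 3) + φ k| ≤ 1 + E :=
      (abs_add_le _ _).trans (add_le_add (by rwa [abs_of_nonneg h1]) (hφb k))
    refine h3.trans ?_
    rw [le_div_iff₀ hn0]
    have h4 : (n : ℝ) ≤ N + 2 := by exact_mod_cast hsmall.le
    have h5 : (1 + E) * n ≤ (1 + E) * (N + 2) := by gcongr
    have h6 : 0 ≤ |K * B| := abs_nonneg _
    linarith
  obtain ⟨f₀, f₂, hf⟩ := hB k
  change ∀ w ∈ discNbhd δ, ‖doubleGF k w - (f₀ + ((φ k : ℝ) : ℂ) * sqrtC w + f₂ * w)‖ ≤ _ at hf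
  set c : ℕ → ℝ := fun n => (coef (fun L => pairCount 2 (0 :: L) = k + 3) n).toReal with hc
  -- This is `f₀ + f₂ w` at `w = 1 - 4 z`; its coefficients vanish for `n ≥ 2`.
  set P : Polynomial ℂ := Polynomial.C (f₀ + f₂) + Polynomial.C (-4 * f₂) * Polynomial.X with hP
  have hdiff : DifferentiableOn ℂ
      (fun w => doubleGF k w - (f₀ + ((φ k : ℝ) : ℂ) * sqrtC w + f₂ * w)) (discNbhd δ) := by
    intro w hw
    have hw' := sector_subset_slitPlane (discNbhd_subset_sector hδ hw)
    exact ((differentiableAt_doubleGF hδ hA k hw).sub (((differentiableAt_const _).add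
      ((differentiableAt_const _).mul (differentiableAt_sqrtC hw'))).add
      ((differentiableAt_const _).mul differentiableAt_id))).differentiableWithinAt
  have hcs := hasSum_coef (F := doubleGF k) (fun w hw => (differentiableAt_doubleGF hδ hA k
    (ball_subset_discNbhd hδ0 hw)).differentiableWithinAt)
    (fun u h0 h1 => exists_gf_pairCount_two k h0 h1)
  have hsum : ∀ z : ℂ, ‖z‖ < 1 / 4 →
      HasSum (fun n => ((c n : ℂ) - ((φ k : ℝ) : ℂ) * sqrtCoeff n - P.coeff n) * z ^ n)
      ((fun w => doubleGF k w - (f₀ + ((φ k : ℝ) : ℂ) * sqrtC w + f₂ * w)) (1 - 4 * z)) := by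
    intro z hz
    have h := ((hcs z hz).sub ((hasSum_sqrtCoeff hz).mul_left ((φ k : ℝ) : ℂ))).sub
      (hasSum_polynomial P z)
    convert! h using 1
    · funext n; ring
    · simp only [hP, Polynomial.eval_add, Polynomial.eval_mul, Polynomial.eval_C,
        Polynomial.eval_X]
      ring
  have h := hK _ B _ hdiff hf hsum n (by omega)
  have hPn : P.coeff n = 0 := by
    rw [hP, Polynomial.coeff_add, Polynomial.coeff_C_of_ne_zero (by omega), Polynomial.coeff_C_mul,
      Polynomial.coeff_X_of_ne_one (by omega)]
    ring
  have e1 : ‖(c n : ℂ) - ((φ k : ℝ) : ℂ) * sqrtCoeff n‖ = |c n - φ k * sqrtCoeff n| := by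
    rw [← Real.norm_eq_abs, ← Complex.norm_real]
    push_cast
    rfl
  have e2 : (n : ℝ) ^ ((1 - (3 : ℕ) : ℝ) / 2) = 1 / (n : ℝ) := by
    rw [show ((1 - (3 : ℕ) : ℝ) / 2) = -1 by norm_num, Real.rpow_neg_one, one_div]
  rw [hPn, sub_zero, e1, e2, mul_one_div] at h
  have hBn : (0 : ℝ) < n.centralBinom := by exact_mod_cast n.centralBinom_pos
  have hn1 : (1 : ℝ) ≤ n := by exact_mod_cast hn
  have h2n : (0 : ℝ) < 2 * n - 1 := by linarith
  rw [prob_multRange hn two_pos]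
  change |2 * n * c n / n.centralBinom + φ k| ≤ _
  -- The coefficient of `√w` contributes `2n * sqrtCoeff n / C(2n, n) = -1 - 1 / (2n - 1)` times `φ
  -- k`.
  have e3 : 2 * n * c n / n.centralBinom + φ k
      = 2 * n / n.centralBinom * (c n - φ k * sqrtCoeff n) + -(φ k / (2 * n - 1)) := by
    have h3 : (2 * n - 1 : ℝ) ≠ 0 := h2n.ne'
    rw [sqrtCoeff]
    field_simp
    ring
  have b1 : |2 * n / n.centralBinom * (c n - φ k * sqrtCoeff n)| ≤ |K * B| / n := by
    rw [abs_mul, abs_of_nonneg (by positivity), div_mul_eq_mul_div]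
    exact h.trans (by gcongr; exact le_abs_self _)
  have b2 : |-(φ k / (2 * n - 1))| ≤ E / n := by
    rw [abs_neg, abs_div, abs_of_pos h2n]
    have := hφb k
    gcongr
    linarith
  rw [e3]
  refine (abs_add_le _ _).trans ((add_le_add b1 b2).trans ?_)
  rw [← add_div]
  refine div_le_div_of_nonneg_right ?_ hn0.le
  have h9 : 0 ≤ (1 + E) * ((N : ℝ) + 2) := by positivity
  linarith

end SimpleWalk

theorem mainTheorem9 :
    (fun n : ℕ => SimpleWalk.prob n (fun s => SimpleWalk.multRange 1 s = 0)
        - (1 / 4 - 1 / (4 * (n : ℝ)) - 1 / (48 * (n : ℝ) ^ 2) + 13 / (144 * (n : ℝ) ^ 3)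
            + 421 / (2880 * (n : ℝ) ^ 4)))
      =O[atTop] (fun n : ℕ => 1 / (n : ℝ) ^ 5) ∧
    (fun n : ℕ => SimpleWalk.prob n (fun s => SimpleWalk.multRange 1 s = 1)
        - (1 / 2 - 5 / (24 * (n : ℝ) ^ 2) - 11 / (36 * (n : ℝ) ^ 3)
            - 511 / (1440 * (n : ℝ) ^ 4)))
      =O[atTop] (fun n : ℕ => 1 / (n : ℝ) ^ 5) ∧
    (fun n : ℕ => SimpleWalk.prob n (fun s => SimpleWalk.multRange 1 s = 2)
        - (1 / 4 + 1 / (4 * (n : ℝ)) + 11 / (48 * (n : ℝ) ^ 2) + 31 / (144 * (n : ℝ) ^ 3)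
            + 601 / (2880 * (n : ℝ) ^ 4)))
      =O[atTop] (fun n : ℕ => 1 / (n : ℝ) ^ 5) ∧
    (∃ C : ℝ, ∀ n : ℕ, 1 ≤ n → ∀ l : ℕ, 2 < l →
      |SimpleWalk.prob n (fun s => SimpleWalk.multRange 2 s = l)
        - SimpleWalk.alpha ^ l * (SimpleWalk.theta0 + (l : ℝ) * SimpleWalk.theta1)|
      ≤ C / (n : ℝ)) := by
  refine ⟨?_, ?_, ?_, SimpleWalk.exists_prob_multRange_two⟩
  · obtain ⟨C, N, h⟩ := SimpleWalk.exists_prob_multRange_one_zero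
    refine IsBigO.of_bound C ?_
    filter_upwards [eventually_ge_atTop N] with n hn
    rw [Real.norm_eq_abs, Real.norm_of_nonneg (by positivity), mul_one_div]
    exact h n hn
  · obtain ⟨C, N, h⟩ := SimpleWalk.exists_prob_multRange_one_one
    refine IsBigO.of_bound C ?_
    filter_upwards [eventually_ge_atTop N] with n hn
    rw [Real.norm_eq_abs, Real.norm_of_nonneg (by positivity), mul_one_div]
    exact h n hn
  · obtain ⟨C, N, h⟩ := SimpleWalk.exists_prob_multRange_one_two
    refine IsBigO.of_bound C ?_
    filter_upwards [eventually_ge_atTop N] with n hn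
    rw [Real.norm_eq_abs, Real.norm_of_nonneg (by positivity), mul_one_div]
    exact h n hn
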